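/- Let $V=\{0,\dots,n-1\}$ with $n\ge 1$. A conditional independence query on $V$ consists of an unordered pair of distinct vertices $u,v$ and a set $S\subseteq V\setminus\{u,v\}$. A CI oracle $\mathcal Q$ answers every query with "independent" or "not independent", arbitrarily. In a DAG $D$ on $V$, a path between $u$ and $v$ is a sequence of distinct vertices, consecutive ones joined by an arc in either direction; $u$ and $v$ are d-separated by $S$ if every such path has an internal vertex that either is not a collider on the path and lies in $S$, or is a collider on the path (both path edges at it point to it) and neither it nor any of its descendants lies in $S$. The d-separation distance of $D$ to $\mathcal Q$ is the number of queries whose answer by $\mathcal Q$ differs from the one given by d-separation in $D$. Two DAGs are Markov equivalent if they have the same d-separations; the distance depends only on the Markov equivalence class. Bayesian network structure learning (BNSL): given $V$, access to a CI oracle $\mathcal Q$, and $k\in\mathbb N$, output a DAG belonging to the unique Markov equivalence class within d-separation distance at most $k$ to $\mathcal Q$, or report that no such class exists, or report that it is not unique. Theorem. BNSL can be solved in time $n^{2k+O(1)}\,2^{n(k+O(1))}$. That is, there are a single deterministic random access machine program (given $n$ and $k$ as input, with query access to $\mathcal Q$) and a constant $c$ such that for all $n\ge1$, all $k\ge 0$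 and all oracles $\mathcal Q$ on $n$ vertices, the program halts with a correct output after at most $n^{2k+c}\,2^{n(k+c)}$ steps. Here register moves, indirect memory accesses, truncated subtractions, comparisons and the loading of constants cost one step, an addition $y+z$ costs $1+z$ steps, and an oracle query costs $1+n$ steps. -/

import Mathlib

namespace BNSL

/-! ## Bayesian networks, d-separation and Markov equivalence -/

/-- A Bayesian network structure on `V`: a directed graph without directed cycles. -/
structure DAG (V : Type*) extends Digraph V where
  /-- No vertex reaches itself by a nonempty directed path (so there are no loops either). -/
  acyclic : ∀ v, ¬ Relation.TransGen Adj v v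

/-- The skeleton: the underlying undirected graph. -/
def DAG.skeleton {V : Type*} (D : DAG V) : SimpleGraph V :=
  D.toDigraph.toSimpleGraphInclusive

/-- A path of the skeleton is blocked by `S` if it has an internal vertex `b`, with neighbours `a`
and `c` on the path, such that either `b` is not a collider on the path and belongs to `S`, or `b`
is a collider on the path and neither `b` nor any of its descendants belongs to `S`. -/
def DAG.Blocked {V : Type*} (D : DAG V) (S : Finset V) {u v : V} (p : D.skeleton.Path u v) : Prop :=
  ∃ a b c : V, [a, b, c] <:+: p.1.support ∧
    ((¬ (D.Adj a b ∧ D.Adj c b) ∧ b ∈ S) ∨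
      ((D.Adj a b ∧ D.Adj c b) ∧ b ∉ S ∧ ∀ d, Relation.TransGen D.Adj b d → d ∉ S))

/-- `u` and `v` are d-separated by `S` in `D`. -/
def DAG.DSep {V : Type*} (D : DAG V) (u v : V) (S : Finset V) : Prop :=
  ∀ p : D.skeleton.Path u v, D.Blocked S p

/-- The conditional independence queries on the vertices `0, …, n - 1`: an unordered pair of
distinct vertices (listed increasingly) and a set of other vertices. -/
structure CIQuery (n : ℕ) where
  u : Fin n
  v : Fin n
  S : Finset (Fin n)
  lt : u < v
  u_notMem : u ∉ S
  v_notMem : v ∉ S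

/-- There are finitely many queries, so that the count in `dist` below is an honest one. -/
instance (n : ℕ) : Finite (CIQuery n) :=
  Finite.of_injective (fun q : CIQuery n => (q.u, q.v, q.S)) (by
    rintro ⟨u, v, S, _, _, _⟩ ⟨u', v', S', _, _, _⟩ h
    simp only [Prod.mk.injEq] at h
    obtain ⟨rfl, rfl, rfl⟩ := h
    rfl)

/-- An oracle answers every query, `true` meaning "independent". Nothing is assumed about the
answers. -/
def CIOracle (n : ℕ) : Type := CIQuery n → Bool

/-- The statement `u ⫫ v | S` queried by `q` holds in `D`. -/
def DAG.Indep {n : ℕ} (D : DAG (Fin n)) (q : CIQuery n) : Prop := D.DSep q.u q.v q.S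

/-- Markov equivalence: the same conditional independencies are encoded. -/
def MarkovEquiv {n : ℕ} (D D' : DAG (Fin n)) : Prop := ∀ q : CIQuery n, D.Indep q ↔ D'.Indep q

/-- The d-separation distance of `D` to the oracle `Q`: the number of queries whose answer differs
from the one implied by `D`. It depends only on the Markov equivalence class of `D`. -/
noncomputable def DAG.dist {n : ℕ} (D : DAG (Fin n)) (Q : CIOracle n) : ℕ :=
  {q : CIQuery n | ¬ (Q q = true ↔ D.Indep q)}.ncard

/-! ## The structure learning problem -/

/-- The possible outputs of Bayesian network structure learning. -/
inductive Answer (n : ℕ) where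
  | dag (D : DAG (Fin n))
  | nonexistent
  | notUnique

/-- `IsCorrect Q k a`: the output `a` is correct for the oracle `Q` and the error bound `k`.
A DAG has to be a member of the only Markov equivalence class within distance `k` to `Q`. -/
def IsCorrect {n : ℕ} (Q : CIOracle n) (k : ℕ) : Answer n → Prop
  | .dag D => D.dist Q ≤ k ∧ ∀ D' : DAG (Fin n), D'.dist Q ≤ k → MarkovEquiv D D'
  | .nonexistent => ∀ D : DAG (Fin n), ¬ D.dist Q ≤ k
  | .notUnique => ∃ D D' : DAG (Fin n), D.dist Q ≤ k ∧ D'.dist Q ≤ k ∧ ¬ MarkovEquiv D D'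

/-! ## Random access machines with an oracle

Structured programs over finitely many registers (each program mentions finitely many) and an
indirectly addressed memory, all holding natural numbers. Instructions and tests take unit time,
except that an addition is charged by the amount by which it increases a number, and that a query
is charged for reading its conditioning set. Hence no number ever exceeds the largest number in
the input and the program plus the elapsed time: unit cost cannot be abused through long words. -/

/-- The contents of the registers and of the memory. -/
structure State where
  reg : ℕ → ℕ
  mem : ℕ → ℕ

/-- Elementary instructions; the arguments are names of registers, except for the number `c`. -/
inductive Instr where
  /-- `x := c` -/
  | const (x c : ℕ)
  /-- `x := y` -/
  | copy (x y : ℕ)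
  /-- `x := y + z` -/
  | add (x y z : ℕ)
  /-- `x := y - z`, or `0` if `y < z` -/
  | sub (x y z : ℕ)
  /-- `x := mem[y]` -/
  | load (x y : ℕ)
  /-- `mem[x] := y` -/
  | store (x y : ℕ)
  /-- `x := 1` if the oracle answers "independent" to the query with vertices `u`, `v` (in either
  order) and the conditioning set of those `w < n` with `mem[p + w] ≠ 0`, and otherwise `x := 0`
  (also if this is not a legal query). -/
  | query (x u v p : ℕ)

/-- Programs. -/
inductive Prog where
  | skip
  | instr (i : Instr)
  | seq (P P' : Prog)
  /-- `if x < y then P else P'` -/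
  | ite (x y : ℕ) (P P' : Prog)
  /-- `while x < y do P` -/
  | loop (x y : ℕ) (P : Prog)

/-- Writing `a` into the register `x`. -/
def State.setReg (s : State) (x a : ℕ) : State := { s with reg := Function.update s.reg x a }

/-- Writing `a` into the memory cell `i`. -/
def State.setMem (s : State) (i a : ℕ) : State := { s with mem := Function.update s.mem i a }

open Classical in
/-- The oracle's answer to a query instruction, for the vertices `a`, `b` and the conditioning set
whose indicator is `χ`. -/
noncomputable def CIOracle.answer {n : ℕ} (Q : CIOracle n) (a b : ℕ) (χ : ℕ → ℕ) : ℕ :=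
  if ∃ q : CIQuery n, Q q = true ∧
      ((a = (q.u : ℕ) ∧ b = (q.v : ℕ)) ∨ (a = (q.v : ℕ) ∧ b = (q.u : ℕ))) ∧
      (∀ w : Fin n, w ∈ q.S ↔ χ w ≠ 0)
  then 1 else 0

/-- The effect of an instruction. -/
noncomputable def Instr.run {n : ℕ} (Q : CIOracle n) (s : State) : Instr → State
  | const x c => s.setReg x c
  | copy x y => s.setReg x (s.reg y)
  | add x y z => s.setReg x (s.reg y + s.reg z)
  | sub x y z => s.setReg x (s.reg y - s.reg z)
  | load x y => s.setReg x (s.mem (s.reg y))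
  | store x y => s.setMem (s.reg x) (s.reg y)
  | query x u v p => s.setReg x (Q.answer (s.reg u) (s.reg v) fun w => s.mem (s.reg p + w))

/-- The time taken by an instruction, on `n` vertices. -/
def Instr.cost (n : ℕ) (s : State) : Instr → ℕ
  | add _ _ z => 1 + s.reg z
  | query _ _ _ _ => 1 + n
  | _ => 1

/-- `Exec Q P s t s'`: with oracle `Q`, the program `P` started in the state `s` halts after time
`t` in the state `s'`. -/
inductive Exec {n : ℕ} (Q : CIOracle n) : Prog → State → ℕ → State → Prop where
  | skip (s : State) : Exec Q .skip s 1 s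
  | instr (i : Instr) (s : State) : Exec Q (.instr i) s (i.cost n s) (i.run Q s)
  | seq {P P' : Prog} {s s' s'' : State} {t t' : ℕ} :
      Exec Q P s t s' → Exec Q P' s' t' s'' → Exec Q (.seq P P') s (t + t') s''
  | ite_pos {x y : ℕ} {P P' : Prog} {s s' : State} {t : ℕ} :
      s.reg x < s.reg y → Exec Q P s t s' → Exec Q (.ite x y P P') s (1 + t) s'
  | ite_neg {x y : ℕ} {P P' : Prog} {s s' : State} {t : ℕ} :
      ¬ s.reg x < s.reg y → Exec Q P' s t s' → Exec Q (.ite x y P P') s (1 + t) s'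
  | loop_step {x y : ℕ} {P : Prog} {s s' s'' : State} {t t' : ℕ} :
      s.reg x < s.reg y → Exec Q P s t s' → Exec Q (.loop x y P) s' t' s'' →
      Exec Q (.loop x y P) s (1 + t + t') s''
  | loop_done {x y : ℕ} {P : Prog} {s : State} :
      ¬ s.reg x < s.reg y → Exec Q (.loop x y P) s 1 s

/-- The initial state: `n` in register `0`, `k` in register `1`, zeros elsewhere. The oracle is
accessible only through queries. -/
def initState (n k : ℕ) : State where
  reg x := if x = 0 then n else if x = 1 then k else 0
  mem _ := 0

/-- The final state `s` presents the output `a`: register `0` holds `0` for "none exists", `2` for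
"not unique" and `1` for a DAG, whose adjacency matrix is then in the memory cells `u * n + v`. -/
def Presents {n : ℕ} (s : State) : Answer n → Prop
  | .dag D => s.reg 0 = 1 ∧ ∀ u v : Fin n,
      (D.Adj u v → s.mem (u * n + v) = 1) ∧ (¬ D.Adj u v → s.mem (u * n + v) = 0)
  | .nonexistent => s.reg 0 = 0
  | .notUnique => s.reg 0 = 2

end BNSL

/-!
A graph within distance `k` of the oracle `Q` is a perfect map for the answers that arise from `Q` by
reversing the answers to at most `k` queries. There are at most `n ^ 2 * 2 ^ n` queries, so that the
sets of reversed queries can be listed as the numbers below `M ^ K` written in base `M`, where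
`M = n ^ 2 * 2 ^ n` and `K = min k M`: the `K` digits are codes of queries, and the code `0`, which no
query has, serves as padding (`exists_digitSet`, `dist_le_of_isPerfect`). This gives the factor
`n ^ (2 * k) * 2 ^ (n * k)`, and it remains to decide in time `2 ^ O(n)` whether a given list of
answers `ρ` has a perfect map.

This is done without evaluating d-separation. If `v` is a sink of a perfect map on a set `W`, the
parents of `v` are the vertices `p` dependent on `v` given all other vertices of `W`, and all
independencies involving `v` are determined by these parents and by the independencies on `W` without
`v` (`SinkCond`). Deleting a sink from a perfect map leaves a perfect map (`DAG.IsPerfect.del`) for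
which this condition holds (`DAG.IsPerfect.sinkCond`); conversely, if it holds, a perfect map on `W`
without `v` extends by the sink `v` with the arcs from these parents (`DAG.IsPerfect.addSink`). So a
table indexed by the sets `W`, with entries that name a possible sink, is filled in order of the codes
of the sets, and a perfect map is read off by following the sinks down from the set of all vertices
(`IsChoice.ne_zero`, `IsChoice.exists_dag`). The facts about d-separation rest on its description by
active walks, which may repeat vertices: a shortest active walk is a path, as closed detours can be
cut out of it (`DAG.ActiveSeq.cut`).

The table is the same for the same answers `ρ`. Hence two perfect maps that are read off and differ
belong to different lists of answers and are not Markov equivalent, while equal ones show that all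
graphs tested so far are equivalent. It is enough to keep the first graph found and to compare the
later ones with it (`Record.step`).

The machine program is obtained from a small language of expressions with bounded quantifiers and
bounded recursion, whose compiler has a polynomial time bound in terms of a cap for all numbers
(`Expr.exists_compilesWithin`). The cap is `16 ^ (n + 1)`, which exceeds all codes and addresses that
occur. The vectors of digits are run through by a counter with carries (`digit_add_one`).
-/

namespace BNSL

/-! ### d-separation by active walks -/

section DSeparation

variable {V : Type*} {D : DAG V} {S : Finset V} {u v w a b c : V} {W : Finset V}

/-- Some vertex of `S` is reachable from `b` by a directed path, possibly the empty one. -/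
def DAG.AncOf (D : DAG V) (S : Finset V) (b : V) : Prop :=
  b ∈ S ∨ ∃ d ∈ S, Relation.TransGen D.Adj b d

/-- The consecutive vertices `a`, `b`, `c` do not block a walk at `b`. -/
def DAG.Open (D : DAG V) (S : Finset V) (a b c : V) : Prop :=
  (D.Adj a b ∧ D.Adj c b → D.AncOf S b) ∧ (¬(D.Adj a b ∧ D.Adj c b) → b ∉ S)

/-- `D.Trail S u a b`: there is an active walk given `S` that starts at `u` and whose last step goes
from `a` to `b`. Vertices may be repeated. -/
inductive DAG.Trail (D : DAG V) (S : Finset V) (u : V) : V → V → Prop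
  | single {b : V} : D.skeleton.Adj u b → DAG.Trail D S u u b
  | snoc {a b c : V} : DAG.Trail D S u a b → D.skeleton.Adj b c → D.Open S a b c →
      DAG.Trail D S u b c

/-- `u` and `w` are joined by an active walk given `S`. -/
def DAG.Conn (D : DAG V) (S : Finset V) (u w : V) : Prop := u = w ∨ ∃ a, D.Trail S u a w

/-- The first `m + 1` terms of `x` are an active walk from `u` to `w` given `S`. -/
def DAG.ActiveSeq (D : DAG V) (S : Finset V) (u w : V) (m : ℕ) (x : ℕ → V) : Prop :=
  x 0 = u ∧ x m = w ∧ (∀ i < m, D.skeleton.Adj (x i) (x (i + 1))) ∧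
    ∀ i, i + 1 < m → D.Open S (x i) (x (i + 1)) (x (i + 2))

theorem DAG.skeleton_adj : D.skeleton.Adj a b ↔ a ≠ b ∧ (D.Adj a b ∨ D.Adj b a) := Iff.rfl

theorem DAG.ne_of_adj (h : D.Adj a b) : a ≠ b := by
  rintro rfl
  exact D.acyclic _ (.single h)

theorem DAG.not_adj_symm (h : D.Adj a b) : ¬ D.Adj b a :=
  fun h' => D.acyclic _ (.tail (.single h) h')

theorem DAG.skeleton_of_adj (h : D.Adj a b) : D.skeleton.Adj a b :=
  ⟨D.ne_of_adj h, Or.inl h⟩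

theorem DAG.Open.symm (h : D.Open S a b c) : D.Open S c b a :=
  ⟨fun h' => h.1 h'.symm, fun h' => h.2 fun h'' => h' h''.symm⟩

theorem DAG.AncOf.of_transGen (h : D.AncOf S b) (hab : Relation.TransGen D.Adj a b) :
    D.AncOf S a := by
  rcases h with h | ⟨d, hd, h⟩
  exacts [.inr ⟨b, h, hab⟩, .inr ⟨d, hd, hab.trans h⟩]

theorem DAG.not_blocked_iff (p : D.skeleton.Path u w) :
    ¬ D.Blocked S p ↔ ∀ i, i + 1 < p.1.length →
      D.Open S (p.1.getVert i) (p.1.getVert (i + 1)) (p.1.getVert (i + 2)) := by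
  have key : ∀ a b c : V, [a, b, c] <:+: p.1.support ↔ ∃ i, i + 1 < p.1.length ∧
      p.1.getVert i = a ∧ p.1.getVert (i + 1) = b ∧ p.1.getVert (i + 2) = c := by
    intro a b c
    have hget : ∀ j, j ≤ p.1.length → p.1.support[j]? = some (p.1.getVert j) := by
      intro j hj
      rw [List.getElem?_eq_getElem (by simp; omega), SimpleGraph.Walk.getVert_eq_support_getElem _ hj]
    rw [List.infix_iff_getElem?]
    constructor
    · rintro ⟨k, hk, h⟩
      have hl : 3 + k ≤ p.1.length + 1 := by simpa using hk
      have h0 := h 0 (by simp)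
      have h1 := h 1 (by simp)
      have h2 := h 2 (by simp)
      rw [hget _ (by omega)] at h0 h1 h2
      refine ⟨k, by omega, ?_, ?_, ?_⟩
      · simpa using h0
      · simpa [add_comm] using h1
      · simpa [add_comm] using h2
    · rintro ⟨k, hk, rfl, rfl, rfl⟩
      refine ⟨k, by simp; omega, fun i hi => ?_⟩
      have hi : i < 3 := by simpa using hi
      rw [hget _ (by omega)]
      interval_cases i <;> simp [add_comm]
  constructor
  · intro h i hi
    refine ⟨fun hc => ?_, fun hc hb => ?_⟩
    · by_contra hb
      refine h ⟨_, _, _, (key _ _ _).2 ⟨i, hi, rfl, rfl, rfl⟩, .inr ⟨hc, ?_, ?_⟩⟩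
      · exact fun h' => hb (.inl h')
      · exact fun d hd hdS => hb (.inr ⟨d, hdS, hd⟩)
    · exact h ⟨_, _, _, (key _ _ _).2 ⟨i, hi, rfl, rfl, rfl⟩, .inl ⟨hc, hb⟩⟩
  · rintro h ⟨a, b, c, habc, hb⟩
    obtain ⟨i, hi, rfl, rfl, rfl⟩ := (key _ _ _).1 habc
    rcases hb with ⟨hc, hS⟩ | ⟨hc, hS, hd⟩
    · exact (h i hi).2 hc hS
    · rcases (h i hi).1 hc with h' | ⟨d, hdS, h'⟩
      exacts [hS h', hd d h' hdS]

theorem DAG.Trail.exists_activeSeq (h : D.Trail S u a b) :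
    ∃ m x, D.ActiveSeq S u b (m + 1) x ∧ x m = a := by
  induction h with
  | @single b h =>
    refine ⟨0, fun i => if i = 0 then u else b, ⟨rfl, rfl, ?_, ?_⟩, rfl⟩
    · intro i hi
      obtain rfl : i = 0 := by omega
      simpa using h
    · intro i hi
      omega
  | @snoc a b c _ hbc ho ih =>
    obtain ⟨m, x, ⟨h0, hm, hadj, hop⟩, ha⟩ := ih
    refine ⟨m + 1, fun i => if i ≤ m + 1 then x i else c, ⟨by simpa using h0, by simp, ?_, ?_⟩,
      by simpa using hm⟩
    · intro i hi
      rcases Nat.lt_or_ge i (m + 1) with hi' | hi'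
      · simpa [hi'.le, Nat.le_of_lt_succ hi'] using hadj i hi'
      · obtain rfl : i = m + 1 := by omega
        simpa [hm] using hbc
    · intro i hi
      rcases Nat.lt_or_ge (i + 1) (m + 1) with hi' | hi'
      · have e1 : i ≤ m + 1 := by omega
        have e2 : i ≤ m := by omega
        have e3 : i + 1 ≤ m := by omega
        simpa [e1, e2, e3] using hop i hi'
      · obtain rfl : i = m := by omega
        simpa [hm, ha] using ho

/-- A walk that leaves `x i` along an arc meets an open collider or stays directed. -/
theorem DAG.ActiveSeq.ancOf_or_transGen {m : ℕ} {x : ℕ → V} (h : D.ActiveSeq S u w m x) {i j : ℕ}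
    (hij : i ≤ j) (hj : j + 1 ≤ m) (hi : D.Adj (x i) (x (i + 1))) :
    D.AncOf S (x i) ∨
      Relation.TransGen D.Adj (x i) (x (j + 1)) ∧ D.Adj (x j) (x (j + 1)) := by
  induction j, hij using Nat.le_induction with
  | base => exact .inr ⟨.single hi, hi⟩
  | succ j hij ih =>
    rcases ih (by omega) with ih | ⟨ih, ih'⟩
    · exact .inl ih
    · rcases (h.2.2.1 (j + 1) hj).2 with hf | hb
      · exact .inr ⟨.tail ih hf, hf⟩
      · exact .inl (((h.2.2.2 j (by omega)).1 ⟨ih', hb⟩).of_transGen ih)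

/-- A closed detour can be cut out of an active walk: if it leaves `x i` along an arc, it has a
collider below `x i` as the graph is acyclic, so that `x i` may become a collider. -/
theorem DAG.ActiveSeq.cut {m : ℕ} {x : ℕ → V} (h : D.ActiveSeq S u w m x) {i j : ℕ}
    (hij : i < j) (hj : j ≤ m) (hx : x i = x j) :
    D.ActiveSeq S u w (m - (j - i)) fun t => if t ≤ i then x t else x (t + (j - i)) := by
  obtain ⟨h0, hm, hadj, hop⟩ := id h
  refine ⟨by simpa using h0, ?_, fun t ht => ?_, fun t ht => ?_⟩
  · rcases hj.eq_or_lt with rfl | hj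
    · have e : j - (j - i) = i := by omega
      simp [e, hx, hm]
    · have e : ¬ m - (j - i) ≤ i := by omega
      have e' : m - (j - i) + (j - i) = m := by omega
      simp [e, e', hm]
  · rcases lt_trichotomy t i with hti | rfl | hti
    · simpa [hti.le, Nat.succ_le_of_lt hti] using hadj t (by omega)
    · have e : t + 1 + (j - t) = j + 1 := by omega
      simpa [e, hx] using hadj j (by omega)
    · have e1 : ¬ t ≤ i := by omega
      have e2 : ¬ t + 1 ≤ i := by omega
      have e : t + 1 + (j - i) = t + (j - i) + 1 := by omega
      simpa [e, e1, e2] using hadj (t + (j - i)) (by omega)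
  · rcases lt_trichotomy (t + 1) i with hti | hti | hti
    · have e1 : t ≤ i := by omega
      have e2 : t + 2 ≤ i := by omega
      simpa [e1, hti.le, e2] using hop t (by omega)
    · subst hti
      have e : t + 2 + (j - (t + 1)) = j + 1 := by omega
      have ho1 := hop t (by omega)
      have ho2 := hop (j - 1) (by omega)
      have e' : j - 1 + 1 = j := by omega
      have e'' : j - 1 + 2 = j + 1 := by omega
      rw [e', e'', ← hx] at ho2
      suffices D.Open S (x t) (x (t + 1)) (x (j + 1)) by simpa [e] using this
      refine ⟨fun hc => ?_, fun hc => ?_⟩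
      · rcases (hadj (t + 1) (by omega)).2 with hf | hb
        · rcases h.ancOf_or_transGen (j := j - 1) (by omega) (by omega) hf with h' | ⟨h', -⟩
          · exact h'
          · rw [e', ← hx] at h'
            exact (D.acyclic _ h').elim
        · exact ho1.1 ⟨hc.1, hb⟩
      · by_cases hc1 : D.Adj (x t) (x (t + 1))
        · exact ho2.2 fun h' => hc ⟨hc1, h'.2⟩
        · exact ho1.2 fun h' => hc1 h'.1
    · rcases Nat.lt_or_ge i t with hit | hit
      · have e1 : ¬ t ≤ i := by omega
        have e2 : ¬ t + 1 ≤ i := by omega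
        have e3 : ¬ t + 2 ≤ i := by omega
        have e4 : t + 1 + (j - i) = t + (j - i) + 1 := by omega
        have e5 : t + 2 + (j - i) = t + (j - i) + 2 := by omega
        simpa [e1, e2, e3, e4, e5] using hop (t + (j - i)) (by omega)
      · obtain rfl : i = t := by omega
        have e4 : i + 1 + (j - i) = j + 1 := by omega
        have e5 : i + 2 + (j - i) = j + 2 := by omega
        simpa [e4, e5, hx] using hop j (by omega)

theorem exists_walk_of_seq {G : SimpleGraph V} (m : ℕ) (x : ℕ → V)
    (h : ∀ i < m, G.Adj (x i) (x (i + 1))) :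
    ∃ p : G.Walk (x 0) (x m), p.length = m ∧ ∀ i ≤ m, p.getVert i = x i := by
  induction m generalizing x with
  | zero => exact ⟨.nil, rfl, fun i hi => by simp [Nat.le_zero.1 hi]⟩
  | succ m ih =>
    obtain ⟨p, hp, hv⟩ := ih (fun i => x (i + 1)) fun i hi => h (i + 1) (by omega)
    refine ⟨.cons (h 0 (by omega)) p, by simp [hp], fun i hi => ?_⟩
    cases i with
    | zero => simp
    | succ i => simpa using hv i (by omega)

theorem DAG.ActiveSeq.exists_path (h : ∃ m x, D.ActiveSeq S u w m x) :
    ∃ p : D.skeleton.Path u w, ¬ D.Blocked S p := by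
  classical
  -- a shortest active walk is a path, by `DAG.ActiveSeq.cut`
  obtain ⟨x, hx⟩ := Nat.find_spec h
  have hmin := fun k => Nat.find_min h (m := k)
  generalize Nat.find h = m at hx hmin
  have hinj : ∀ i j, i < j → j ≤ m → x i ≠ x j := fun i j hij hj he =>
    hmin (m - (j - i)) (by omega) ⟨_, hx.cut hij hj he⟩
  obtain ⟨p, hp, hv⟩ := exists_walk_of_seq m x hx.2.2.1
  obtain ⟨rfl, rfl, -, hop⟩ := hx
  have hpath : p.IsPath := by
    rw [← SimpleGraph.Walk.IsPath.getVert_injOn_iff]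
    intro i hi j hj he
    simp only [Set.mem_ofPred_eq, hp] at hi hj
    rw [hv i hi, hv j hj] at he
    rcases lt_trichotomy i j with hij | rfl | hij
    exacts [(hinj i j hij hj he).elim, rfl, (hinj j i hij hi he.symm).elim]
  refine ⟨⟨p, hpath⟩, (DAG.not_blocked_iff _).2 fun i hi => ?_⟩
  simp only [hp] at hi ⊢
  rw [hv i (by omega), hv (i + 1) (by omega), hv (i + 2) (by omega)]
  exact hop i hi

/-- Active walks and active paths connect the same vertices. -/
theorem DAG.not_dSep_iff : ¬ D.DSep u w S ↔ D.Conn S u w := by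
  rw [DAG.DSep, not_forall]
  constructor
  · rintro ⟨p, hp⟩
    rw [DAG.not_blocked_iff] at hp
    have key : ∀ i, i + 1 ≤ p.1.length →
        D.Trail S u (p.1.getVert i) (p.1.getVert (i + 1)) := by
      intro i
      induction i with
      | zero =>
        intro hi
        have := p.1.adj_getVert_succ (i := 0) (by omega)
        rw [SimpleGraph.Walk.getVert_zero] at this ⊢
        exact .single this
      | succ i ih =>
        intro hi
        exact .snoc (ih (by omega)) (p.1.adj_getVert_succ (by omega)) (hp i (by omega))
    rcases Nat.eq_zero_or_pos p.1.length with h0 | h0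
    · exact .inl (SimpleGraph.Walk.eq_of_length_eq_zero h0)
    · have := key (p.1.length - 1) (by omega)
      rw [Nat.sub_add_cancel h0, SimpleGraph.Walk.getVert_length] at this
      exact .inr ⟨_, this⟩
  · rintro (rfl | ⟨a, h⟩)
    · exact DAG.ActiveSeq.exists_path ⟨0, fun _ => u, rfl, rfl, by simp, by simp⟩
    · obtain ⟨m, x, hx, -⟩ := h.exists_activeSeq
      exact DAG.ActiveSeq.exists_path ⟨_, x, hx⟩

theorem DAG.Trail.skel (h : D.Trail S u a b) : D.skeleton.Adj a b := by
  cases h <;> assumption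

/-- A trail can be run backwards, at the end of another one that arrives with the same step. -/
theorem DAG.Trail.append_reverse (h : D.Trail S w b c) :
    ∀ {x : V}, D.Trail S x c b → ∃ z, D.Trail S x z w := by
  induction h with
  | single h => exact fun hx => ⟨_, hx⟩
  | snoc h hbc ho ih => exact fun hx => ih (.snoc hx h.skel.symm ho.symm)

theorem DAG.Conn.symm (h : D.Conn S u w) : D.Conn S w u := by
  rcases h with rfl | ⟨a, h⟩
  · exact .inl rfl
  · exact .inr (h.append_reverse (.single h.skel.symm))

theorem DAG.dSep_iff_not_conn : D.DSep u w S ↔ ¬ D.Conn S u w := by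
  rw [← DAG.not_dSep_iff, not_not]

theorem DAG.dSep_comm : D.DSep u w S ↔ D.DSep w u S :=
  not_iff_not.1 (by
    rw [DAG.not_dSep_iff, DAG.not_dSep_iff]
    exact ⟨DAG.Conn.symm, DAG.Conn.symm⟩)

/-! ### Removing and adding a sink -/

theorem DAG.exists_sink [Finite V] (D : DAG V) (hW : W.Nonempty)
    (h : ∀ a b, D.Adj a b → a ∈ W ∧ b ∈ W) : ∃ v ∈ W, ∀ x, ¬ D.Adj v x := by
  have : IsTrans V (flip (Relation.TransGen D.Adj)) := ⟨fun a b c h1 h2 => h2.trans h1⟩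
  have : Std.Irrefl (flip (Relation.TransGen D.Adj)) := ⟨D.acyclic⟩
  obtain ⟨v, hv, hmin⟩ := (Finite.wellFounded_of_trans_of_irrefl
    (flip (Relation.TransGen D.Adj))).has_min (W : Set V) hW
  exact ⟨v, hv, fun x hx => hmin x (h _ _ hx).2 (.single hx)⟩

/-- Deletion of all arcs at `v`. -/
def DAG.del (D : DAG V) (v : V) : DAG V where
  Adj a b := D.Adj a b ∧ a ≠ v ∧ b ≠ v
  acyclic x h := D.acyclic x (Relation.TransGen.mono (fun _ _ h => h.1) _ _ h)

theorem DAG.del_adj : (D.del v).Adj a b ↔ D.Adj a b ∧ a ≠ v ∧ b ≠ v := Iff.rfl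

theorem DAG.not_transGen_of_sink (hv : ∀ x, ¬ D.Adj v x) : ¬ Relation.TransGen D.Adj v a := by
  intro h
  obtain ⟨x, hx, -⟩ := Relation.TransGen.head'_iff.1 h
  exact hv x hx

theorem DAG.transGen_del (hv : ∀ x, ¬ D.Adj v x) (hb : b ≠ v) (h : Relation.TransGen D.Adj a b) :
    Relation.TransGen (D.del v).Adj a b := by
  have ne : ∀ {x y}, D.Adj x y → x ≠ v := by
    rintro x y h rfl
    exact hv _ h
  induction h with
  | single h => exact .single ⟨h, ne h, hb⟩
  | tail _ h ih => exact .tail (ih (ne h)) ⟨h, ne h, hb⟩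

theorem DAG.ancOf_del (hv : ∀ x, ¬ D.Adj v x) (hvS : v ∉ S) :
    (D.del v).AncOf S b ↔ D.AncOf S b := by
  constructor
  · rintro (h | ⟨d, hd, h⟩)
    exacts [.inl h, .inr ⟨d, hd, Relation.TransGen.mono (fun _ _ h => h.1) _ _ h⟩]
  · rintro (h | ⟨d, hd, h⟩)
    · exact .inl h
    · refine .inr ⟨d, hd, DAG.transGen_del hv ?_ h⟩
      rintro rfl
      exact hvS hd

theorem DAG.open_del (hv : ∀ x, ¬ D.Adj v x) (hvS : v ∉ S) (ha : a ≠ v) (hb : b ≠ v) (hc : c ≠ v) :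
    (D.del v).Open S a b c ↔ D.Open S a b c := by
  simp [DAG.Open, DAG.ancOf_del hv hvS, DAG.del_adj, ha, hb, hc]

theorem DAG.skeleton_del : (D.del v).skeleton.Adj a b ↔ D.skeleton.Adj a b ∧ a ≠ v ∧ b ≠ v := by
  simp only [DAG.skeleton_adj, DAG.del_adj]
  tauto

theorem DAG.trail_of_del (hv : ∀ x, ¬ D.Adj v x) (hvS : v ∉ S) (h : (D.del v).Trail S u a b) :
    D.Trail S u a b := by
  induction h with
  | single h => exact .single (DAG.skeleton_del.1 h).1
  | snoc h hbc ho ih =>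
    have h1 := DAG.skeleton_del.1 h.skel
    have h2 := DAG.skeleton_del.1 hbc
    exact .snoc ih h2.1 ((DAG.open_del hv hvS h1.2.1 h1.2.2 h2.2.2).1 ho)

/-- Off `S`, a sink blocks every walk through it. -/
theorem DAG.Open.ne_sink (hv : ∀ x, ¬ D.Adj v x) (hvS : v ∉ S) (hab : D.skeleton.Adj a b)
    (hbc : D.skeleton.Adj b c) (h : D.Open S a b c) : b ≠ v := by
  rintro rfl
  rcases h.1 ⟨hab.2.resolve_right (hv _), hbc.2.resolve_left (hv _)⟩ with h | ⟨d, -, h⟩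
  exacts [hvS h, DAG.not_transGen_of_sink hv h]

theorem DAG.Trail.del (hv : ∀ x, ¬ D.Adj v x) (hvS : v ∉ S) (hu : u ≠ v) (h : D.Trail S u a b) :
    a ≠ v ∧ (b ≠ v → (D.del v).Trail S u a b) := by
  induction h with
  | single h => exact ⟨hu, fun hb => .single (DAG.skeleton_del.2 ⟨h, hu, hb⟩)⟩
  | snoc h hbc ho ih =>
    have hb := ho.ne_sink hv hvS h.skel hbc
    exact ⟨hb, fun hc => .snoc (ih.2 hb) (DAG.skeleton_del.2 ⟨hbc, hb, hc⟩)
      ((DAG.open_del hv hvS ih.1 hb hc).2 ho)⟩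

theorem DAG.conn_del (hv : ∀ x, ¬ D.Adj v x) (hvS : v ∉ S) (hu : u ≠ v) (hw : w ≠ v) :
    (D.del v).Conn S u w ↔ D.Conn S u w := by
  constructor
  · rintro (h | ⟨a, h⟩)
    exacts [.inl h, .inr ⟨a, DAG.trail_of_del hv hvS h⟩]
  · rintro (h | ⟨a, h⟩)
    exacts [.inl h, .inr ⟨a, (h.del hv hvS hu).2 hw⟩]

/-- A sink is connected to whatever one of its parents outside `S` is connected to. -/
theorem DAG.conn_sink (hv : ∀ x, ¬ D.Adj v x) (huS : u ∉ S) (hu : u ≠ v) :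
    D.Conn S u v ↔ ∃ p, p ∉ S ∧ D.Adj p v ∧ D.Conn S u p := by
  constructor
  · rintro (h | ⟨p, h⟩)
    · exact (hu h).elim
    · have hpv : D.Adj p v := h.skel.2.resolve_right (hv _)
      cases h with
      | single h => exact ⟨u, huS, hpv, .inl rfl⟩
      | @snoc a _ _ h h' ho =>
        exact ⟨p, ho.2 fun hc => hv _ hc.2, hpv, .inr ⟨_, h⟩⟩
  · rintro ⟨p, hp, hpv, rfl | ⟨a, h⟩⟩
    · exact .inr ⟨_, .single (DAG.skeleton_of_adj hpv)⟩
    · exact .inr ⟨_, .snoc h (DAG.skeleton_of_adj hpv) ⟨fun hc => (hv _ hc.2).elim, fun _ => hp⟩⟩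

/-- A trail entering `b` along an arc goes on along a directed path, as long as `b` has no
descendants in `S`. -/
theorem DAG.Trail.extend_transGen (h : D.Trail S u a b) (hab : D.Adj a b)
    (hbv : Relation.TransGen D.Adj b v) (hb : ¬ D.AncOf S b) : ∃ c, D.Trail S u c v := by
  induction hbv using Relation.TransGen.head_induction_on generalizing a with
  | @single b hbv =>
    exact ⟨b, .snoc h (DAG.skeleton_of_adj hbv)
      ⟨fun hc => (DAG.not_adj_symm hbv hc.2).elim, fun _ hbS => hb (.inl hbS)⟩⟩
  | @head b c hbc hcv ih =>
    exact ih (.snoc h (DAG.skeleton_of_adj hbc)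
      ⟨fun hc => (DAG.not_adj_symm hbc hc.2).elim, fun _ hbS => hb (.inl hbS)⟩) hbc
      fun hc => hb (hc.of_transGen (.single hbc))

variable [DecidableEq V]

theorem DAG.Trail.insert_sink (hv : ∀ x, ¬ D.Adj v x) (hvS : v ∉ S) (h : D.Trail S u a b) :
    D.Trail (insert v S) u a b := by
  induction h with
  | single h => exact .single h
  | snoc h hbc ho ih =>
    refine .snoc ih hbc ⟨fun hc => ?_, fun hc => ?_⟩
    · rcases ho.1 hc with h' | ⟨d, hd, h'⟩
      exacts [.inl (Finset.mem_insert_of_mem h'), .inr ⟨d, Finset.mem_insert_of_mem hd, h'⟩]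
    · have := ho.ne_sink hv hvS h.skel hbc
      simp [this, ho.2 hc]

/-- If a walk uses that a collider is an ancestor of `v`, then it can be redirected to `v`. -/
theorem DAG.Trail.of_insert (h : D.Trail (insert v S) u a b) :
    D.Trail S u a b ∨ ∃ c, D.Trail S u c v := by
  induction h with
  | single h => exact .inl (.single h)
  | @snoc a b c _ hbc ho ih =>
    rcases ih with ih | ih
    · by_cases hc : D.Adj a b ∧ D.Adj c b
      · by_cases hb : D.AncOf S b
        · exact .inl (.snoc ih hbc ⟨fun _ => hb, fun h => (h hc).elim⟩)
        · right
          rcases ho.1 hc with h | ⟨d, hd, h⟩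
          · rcases Finset.mem_insert.1 h with rfl | h
            exacts [⟨_, ih⟩, (hb (.inl h)).elim]
          · rcases Finset.mem_insert.1 hd with rfl | hd
            exacts [ih.extend_transGen hc.1 h hb, (hb (.inr ⟨d, hd, h⟩)).elim]
      · refine .inl (.snoc ih hbc ⟨fun h => (hc h).elim, fun _ hb => ho.2 hc ?_⟩)
        exact Finset.mem_insert_of_mem hb
    · exact .inr ih

/-- Conditioning on a sink connects, in addition, the vertices that are both connected to it. -/
theorem DAG.conn_insert_sink (hv : ∀ x, ¬ D.Adj v x) (hvS : v ∉ S) (hu : u ≠ v) (hw : w ≠ v) :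
    D.Conn (insert v S) u w ↔ D.Conn S u w ∨ D.Conn S u v ∧ D.Conn S w v := by
  constructor
  · intro h
    by_contra! hcon
    have hsymm := h.symm
    rcases h with rfl | ⟨a, h⟩
    · exact hcon.1 (.inl rfl)
    rcases hsymm with rfl | ⟨a', h'⟩
    · exact hcon.1 (.inl rfl)
    have h1 := h.of_insert.resolve_left fun h => hcon.1 (.inr ⟨_, h⟩)
    have h2 := h'.of_insert.resolve_left fun h => hcon.1 (DAG.Conn.symm (.inr ⟨_, h⟩))
    exact hcon.2 (.inr h1) (.inr h2)
  · rintro (h | ⟨h1, h2⟩)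
    · rcases h with h | ⟨a, h⟩
      exacts [.inl h, .inr ⟨a, h.insert_sink hv hvS⟩]
    · obtain ⟨a, h1⟩ := h1.resolve_left hu
      obtain ⟨b, h2⟩ := h2.resolve_left hw
      have ha := h1.skel.2.resolve_right (hv _)
      have hb := h2.skel.2.resolve_right (hv _)
      -- the two walks meet at the collider `v`
      exact .inr ((h2.insert_sink hv hvS).append_reverse (.snoc (h1.insert_sink hv hvS) h2.skel.symm
        ⟨fun _ => .inl (Finset.mem_insert_self _ _), fun h => (h ⟨ha, hb⟩).elim⟩))

/-! ### Perfect maps, one sink at a time -/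

/-- All arcs of `D` lie within `W`, and on `W` it has exactly the independencies `ρ`. -/
def DAG.IsPerfect (D : DAG V) (ρ : V → V → Finset V → Prop) (W : Finset V) : Prop :=
  (∀ a b, D.Adj a b → a ∈ W ∧ b ∈ W) ∧
    ∀ u ∈ W, ∀ w ∈ W, u ≠ w → ∀ S ⊆ W, u ∉ S → w ∉ S → (D.DSep u w S ↔ ρ u w S)

/-- The vertices of `W` that have to be the parents of `v`, if `v` is the last vertex after `W`. -/
def IsParent (ρ : V → V → Finset V → Prop) (v : V) (W : Finset V) (p : V) : Prop :=
  p ∈ W ∧ ¬ ρ p v (W.erase p)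

/-- The independencies that involve `v` are determined by those on `W` and by the parents of `v`
in the way they are when `v` is a sink. -/
def SinkCond (ρ : V → V → Finset V → Prop) (v : V) (W : Finset V) : Prop :=
  ∀ u ∈ W, ∀ S ⊆ W, u ∉ S →
    (ρ u v S ↔ ¬ ∃ p, p ∉ S ∧ IsParent ρ v W p ∧ (p = u ∨ ¬ ρ u p S)) ∧
    ∀ w ∈ W, w ∉ S → w ≠ u → (ρ u w (insert v S) ↔ ρ u w S ∧ (ρ u v S ∨ ρ w v S))

variable {ρ : V → V → Finset V → Prop}

theorem DAG.adj_sink_iff (hW : ∀ a b, D.Adj a b → a ∈ insert v W ∧ b ∈ insert v W)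
    (hv : ∀ x, ¬ D.Adj v x) (hvW : v ∉ W) {p : V} :
    D.Adj p v ↔ p ∈ W ∧ ¬ D.DSep p v (W.erase p) := by
  have hpar : ∀ {q}, D.Adj q v → q ∈ W := fun {q} hq =>
    (Finset.mem_insert.1 (hW _ _ hq).1).resolve_left (DAG.ne_of_adj hq)
  rw [DAG.not_dSep_iff]
  constructor
  · exact fun h => ⟨hpar h, .inr ⟨_, .single (DAG.skeleton_of_adj h)⟩⟩
  · rintro ⟨hp, h⟩
    have hpv : p ≠ v := by rintro rfl; exact hvW hp
    obtain ⟨q, hq, hqv, -⟩ := (DAG.conn_sink hv (by simp) hpv).1 h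
    have : q = p := by
      by_contra hne
      exact hq (Finset.mem_erase.2 ⟨hne, hpar hqv⟩)
    rwa [← this]

theorem DAG.IsPerfect.del (h : D.IsPerfect ρ (insert v W)) (hv : ∀ x, ¬ D.Adj v x) (hvW : v ∉ W) :
    (D.del v).IsPerfect ρ W := by
  have ne : ∀ {x}, x ∈ W → x ≠ v := by rintro x hx rfl; exact hvW hx
  refine ⟨fun a b hab => ?_, fun u hu w hw huw S hS huS hwS => ?_⟩
  · have := h.1 a b hab.1
    simpa [hab.2.1, hab.2.2] using this
  · rw [DAG.dSep_iff_not_conn, DAG.conn_del hv (fun h => hvW (hS h)) (ne hu) (ne hw),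
      ← DAG.dSep_iff_not_conn]
    exact h.2 u (Finset.mem_insert_of_mem hu) w (Finset.mem_insert_of_mem hw) huw S
      (hS.trans (Finset.subset_insert _ _)) huS hwS

theorem DAG.IsPerfect.sinkCond (h : D.IsPerfect ρ (insert v W)) (hv : ∀ x, ¬ D.Adj v x)
    (hvW : v ∉ W) : SinkCond ρ v W := by
  have ne : ∀ {x}, x ∈ W → x ≠ v := by rintro x hx rfl; exact hvW hx
  have mem : ∀ {x}, x ∈ W → x ∈ insert v W := fun hx => Finset.mem_insert_of_mem hx
  have hWv := Finset.subset_insert v W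
  have hpar : ∀ p, IsParent ρ v W p ↔ D.Adj p v := by
    intro p
    rw [IsParent, DAG.adj_sink_iff h.1 hv hvW]
    refine and_congr_right fun hp => ?_
    rw [h.2 p (mem hp) v (Finset.mem_insert_self _ _) (ne hp) _ ((Finset.erase_subset _ _).trans hWv)
      (by simp) (by simp [hvW])]
  intro u hu S hS huS
  have hvS : v ∉ S := fun h => hvW (hS h)
  refine ⟨?_, fun w hw hwS hwu => ?_⟩
  · rw [← h.2 u (mem hu) v (Finset.mem_insert_self _ _) (ne hu) S (hS.trans hWv) huS hvS,
      DAG.dSep_iff_not_conn, DAG.conn_sink hv huS (ne hu), not_iff_not]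
    refine exists_congr fun p => and_congr_right fun hp => ?_
    rw [hpar]
    refine and_congr_right fun hpv => ?_
    rcases eq_or_ne p u with rfl | hpu
    · simp [DAG.Conn]
    · have hpW := ((hpar p).2 hpv).1
      rw [← h.2 u (mem hu) p (mem hpW) hpu.symm S (hS.trans hWv) huS hp, DAG.not_dSep_iff]
      simp [hpu]
  · have e := fun T => h.2 u (mem hu) w (mem hw) hwu.symm T
    rw [← e S (hS.trans hWv) huS hwS, ← e (insert v S) (Finset.insert_subset_insert _ hS)
      (by simp [huS, ne hu]) (by simp [hwS, ne hw]),
      ← h.2 u (mem hu) v (Finset.mem_insert_self _ _) (ne hu) S (hS.trans hWv) huS hvS,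
      ← h.2 w (mem hw) v (Finset.mem_insert_self _ _) (ne hw) S (hS.trans hWv) hwS hvS]
    simp only [DAG.dSep_iff_not_conn, DAG.conn_insert_sink hv hvS (ne hu) (ne hw)]
    tauto

/-- The graph with the additional arcs from the elements of `P` to `v`. -/
def DAG.addSink (D : DAG V) (v : V) (P : V → Prop) (hv : ∀ x, ¬ D.Adj v x) (hP : ¬ P v) :
    DAG V where
  Adj a b := D.Adj a b ∨ P a ∧ b = v
  acyclic x h := by
    have hsink : ∀ {a b}, (D.Adj a b ∨ P a ∧ b = v) → a ≠ v := by
      rintro a b (h' | h') rfl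
      exacts [hv _ h', hP h'.1]
    have key : ∀ {a b}, Relation.TransGen (fun a b => D.Adj a b ∨ P a ∧ b = v) a b → b ≠ v →
        Relation.TransGen D.Adj a b := by
      intro a b h
      induction h with
      | single h => exact fun hb => .single (h.resolve_right fun h => hb h.2)
      | tail _ h ih => exact fun hb => .tail (ih (hsink h)) (h.resolve_right fun h => hb h.2)
    rcases eq_or_ne x v with rfl | hx
    · obtain ⟨y, hy, -⟩ := Relation.TransGen.head'_iff.1 h
      exact hsink hy rfl
    · exact D.acyclic x (key h hx)

theorem DAG.IsPerfect.addSink (h : D.IsPerfect ρ W) (hv : ∀ x, ¬ D.Adj v x) (hvW : v ∉ W)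
    (hsymm : ∀ u w S, ρ u w S ↔ ρ w u S) (hc : SinkCond ρ v W) :
    (D.addSink v (IsParent ρ v W) hv fun h => hvW h.1).IsPerfect ρ (insert v W) := by
  set D' := D.addSink v (IsParent ρ v W) hv fun h => hvW h.1 with hD'
  have ne : ∀ {x}, x ∈ W → x ≠ v := by rintro x hx rfl; exact hvW hx
  have adj : ∀ {a b}, D'.Adj a b ↔ D.Adj a b ∨ IsParent ρ v W a ∧ b = v := Iff.rfl
  have hv' : ∀ x, ¬ D'.Adj v x := by
    intro x hx
    rcases adj.1 hx with h' | h'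
    exacts [hv _ h', hvW h'.1.1]
  have hadjv : ∀ p, D'.Adj p v ↔ IsParent ρ v W p := by
    intro p
    rw [adj]
    constructor
    · rintro (h' | h')
      exacts [(hvW (h.1 _ _ h').2).elim, h'.1]
    · exact fun h' => .inr ⟨h', rfl⟩
  have hdel : D'.del v = D := by
    have : (D'.del v).Adj = D.Adj := by
      ext a b
      rw [DAG.del_adj, adj]
      constructor
      · rintro ⟨h' | h', -, hb⟩
        exacts [h', (hb h'.2).elim]
      · exact fun h' => ⟨.inl h', ne (h.1 _ _ h').1, ne (h.1 _ _ h').2⟩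
    cases D
    exact DAG.mk.congr_simp _ _ (Digraph.ext this) _
  -- queries within `W`
  have base : ∀ u ∈ W, ∀ w ∈ W, u ≠ w → ∀ S ⊆ W, u ∉ S → w ∉ S → (¬ D'.Conn S u w ↔ ρ u w S) := by
    intro u hu w hw huw S hS huS hwS
    rw [← h.2 u hu w hw huw S hS huS hwS, DAG.dSep_iff_not_conn,
      ← DAG.conn_del hv' (fun h => hvW (hS h)) (ne hu) (ne hw), hdel]
  -- queries for the new vertex
  have sink : ∀ u ∈ W, ∀ S ⊆ W, u ∉ S → (¬ D'.Conn S u v ↔ ρ u v S) := by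
    intro u hu S hS huS
    rw [(hc u hu S hS huS).1, DAG.conn_sink hv' huS (ne hu), not_iff_not]
    refine exists_congr fun p => and_congr_right fun hp => ?_
    rw [hadjv]
    refine and_congr_right fun hpv => ?_
    rcases eq_or_ne p u with rfl | hpu
    · simp [DAG.Conn]
    · rw [← base u hu p hpv.1 hpu.symm S hS huS hp]
      simp [hpu]
  refine ⟨fun a b hab => ?_, fun u hu w hw huw S hS huS hwS => ?_⟩
  · rcases adj.1 hab with h' | ⟨h', rfl⟩
    · exact ⟨Finset.mem_insert_of_mem (h.1 _ _ h').1, Finset.mem_insert_of_mem (h.1 _ _ h').2⟩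
    · exact ⟨Finset.mem_insert_of_mem h'.1, Finset.mem_insert_self _ _⟩
  · rw [DAG.dSep_iff_not_conn]
    rcases Finset.mem_insert.1 hu with rfl | hu'
    · have hw := (Finset.mem_insert.1 hw).resolve_left huw.symm
      rw [hsymm, ← sink w hw S ((Finset.subset_insert_iff_of_notMem huS).1 hS) hwS]
      exact not_congr ⟨DAG.Conn.symm, DAG.Conn.symm⟩
    rcases Finset.mem_insert.1 hw with rfl | hw'
    · exact sink u hu' S ((Finset.subset_insert_iff_of_notMem hwS).1 hS) huS
    by_cases hvS : v ∈ S
    · obtain ⟨T, hvT, rfl⟩ : ∃ T, v ∉ T ∧ S = insert v T :=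
        ⟨S.erase v, by simp, (Finset.insert_erase hvS).symm⟩
      have hT : T ⊆ W := (Finset.subset_insert_iff_of_notMem hvT).1
        ((Finset.subset_insert _ _).trans hS)
      have huT : u ∉ T := fun h => huS (Finset.mem_insert_of_mem h)
      have hwT : w ∉ T := fun h => hwS (Finset.mem_insert_of_mem h)
      rw [DAG.conn_insert_sink hv' hvT (ne hu') (ne hw'), (hc u hu' T hT huT).2 w hw' hwT huw.symm,
        ← base u hu' w hw' huw T hT huT hwT, ← sink u hu' T hT huT, ← sink w hw' T hT hwT]
      tauto
    · exact base u hu' w hw' huw S ((Finset.subset_insert_iff_of_notMem hvS).1 hS) huS hwS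

end DSeparation

/-! ### A language of expressions and its compiler -/

/-- Expressions denoting numbers. Variables are de Bruijn indices. -/
inductive Expr where
  /-- a constant -/
  | lit (c : Fin 3)
  /-- a variable -/
  | var (i : ℕ)
  /-- the content of one of the first 24 registers -/
  | glob (i : Fin 24)
  /-- the content of a memory cell -/
  | load (a : Expr)
  /-- addition -/
  | add (a b : Expr)
  /-- truncated subtraction -/
  | sub (a b : Expr)
  /-- `if a < b then x else y` -/
  | ite (a b x y : Expr)
  /-- primitive recursion: starting from `init`, apply `body` for `i < bound`. In `body`, variable
  `0` is `i` and variable `1` is the value reached so far. -/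
  | iter (bound init body : Expr)
  /-- `f`, with the values of `a`, `b`, `c` for its variables `0`, `1`, `2` -/
  | call (f a b c : Expr)

/-- Iteration of a binary function whose first argument counts the steps. -/
def iterate (f : ℕ → ℕ → ℕ) (a : ℕ) : ℕ → ℕ
  | 0 => a
  | i + 1 => f i (iterate f a i)

/-- The value of an expression, where `g` lists the contents of the global registers, `m` the memory
and `l` the values of the variables. Sums and all numbers read from registers or from the memory are
cut off at `g 2`. -/
def Expr.eval (g : Fin 24 → ℕ) (m : ℕ → ℕ) : Expr → List ℕ → ℕ
  | .lit c, _ => c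
  | .var i, l => l.getD i 0
  | .glob i, _ => min (g i) (g 2)
  | .load a, l => min (m (a.eval g m l)) (g 2)
  | .add a b, l => min (a.eval g m l + b.eval g m l) (g 2)
  | .sub a b, l => a.eval g m l - b.eval g m l
  | .ite a b x y, l => if a.eval g m l < b.eval g m l then x.eval g m l else y.eval g m l
  | .iter bound init body, l =>
      iterate (fun i acc => body.eval g m (i :: acc :: l)) (init.eval g m l) (bound.eval g m l)
  | .call f a b c, l => f.eval g m [a.eval g m l, b.eval g m l, c.eval g m l]

theorem iterate_le {F : ℕ → ℕ → ℕ} {a N B : ℕ} (ha : a ≤ B) (hN : N ≤ B)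
    (hF : ∀ i acc, i ≤ B → acc ≤ B → F i acc ≤ B) : ∀ i ≤ N, iterate F a i ≤ B
  | 0, _ => ha
  | i + 1, hi => hF _ _ (by omega) (iterate_le ha hN hF i (by omega))

theorem Expr.eval_le {g : Fin 24 → ℕ} {m : ℕ → ℕ} (hg : 2 ≤ g 2) (e : Expr) :
    ∀ {l : List ℕ}, (∀ x ∈ l, x ≤ g 2) → e.eval g m l ≤ g 2 := by
  induction e with
  | lit c => intro l _; simp only [eval]; omega
  | var i =>
    intro l hl
    simp only [eval, List.getD_eq_getElem?_getD]
    rcases h : l[i]? with _ | x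
    · simp
    · exact hl x (List.mem_of_getElem? h)
  | glob i => intro l _; simp [eval]
  | load a => intro l _; simp [eval]
  | add a b => intro l _; simp [eval]
  | sub a b iha _ => intro l hl; exact (Nat.sub_le _ _).trans (iha hl)
  | ite a b x y _ _ ihx ihy =>
    intro l hl
    simp only [eval]
    split_ifs
    exacts [ihx hl, ihy hl]
  | iter bound init body ihb ihi ihbody =>
    intro l hl
    simp only [eval]
    refine iterate_le (ihi hl) (ihb hl) (fun i acc hi hacc => ihbody fun x hx => ?_) _ le_rfl
    simp only [List.mem_cons] at hx
    rcases hx with rfl | rfl | hx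
    exacts [hi, hacc, hl x hx]
  | call f a b c ihf iha ihb ihc =>
    intro l hl
    refine ihf fun x hx => ?_
    simp only [List.mem_cons, List.not_mem_nil, or_false] at hx
    rcases hx with rfl | rfl | rfl
    exacts [iha hl, ihb hl, ihc hl]

/-- Replaces the content of register `d` by that of register `2` if it is larger. -/
def clip (d : ℕ) : Prog := .ite 2 d (.instr (.copy d 2)) .skip

/-- The program computing an expression into register `d`, if the variables are in the registers
listed by `locs`. It leaves the memory and the registers below `d` as they are. -/
def Expr.compile : Expr → List ℕ → ℕ → Prog
  | .lit c, _, d => .instr (.const d c)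
  | .var i, locs, d =>
      match locs[i]? with
      | some r => .instr (.copy d r)
      | none => .instr (.const d 0)
  | .glob i, _, d => .seq (.instr (.copy d i)) (clip d)
  | .load a, locs, d => .seq (a.compile locs d) (.seq (.instr (.load d d)) (clip d))
  | .add a b, locs, d => .seq (a.compile locs d) (.seq (b.compile locs (d + 1))
      (.seq (.instr (.add d d (d + 1))) (clip d)))
  | .sub a b, locs, d => .seq (a.compile locs d) (.seq (b.compile locs (d + 1))
      (.instr (.sub d d (d + 1))))
  | .ite a b x y, locs, d => .seq (a.compile locs d) (.seq (b.compile locs (d + 1))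
      (.ite d (d + 1) (x.compile locs d) (y.compile locs d)))
  | .iter bound init body, locs, d => .seq (bound.compile locs d) (.seq (init.compile locs (d + 2))
      (.seq (.instr (.const (d + 1) 0)) (.seq
        (.loop (d + 1) d (.seq (body.compile ((d + 1) :: (d + 2) :: locs) (d + 3))
          (.seq (.instr (.copy (d + 2) (d + 3))) (.seq (.instr (.const (d + 3) 1))
            (.instr (.add (d + 1) (d + 1) (d + 3)))))))
        (.instr (.copy d (d + 2))))))
  | .call f a b c, locs, d => .seq (a.compile locs d) (.seq (b.compile locs (d + 1))
      (.seq (c.compile locs (d + 2)) (.seq (f.compile [d, d + 1, d + 2] (d + 3))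
        (.instr (.copy d (d + 3))))))

/-- `Computes Q P d s T a`: started in `s`, the program `P` halts within time `T` with `a` in
register `d`, the memory and the registers below `d` being as before. -/
def Computes {n : ℕ} (Q : CIOracle n) (P : Prog) (d : ℕ) (s : State) (T a : ℕ) : Prop :=
  ∃ t s', Exec Q P s t s' ∧ t ≤ T ∧ s'.reg d = a ∧ (∀ i < d, s'.reg i = s.reg i) ∧ s'.mem = s.mem

/-- What the compiled program of `e` is to achieve, the exponent `c` bounding its time. -/
def Expr.CompilesWithin (e : Expr) (c : ℕ) : Prop :=
  ∀ (n : ℕ) (Q : CIOracle n) (g : Fin 24 → ℕ) (m : ℕ → ℕ) (l locs : List ℕ) (d : ℕ) (s : State),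
    2 ≤ g 2 → 24 ≤ d → (∀ i : Fin 24, s.reg i = g i) → s.mem = m → (∀ x ∈ l, x ≤ g 2) →
    List.Forall₂ (fun r x => r < d ∧ s.reg r = x) locs l →
    Computes Q (e.compile locs d) d s ((g 2 + 2) ^ c) (e.eval g m l)

@[simp] theorem State.setReg_mem (s : State) (x a : ℕ) : (s.setReg x a).mem = s.mem := rfl

@[simp] theorem State.setReg_reg (s : State) (x a : ℕ) :
    (s.setReg x a).reg = Function.update s.reg x a := rfl

section Computes

variable {n : ℕ} {Q : CIOracle n}

theorem Computes.mono {P : Prog} {d : ℕ} {s : State} {T T' a : ℕ} (h : Computes Q P d s T a)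
    (hT : T ≤ T') : Computes Q P d s T' a := by
  obtain ⟨t, s', h, ht, h'⟩ := h
  exact ⟨t, s', h, ht.trans hT, h'⟩

theorem exec_clip (s : State) (d : ℕ) :
    Exec Q (clip d) s 2 (s.setReg d (min (s.reg d) (s.reg 2))) := by
  by_cases h : s.reg 2 < s.reg d
  · have := Exec.ite_pos (P' := .skip) h (Exec.instr (Q := Q) (.copy d 2) s)
    rw [min_eq_right h.le]
    exact this
  · have := Exec.ite_neg (P := .instr (.copy d 2)) h (Exec.skip (Q := Q) s)
    rw [min_eq_left (not_lt.1 h)]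
    rwa [show s.setReg d (s.reg d) = s by simp [State.setReg]]

end Computes

theorem forall₂_locs_congr {locs l : List ℕ} {d d' : ℕ} {s s' : State}
    (h : List.Forall₂ (fun r x => r < d ∧ s.reg r = x) locs l) (hd : d ≤ d')
    (hs : ∀ i < d, s'.reg i = s.reg i) :
    List.Forall₂ (fun r x => r < d' ∧ s'.reg r = x) locs l :=
  h.imp fun _ _ h => ⟨h.1.trans_le hd, (hs _ h.1).trans h.2⟩

theorem pow_sum_le {B c : ℕ} (hB : 2 ≤ B) (j : ℕ) {x y : ℕ} (hx : x ≤ B ^ c) (hy : y ≤ B ^ (c + j)) :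
    x + y ≤ B ^ (c + j + 1) := by
  have : B ^ c ≤ B ^ (c + j) := Nat.pow_le_pow_right (by omega) (by omega)
  calc x + y ≤ B ^ (c + j) * 2 := by omega
    _ ≤ B ^ (c + j + 1) := by rw [pow_succ]; exact Nat.mul_le_mul_left _ hB

theorem Expr.CompilesWithin.mono {e : Expr} {c c' : ℕ} (h : e.CompilesWithin c) (hc : c ≤ c') :
    e.CompilesWithin c' :=
  fun n Q g m l locs d s hg hd hs hm hl hf =>
    (h n Q g m l locs d s hg hd hs hm hl hf).mono (Nat.pow_le_pow_right (by omega) hc)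

/-- The loop computing an iteration. -/
theorem exec_iter_loop {n : ℕ} {Q : CIOracle n} {P : Prog} {d T N : ℕ} {F : ℕ → ℕ → ℕ} {a : ℕ}
    (s₀ : State)
    (hP : ∀ i < N, ∀ s : State, (∀ j < d, s.reg j = s₀.reg j) → s.mem = s₀.mem →
      s.reg (d + 1) = i → s.reg (d + 2) = iterate F a i →
      Computes Q P (d + 3) s T (iterate F a (i + 1))) (k : ℕ) :
    ∀ i, i + k = N → ∀ s : State, (∀ j < d, s.reg j = s₀.reg j) → s.mem = s₀.mem → s.reg d = N →
      s.reg (d + 1) = i → s.reg (d + 2) = iterate F a i →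
      ∃ t s', Exec Q (.loop (d + 1) d (.seq P (.seq (.instr (.copy (d + 2) (d + 3)))
          (.seq (.instr (.const (d + 3) 1)) (.instr (.add (d + 1) (d + 1) (d + 3))))))) s t s' ∧
        t ≤ k * (T + 5) + 1 ∧ s'.reg (d + 2) = iterate F a N ∧ (∀ j < d, s'.reg j = s₀.reg j) ∧
        s'.mem = s₀.mem := by
  induction k with
  | zero =>
    intro i hi s hs hm hN h1 h2
    obtain rfl : i = N := hi
    exact ⟨1, s, .loop_done (by omega), by omega, h2, hs, hm⟩
  | succ k ih =>
    intro i hi s hs hm hN h1 h2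
    obtain ⟨t, s', he, ht, hv, hr, hm'⟩ := hP i (by omega) s hs hm h1 h2
    let s₁ := (s'.setReg (d + 2) (s'.reg (d + 3)))
    let s₂ := s₁.setReg (d + 3) 1
    let s₃ := s₂.setReg (d + 1) (s₂.reg (d + 1) + s₂.reg (d + 3))
    have e1 : s₃.reg (d + 1) = i + 1 := by
      simp [s₃, s₂, s₁, hr (d + 1) (by omega), h1]
    have e2 : s₃.reg (d + 2) = iterate F a (i + 1) := by
      simp [s₃, s₂, s₁, hv]
    have e3 : s₃.reg d = N := by
      simp [s₃, s₂, s₁, hr d (by omega), hN]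
    have e4 : ∀ j < d, s₃.reg j = s₀.reg j := by
      intro j hj
      have h1 : j ≠ d + 1 := by omega
      have h2 : j ≠ d + 2 := by omega
      have h3 : j ≠ d + 3 := by omega
      simp [s₃, s₂, s₁, h1, h2, h3, hr j (by omega), hs j hj]
    obtain ⟨t', s'', he', ht', h'⟩ := ih (i + 1) (by omega) s₃ e4 (hm'.trans hm) e3 e1 e2
    have hbody := Exec.seq he (Exec.seq (Exec.instr (.copy (d + 2) (d + 3)) s')
      (Exec.seq (Exec.instr (.const (d + 3) 1) s₁)
        (Exec.instr (Q := Q) (.add (d + 1) (d + 1) (d + 3)) s₂)))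
    refine ⟨_, s'', .loop_step (by omega) hbody he', ?_, h'⟩
    have : s₂.reg (d + 3) = 1 := by simp [s₂]
    simp only [Instr.cost, this]
    rw [Nat.add_mul]
    omega

theorem Expr.exists_compilesWithin (e : Expr) : ∃ c, e.CompilesWithin c := by
  induction e with
  | lit c =>
    refine ⟨0, fun n Q g m l locs d s hg hd hs hm hl hf => ?_⟩
    refine ⟨_, _, .instr _ _, by simp [Instr.cost], by simp [Instr.run, eval], fun i hi => ?_, rfl⟩
    simp [Instr.run, hi.ne]
  | var i =>
    refine ⟨0, fun n Q g m l locs d s hg hd hs hm hl hf => ?_⟩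
    rw [List.forall₂_iff_get] at hf
    simp only [compile]
    by_cases hi : i < locs.length
    · have hi' : i < l.length := hf.1 ▸ hi
      have := (hf.2 i hi hi').2
      rw [List.getElem?_eq_getElem hi]
      refine ⟨_, _, .instr _ _, by simp [Instr.cost], ?_, fun i hi => ?_, rfl⟩
      · simpa [Instr.run, eval, hi'] using this
      · simp [Instr.run, hi.ne]
    · have hi' : ¬ i < l.length := hf.1 ▸ hi
      rw [List.getElem?_eq_none (not_lt.1 hi)]
      refine ⟨_, _, .instr _ _, by simp [Instr.cost], ?_, fun i hi => ?_, rfl⟩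
      · simp [Instr.run, eval, List.getElem?_eq_none (not_lt.1 hi')]
      · simp [Instr.run, hi.ne]
  | glob i =>
    refine ⟨2, fun n Q g m l locs d s hg hd hs hm hl hf => ?_⟩
    refine ⟨_, _, .seq (.instr _ _) (exec_clip _ _), ?_, ?_, fun j hj => ?_, rfl⟩
    · have : 2 ^ 2 ≤ (g 2 + 2) ^ 2 := Nat.pow_le_pow_left (by omega) 2
      simp only [Instr.cost]
      omega
    · have h2 : 2 ≠ d := by omega
      simp [Instr.run, eval, h2, hs i, show s.reg 2 = g 2 from hs 2]
    · simp [Instr.run, hj.ne]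
  | load a iha =>
    obtain ⟨c, iha⟩ := iha
    refine ⟨c + 2 + 1, fun n Q g m l locs d s hg hd hs hm hl hf => ?_⟩
    obtain ⟨t, s', he, ht, hv, hr, hm'⟩ := iha n Q g m l locs d s hg hd hs hm hl hf
    refine ⟨_, _, .seq he (.seq (.instr _ _) (exec_clip _ _)), ?_, ?_, fun j hj => ?_, ?_⟩
    · refine pow_sum_le (by omega) 2 ht ?_
      have : 2 ^ 2 ≤ (g 2 + 2) ^ (c + 2) := (Nat.pow_le_pow_left (by omega) 2).trans
        (Nat.pow_le_pow_right (by omega) (by omega))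
      simp only [Instr.cost]
      omega
    · have h2 : 2 ≠ d := by omega
      simp [Instr.run, eval, h2, hr 2 (by omega), hv, hm', hm, show s.reg 2 = g 2 from hs 2]
    · simp [Instr.run, hj.ne, hr j hj]
    · simpa [Instr.run] using hm'
  | add a b iha ihb =>
    obtain ⟨ca, iha⟩ := iha
    obtain ⟨cb, ihb⟩ := ihb
    refine ⟨max ca cb + 1 + 1 + 1 + 1 + 1, fun n Q g m l locs d s hg hd hs hm hl hf => ?_⟩
    replace iha := iha.mono (le_max_left ca cb)
    replace ihb := ihb.mono (le_max_right ca cb)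
    generalize max ca cb = c at iha ihb
    obtain ⟨t, s', he, ht, hv, hr, hm'⟩ := iha n Q g m l locs d s hg hd hs hm hl hf
    obtain ⟨t₂, s₂, he₂, ht₂, hv₂, hr₂, hm₂⟩ := ihb n Q g m l locs (d + 1) s' hg (by omega)
      (fun i => (hr i (by omega)).trans (hs i)) (hm'.trans hm) hl
      (forall₂_locs_congr hf (by omega) hr)
    refine ⟨_, _, .seq he (.seq he₂ (.seq (.instr _ _) (exec_clip _ _))), ?_, ?_,
      fun j hj => ?_, ?_⟩
    · have hb := eval_le (m := m) hg b hl
      have h1 : 2 ^ 2 ≤ (g 2 + 2) ^ (c + 2) := (Nat.pow_le_pow_left (by omega) 2).trans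
        (Nat.pow_le_pow_right (by omega) (by omega))
      have h2 : g 2 + 2 ≤ (g 2 + 2) ^ (c + 2) := Nat.le_self_pow (by omega) _
      refine pow_sum_le (by omega) 4 ht ?_
      refine pow_sum_le (by omega) 3 ht₂ ?_
      have h3 : (g 2 + 2) ^ (c + 3) = (g 2 + 2) ^ (c + 2) * (g 2 + 2) := pow_succ _ _
      have : (g 2 + 2) ^ (c + 2) * 2 ≤ (g 2 + 2) ^ (c + 2) * (g 2 + 2) :=
        Nat.mul_le_mul_left _ (by omega)
      simp only [Instr.cost, hv₂]
      omega
    · have h2 : 2 ≠ d := by omega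
      have h3 : 2 ≠ d + 1 := by omega
      simp [Instr.run, eval, h2, hr 2 (by omega), hr₂ 2 (by omega), hr₂ d (by omega), hv, hv₂,
        show s.reg 2 = g 2 from hs 2]
    · simp [Instr.run, hj.ne, hr j hj, hr₂ j (by omega)]
    · simpa [Instr.run] using hm₂.trans hm'
  | sub a b iha ihb =>
    obtain ⟨ca, iha⟩ := iha
    obtain ⟨cb, ihb⟩ := ihb
    refine ⟨max ca cb + 1 + 1, fun n Q g m l locs d s hg hd hs hm hl hf => ?_⟩
    replace iha := iha.mono (le_max_left ca cb)
    replace ihb := ihb.mono (le_max_right ca cb)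
    generalize max ca cb = c at iha ihb
    obtain ⟨t, s', he, ht, hv, hr, hm'⟩ := iha n Q g m l locs d s hg hd hs hm hl hf
    obtain ⟨t₂, s₂, he₂, ht₂, hv₂, hr₂, hm₂⟩ := ihb n Q g m l locs (d + 1) s' hg (by omega)
      (fun i => (hr i (by omega)).trans (hs i)) (hm'.trans hm) hl
      (forall₂_locs_congr hf (by omega) hr)
    refine ⟨_, _, .seq he (.seq he₂ (.instr _ _)), ?_, ?_, fun j hj => ?_, ?_⟩
    · refine pow_sum_le (by omega) 1 ht ?_
      exact pow_sum_le (by omega) 0 ht₂ (Nat.one_le_pow _ _ (by omega))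
    · simp [Instr.run, eval, hr₂ d (by omega), hv, hv₂]
    · simp [Instr.run, hj.ne, hr j hj, hr₂ j (by omega)]
    · simpa [Instr.run] using hm₂.trans hm'
  | ite a b x y iha ihb ihx ihy =>
    obtain ⟨ca, iha⟩ := iha
    obtain ⟨cb, ihb⟩ := ihb
    obtain ⟨cx, ihx⟩ := ihx
    obtain ⟨cy, ihy⟩ := ihy
    obtain ⟨c, h1, h2, h3, h4⟩ : ∃ c, ca ≤ c ∧ cb ≤ c ∧ cx ≤ c ∧ cy ≤ c :=
      ⟨ca + cb + cx + cy, by omega, by omega, by omega, by omega⟩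
    refine ⟨c + 1 + 1 + 1, fun n Q g m l locs d s hg hd hs hm hl hf => ?_⟩
    obtain ⟨t, s', he, ht, hv, hr, hm'⟩ := iha.mono h1 n Q g m l locs d s hg hd hs hm hl hf
    have hf' := forall₂_locs_congr hf (Nat.le_succ d) hr
    have hs' : ∀ i : Fin 24, s'.reg i = g i := fun i => (hr i (by omega)).trans (hs i)
    obtain ⟨t₂, s₂, he₂, ht₂, hv₂, hr₂, hm₂⟩ := ihb.mono h2 n Q g m l locs (d + 1) s' hg (by omega)
      hs' (hm'.trans hm) hl hf'
    have hr₂' : ∀ i < d, s₂.reg i = s.reg i := fun i hi => (hr₂ i (by omega)).trans (hr i hi)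
    have hf₂ := forall₂_locs_congr hf le_rfl hr₂'
    have hs₂ : ∀ i : Fin 24, s₂.reg i = g i := fun i => (hr₂' i (by omega)).trans (hs i)
    have hm₂' := hm₂.trans (hm'.trans hm)
    have hd₂ : s₂.reg d = a.eval g m l := (hr₂ d (by omega)).trans hv
    by_cases hlt : a.eval g m l < b.eval g m l
    · obtain ⟨t₃, s₃, he₃, ht₃, hv₃, hr₃, hm₃⟩ := ihx.mono h3 n Q g m l locs d s₂ hg hd
        hs₂ hm₂' hl hf₂
      refine ⟨_, _, .seq he (.seq he₂ (.ite_pos (by rwa [hd₂, hv₂]) he₃)), ?_,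
        by simpa [eval, hlt] using hv₃, fun j hj => (hr₃ j hj).trans (hr₂' j hj),
        (hm₃.trans hm₂).trans hm'⟩
      refine pow_sum_le (by omega) 2 ht ?_
      refine pow_sum_le (by omega) 1 ht₂ ?_
      rw [add_comm]
      exact pow_sum_le (by omega) 0 ht₃ (Nat.one_le_pow _ _ (by omega))
    · obtain ⟨t₃, s₃, he₃, ht₃, hv₃, hr₃, hm₃⟩ := ihy.mono h4 n Q g m l locs d s₂ hg hd
        hs₂ hm₂' hl hf₂
      refine ⟨_, _, .seq he (.seq he₂ (.ite_neg (by rwa [hd₂, hv₂]) he₃)), ?_,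
        by simpa [eval, hlt] using hv₃, fun j hj => (hr₃ j hj).trans (hr₂' j hj),
        (hm₃.trans hm₂).trans hm'⟩
      refine pow_sum_le (by omega) 2 ht ?_
      refine pow_sum_le (by omega) 1 ht₂ ?_
      rw [add_comm]
      exact pow_sum_le (by omega) 0 ht₃ (Nat.one_le_pow _ _ (by omega))
  | iter bound init body ihb ihi ihbody =>
    obtain ⟨cb, ihb⟩ := ihb
    obtain ⟨ci, ihi⟩ := ihi
    obtain ⟨cy, ihbody⟩ := ihbody
    obtain ⟨c, h1, h2, h3⟩ : ∃ c, cb ≤ c ∧ ci ≤ c ∧ cy ≤ c :=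
      ⟨cb + ci + cy, by omega, by omega, by omega⟩
    refine ⟨c + 5 + 1 + 1, fun n Q g m l locs d s hg hd hs hm hl hf => ?_⟩
    obtain ⟨t, s', he, ht, hv, hr, hm'⟩ := ihb.mono h1 n Q g m l locs d s hg hd hs hm hl hf
    have hs' : ∀ i : Fin 24, s'.reg i = g i := fun i => (hr i (by omega)).trans (hs i)
    obtain ⟨t₂, s₂, he₂, ht₂, hv₂, hr₂, hm₂⟩ := ihi.mono h2 n Q g m l locs (d + 2) s' hg (by omega)
      hs' (hm'.trans hm) hl (forall₂_locs_congr hf (by omega) hr)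
    let s₃ := s₂.setReg (d + 1) 0
    have hr₃ : ∀ j < d, s₃.reg j = s.reg j := by
      intro j hj
      have : j ≠ d + 1 := by omega
      simp [s₃, this, hr₂ j (by omega), hr j hj]
    have hN := eval_le (m := m) hg bound hl
    have hle : ∀ i ≤ bound.eval g m l,
        iterate (fun i acc => body.eval g m (i :: acc :: l)) (init.eval g m l) i ≤ g 2 :=
      iterate_le (eval_le hg init hl) hN fun i acc hi hacc => eval_le hg body (by
        intro x hx
        simp only [List.mem_cons] at hx
        rcases hx with rfl | rfl | hx
        exacts [hi, hacc, hl x hx])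
    obtain ⟨t₄, s₄, he₄, ht₄, hv₄, hr₄, hm₄⟩ := exec_iter_loop (Q := Q)
      (P := body.compile ((d + 1) :: (d + 2) :: locs) (d + 3)) (d := d) (T := (g 2 + 2) ^ c)
      (N := bound.eval g m l)
      (F := fun i acc => body.eval g m (i :: acc :: l)) (a := init.eval g m l) s (by
        intro i hi σ hσ hσm hσ1 hσ2
        have := hle i hi.le
        refine ihbody.mono h3 n Q g m (i :: _ :: l) _ (d + 3) σ hg (by omega)
          (fun j => (hσ j (by omega)).trans (hs j)) (hσm.trans hm) ?_ ?_
        · intro x hx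
          simp only [List.mem_cons] at hx
          rcases hx with rfl | rfl | hx
          exacts [by omega, ‹_›, hl x hx]
        · exact .cons ⟨by omega, hσ1⟩ (.cons ⟨by omega, hσ2⟩
            (forall₂_locs_congr hf (by omega) hσ)))
      (bound.eval g m l) 0 (by omega) s₃ hr₃ (hm₂.trans hm')
      (by simp [s₃, hr₂ d (by omega), hv]) (by simp [s₃]) (by simp [s₃, hv₂, iterate])
    refine ⟨_, _, .seq he (.seq he₂ (.seq (.instr _ _) (.seq he₄ (.instr _ _)))), ?_, ?_,
      fun j hj => ?_, ?_⟩
    · refine pow_sum_le (by omega) 6 ht ?_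
      refine pow_sum_le (by omega) 5 ht₂ ?_
      set B := g 2 + 2
      have hp : 1 ≤ B ^ c := Nat.one_le_pow _ _ (by omega)
      have h4 : (bound.eval g m l) * (B ^ c + 5) + 1 + 1 + 1 ≤ (B ^ c + 5) * B := by
        have : (bound.eval g m l) * (B ^ c + 5) ≤ g 2 * (B ^ c + 5) := Nat.mul_le_mul_right _ hN
        have : (B ^ c + 5) * B = g 2 * (B ^ c + 5) + 2 * (B ^ c + 5) := by
          simp only [B]; ring
        omega
      have h5 : (B ^ c + 5) * B ≤ B ^ (c + 5) := by
        have e1 : (B ^ c + 5) ≤ B ^ c * 2 ^ 3 := by omega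
        calc (B ^ c + 5) * B ≤ B ^ c * 2 ^ 3 * B := Nat.mul_le_mul_right _ e1
          _ ≤ B ^ c * B ^ 3 * B := by gcongr; omega
          _ = B ^ (c + 4) := by ring
          _ ≤ B ^ (c + 5) := Nat.pow_le_pow_right (by omega) (by omega)
      simp only [Instr.cost]
      omega
    · simp [Instr.run, eval, hv₄]
    · simp [Instr.run, hj.ne, hr₄ j hj]
    · simpa [Instr.run] using hm₄
  | call f a b e ihf iha ihb ihc =>
    obtain ⟨cf, ihf⟩ := ihf
    obtain ⟨ca, iha⟩ := iha
    obtain ⟨cb, ihb⟩ := ihb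
    obtain ⟨cc, ihc⟩ := ihc
    obtain ⟨c, h1, h2, h3, h4⟩ : ∃ c, cf ≤ c ∧ ca ≤ c ∧ cb ≤ c ∧ cc ≤ c :=
      ⟨cf + ca + cb + cc, by omega, by omega, by omega, by omega⟩
    refine ⟨c + 3 + 1, fun n Q g m l locs d s hg hd hs hm hl hf => ?_⟩
    obtain ⟨t, s', he, ht, hv, hr, hm'⟩ := iha.mono h2 n Q g m l locs d s hg hd hs hm hl hf
    obtain ⟨t₂, s₂, he₂, ht₂, hv₂, hr₂, hm₂⟩ := ihb.mono h3 n Q g m l locs (d + 1) s' hg (by omega)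
      (fun i => (hr i (by omega)).trans (hs i)) (hm'.trans hm) hl
      (forall₂_locs_congr hf (by omega) hr)
    have hr₂' : ∀ i < d, s₂.reg i = s.reg i := fun i hi => (hr₂ i (by omega)).trans (hr i hi)
    obtain ⟨t₃, s₃, he₃, ht₃, hv₃, hr₃, hm₃⟩ := ihc.mono h4 n Q g m l locs (d + 2) s₂ hg (by omega)
      (fun i => (hr₂' i (by omega)).trans (hs i)) (hm₂.trans (hm'.trans hm)) hl
      (forall₂_locs_congr hf (by omega) hr₂')
    have hr₃' : ∀ i < d, s₃.reg i = s.reg i := fun i hi => (hr₃ i (by omega)).trans (hr₂' i hi)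
    obtain ⟨t₄, s₄, he₄, ht₄, hv₄, hr₄, hm₄⟩ := ihf.mono h1 n Q g m
      [a.eval g m l, b.eval g m l, e.eval g m l] [d, d + 1, d + 2] (d + 3) s₃ hg (by omega)
      (fun i => (hr₃' i (by omega)).trans (hs i)) (hm₃.trans (hm₂.trans (hm'.trans hm)))
      (by
        intro x hx
        simp only [List.mem_cons, List.not_mem_nil, or_false] at hx
        rcases hx with rfl | rfl | rfl
        exacts [eval_le hg _ hl, eval_le hg _ hl, eval_le hg _ hl])
      (.cons ⟨by omega, by rw [hr₃ d (by omega), hr₂ d (by omega), hv]⟩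
        (.cons ⟨by omega, by rw [hr₃ _ (by omega), hv₂]⟩ (.cons ⟨by omega, hv₃⟩ .nil)))
    refine ⟨_, _, .seq he (.seq he₂ (.seq he₃ (.seq he₄ (.instr _ _)))), ?_, ?_,
      fun j hj => ?_, ?_⟩
    · refine pow_sum_le (by omega) 3 ht ?_
      refine pow_sum_le (by omega) 2 ht₂ ?_
      refine pow_sum_le (by omega) 1 ht₃ ?_
      exact pow_sum_le (by omega) 0 ht₄ (Nat.one_le_pow _ _ (by omega))
    · simp [Instr.run, eval, hv₄]
    · simp [Instr.run, hj.ne, hr₄ j (by omega), hr₃' j hj]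
    · simpa [Instr.run] using hm₄.trans (hm₃.trans (hm₂.trans hm'))

/-! ### Programs on the visible part of the state -/

/-- The contents of the global registers. -/
abbrev Globals := Fin 24 → ℕ

/-- Started with global registers `g` and memory `m`, and whatever in the other registers, the
program `P` halts within time `T`, with global registers and memory satisfying `R`. -/
def Runs {n : ℕ} (Q : CIOracle n) (P : Prog) (T : ℕ) (g : Globals) (m : ℕ → ℕ)
    (R : Globals → (ℕ → ℕ) → Prop) : Prop :=
  ∀ s : State, (∀ i : Fin 24, s.reg i = g i) → s.mem = m →
    ∃ t s', Exec Q P s t s' ∧ t ≤ T ∧ R (fun i => s'.reg i) s'.mem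

/-- Storing the value of an expression in a global register. -/
def assign (r : Fin 24) (e : Expr) : Prog := .seq (e.compile [] 24) (.instr (.copy r 24))

section Runs

variable {n : ℕ} {Q : CIOracle n} {P P' : Prog} {T T' : ℕ} {g : Globals} {m : ℕ → ℕ}
  {R R' : Globals → (ℕ → ℕ) → Prop}

theorem Runs.mono (h : Runs Q P T g m R) (hT : T ≤ T') (hR : ∀ g' m', R g' m' → R' g' m') :
    Runs Q P T' g m R' := by
  intro s hs hm
  obtain ⟨t, s', he, ht, hr⟩ := h s hs hm
  exact ⟨t, s', he, ht.trans hT, hR _ _ hr⟩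

theorem Runs.seq (h : Runs Q P T g m R) (h' : ∀ g' m', R g' m' → Runs Q P' T' g' m' R') :
    Runs Q (.seq P P') (T + T') g m R' := by
  intro s hs hm
  obtain ⟨t, s', he, ht, hr⟩ := h s hs hm
  obtain ⟨t', s'', he', ht', hr'⟩ := h' _ _ hr s' (fun _ => rfl) rfl
  exact ⟨_, _, .seq he he', by omega, hr'⟩

theorem Runs.loop {x y : Fin 24} {N : ℕ} (Inv : ℕ → Globals → (ℕ → ℕ) → Prop)
    (hlt : ∀ i < N, ∀ g m, Inv i g m → g x < g y) (hend : ∀ g m, Inv N g m → ¬ g x < g y)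
    (hstep : ∀ i < N, ∀ g m, Inv i g m → Runs Q P T g m (Inv (i + 1))) (h0 : Inv 0 g m) :
    Runs Q (.loop x y P) (N * (T + 1) + 1) g m (Inv N) := by
  suffices ∀ k i, i + k = N → ∀ g m, Inv i g m →
      Runs Q (.loop x y P) (k * (T + 1) + 1) g m (Inv N) from this N 0 (by omega) g m h0
  intro k
  induction k with
  | zero =>
    rintro i rfl g m hi s hs rfl
    refine ⟨1, s, .loop_done ?_, by omega, ?_⟩
    · rw [hs, hs]
      exact hend g _ hi
    · rwa [show (fun i : Fin 24 => s.reg i) = g from funext hs]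
  | succ k ih =>
    rintro i hi g m hinv s hs rfl
    obtain ⟨t, s', he, ht, hr⟩ := hstep i (by omega) g _ hinv s hs rfl
    obtain ⟨t', s'', he', ht', hr'⟩ := ih (i + 1) (by omega) _ _ hr s' (fun _ => rfl) rfl
    refine ⟨_, _, .loop_step ?_ he he', ?_, hr'⟩
    · rw [hs, hs]
      exact hlt i (by omega) g _ hinv
    · rw [Nat.add_mul]
      omega

end Runs

/-- A specification with a time bound that is a fixed power of `g 2 + 2`: started with globals `g`
and memory `m` satisfying `Pre`, the program halts with globals and memory related to the initial
ones by `R`. -/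
def Poly (P : Prog) (Pre : ∀ n : ℕ, CIOracle n → Globals → (ℕ → ℕ) → Prop)
    (R : ∀ n : ℕ, CIOracle n → Globals → (ℕ → ℕ) → Globals → (ℕ → ℕ) → Prop) : Prop :=
  ∃ c, ∀ (n : ℕ) (Q : CIOracle n) (g : Globals) (m : ℕ → ℕ), 2 ≤ g 2 → Pre n Q g m →
    Runs Q P ((g 2 + 2) ^ c) g m (R n Q g m)

section Poly

variable {P P' : Prog} {Pre Pre' : ∀ n : ℕ, CIOracle n → Globals → (ℕ → ℕ) → Prop}
  {R R' R'' : ∀ n : ℕ, CIOracle n → Globals → (ℕ → ℕ) → Globals → (ℕ → ℕ) → Prop}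

theorem Poly.conseq (h : Poly P Pre R) (hpre : ∀ n Q g m, 2 ≤ g 2 → Pre' n Q g m → Pre n Q g m)
    (hR : ∀ n Q g m g' m', 2 ≤ g 2 → Pre' n Q g m → R n Q g m g' m' → R' n Q g m g' m') :
    Poly P Pre' R' := by
  obtain ⟨c, h⟩ := h
  exact ⟨c, fun n Q g m hg hp => (h n Q g m hg (hpre n Q g m hg hp)).mono le_rfl
    fun g' m' hr => hR n Q g m g' m' hg hp hr⟩

theorem Poly.seq (h : Poly P Pre R) (h' : Poly P' Pre' R')
    (hmid : ∀ n Q g m g' m', 2 ≤ g 2 → Pre n Q g m → R n Q g m g' m' →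
      g' 2 = g 2 ∧ Pre' n Q g' m')
    (hR : ∀ n Q g m g' m' g'' m'', 2 ≤ g 2 → Pre n Q g m → R n Q g m g' m' →
      R' n Q g' m' g'' m'' → R'' n Q g m g'' m'') :
    Poly (.seq P P') Pre R'' := by
  obtain ⟨c, h⟩ := h
  obtain ⟨c', h'⟩ := h'
  refine ⟨c + c' + 1, fun n Q g m hg hp => ?_⟩
  refine (Runs.seq (T' := (g 2 + 2) ^ c') (R' := fun g' m' => R'' n Q g m g' m')
    (h n Q g m hg hp) fun g' m' hr => ?_).mono ?_ fun _ _ h => h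
  · obtain ⟨h2, hp'⟩ := hmid n Q g m g' m' hg hp hr
    have := h' n Q g' m' (h2 ▸ hg) hp'
    rw [h2] at this
    exact this.mono le_rfl fun g'' m'' hr' => hR n Q g m g' m' g'' m'' hg hp hr hr'
  · exact pow_sum_le (by omega) c' le_rfl (Nat.pow_le_pow_right (by omega) (by omega))

/-- A loop making at most `g 2` rounds. -/
theorem Poly.loop {x y : Fin 24} (h : Poly P Pre R) (N : Globals → (ℕ → ℕ) → ℕ)
    (Inv : ∀ n : ℕ, CIOracle n → Globals → (ℕ → ℕ) → ℕ → Globals → (ℕ → ℕ) → Prop)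
    (hN : ∀ n Q g m, 2 ≤ g 2 → Pre' n Q g m → N g m ≤ g 2 ∧ Inv n Q g m 0 g m)
    (hstep : ∀ n Q g m, 2 ≤ g 2 → Pre' n Q g m → ∀ i < N g m, ∀ g' m', Inv n Q g m i g' m' →
      g' x < g' y ∧ g' 2 = g 2 ∧ Pre n Q g' m' ∧
      ∀ g'' m'', R n Q g' m' g'' m'' → Inv n Q g m (i + 1) g'' m'')
    (hend : ∀ n Q g m, 2 ≤ g 2 → Pre' n Q g m → ∀ g' m', Inv n Q g m (N g m) g' m' →
      ¬ g' x < g' y) :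
    Poly (.loop x y P) Pre' fun n Q g m => Inv n Q g m (N g m) := by
  obtain ⟨c, h⟩ := h
  refine ⟨c + 2, fun n Q g m hg hp => ?_⟩
  refine (Runs.loop (Q := Q) (P := P) (T := (g 2 + 2) ^ c) (N := N g m) (Inv n Q g m)
    (fun i hi g' m' hinv => (hstep n Q g m hg hp i hi g' m' hinv).1) (hend n Q g m hg hp)
    (fun i hi g' m' hinv => ?_) (hN n Q g m hg hp).2).mono ?_ fun _ _ h => h
  · obtain ⟨-, h2, hp', hr⟩ := hstep n Q g m hg hp i hi g' m' hinv
    have := h n Q g' m' (h2 ▸ hg) hp'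
    rw [h2] at this
    exact this.mono le_rfl hr
  · have h1 := (hN n Q g m hg hp).1
    set B := g 2 + 2 with hB
    have hp : 1 ≤ B ^ c := Nat.one_le_pow _ _ (by omega)
    calc N g m * (B ^ c + 1) + 1 ≤ g 2 * (B ^ c + 1) + 1 := by gcongr
      _ ≤ (g 2 + 2) * (B ^ c + 1) := by nlinarith
      _ ≤ B * (B ^ c * B) := by gcongr; nlinarith
      _ = B ^ (c + 2) := by ring

theorem poly_assign (r : Fin 24) (e : Expr) :
    Poly (assign r e) (fun _ _ _ _ => True)
      fun _ _ g m g' m' => g' = Function.update g r (e.eval g m []) ∧ m' = m := by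
  obtain ⟨c, h⟩ := e.exists_compilesWithin
  refine ⟨c + 1, fun n Q g m hg _ s hs hm => ?_⟩
  obtain ⟨t, s', he, ht, hv, hr, hm'⟩ := h n Q g m [] [] 24 s hg le_rfl hs hm (by simp) .nil
  refine ⟨_, _, .seq he (.instr _ _), ?_, ?_, ?_⟩
  · exact pow_sum_le (by omega) 0 ht (Nat.one_le_pow _ _ (by omega))
  · funext i
    rcases eq_or_ne i r with rfl | hi
    · simp [Instr.run, hv]
    · have : (i : ℕ) ≠ r := fun h => hi (Fin.ext h)
      simp [Instr.run, this, hi, hr i i.2, hs i]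
  · simpa [Instr.run] using hm'.trans hm

theorem poly_store (x y : Fin 24) :
    Poly (.instr (.store x y)) (fun _ _ _ _ => True)
      fun _ _ g m g' m' => g' = g ∧ m' = Function.update m (g x) (g y) := by
  refine ⟨0, fun n Q g m hg _ s hs hm => ⟨_, _, .instr _ _, by simp [Instr.cost], ?_, ?_⟩⟩
  · funext i
    simp [Instr.run, State.setMem, hs i]
  · simp [Instr.run, State.setMem, hs x, hs y, hm]

theorem poly_query (x u v p : Fin 24) :
    Poly (.instr (.query x u v p)) (fun n _ g _ => n ≤ g 2)
      fun _ Q g m g' m' =>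
        g' = Function.update g x (Q.answer (g u) (g v) fun w => m (g p + w)) ∧ m' = m := by
  refine ⟨1, fun n Q g m hg hn s hs hm => ⟨_, _, .instr _ _, by simp [Instr.cost]; omega, ?_, ?_⟩⟩
  · funext i
    rcases eq_or_ne i x with rfl | hi
    · simp [Instr.run, hs u, hs v, hs p, hm]
    · have : (i : ℕ) ≠ x := fun h => hi (Fin.ext h)
      simp [Instr.run, this, hi, hs i]
  · simp [Instr.run, hm]

/-- For `i` from `0` up to the value of `el`, store the value of `ev` at distance `i` from the
address in register `b`. In `ev`, register `11` holds `i`. Registers `11` to `14` are used. -/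
def fill (b : Fin 24) (el ev : Expr) : Prog :=
  .seq (assign 12 el) (.seq (assign 11 (.lit 0)) (.loop (11 : Fin 24) (12 : Fin 24)
    (.seq (assign 13 ev) (.seq (assign 14 (.add (.glob b) (.glob 11)))
      (.seq (.instr (.store (14 : Fin 24) (13 : Fin 24)))
        (assign 11 (.add (.glob 11) (.lit 1))))))))

/-- Two lists of globals that differ in the registers used by `fill` only. -/
def SameUpTo (g g' : Globals) : Prop := ∀ j : Fin 24, j.val < 11 ∨ 14 < j.val → g' j = g j

theorem poly_fill (b : Fin 24) (hb : b.val < 11 ∨ 14 < b.val) (el ev : Expr) :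
    Poly (fill b el ev) (fun _ _ g m => g b + el.eval g m [] ≤ g 2)
      fun _ _ g m g' m' => SameUpTo g g' ∧
        (∀ a, a < g b ∨ g b + el.eval g m [] ≤ a → m' a = m a) ∧
        ∀ i < el.eval g m [], ∃ g'', SameUpTo g g'' ∧ g'' 11 = i ∧
          m' (g b + i) = ev.eval g'' (fun a => if a < g b + i then m' a else m a) [] := by
  have hbody : Poly (.seq (assign 13 ev) (.seq (assign 14 (.add (.glob b) (.glob 11)))
      (.seq (.instr (.store (14 : Fin 24) (13 : Fin 24))) (assign 11 (.add (.glob 11) (.lit 1))))))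
      (fun _ _ g _ => g b + g 11 + 1 ≤ g 2)
      (fun _ _ g m g' m' => SameUpTo g g' ∧ g' 12 = g 12 ∧ g' 11 = g 11 + 1 ∧
        m' = Function.update m (g b + g 11) (ev.eval g m [])) := by
    have hb13 : b ≠ 13 := by rintro rfl; simp at hb
    have hb11 : b ≠ 11 := by rintro rfl; simp at hb
    refine (poly_assign 13 ev).conseq (Pre' := fun _ _ g _ => g b + g 11 + 1 ≤ g 2)
      (fun _ _ _ _ _ _ => trivial) (fun _ _ _ _ _ _ _ _ h => h) |>.seq
      ((poly_assign 14 _).seq ((poly_store 14 13).seq (poly_assign 11 _)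
        (R'' := fun _ _ g m g' m' => g' = Function.update g 11 (min (min (g 11) (g 2) + 1) (g 2)) ∧
          m' = Function.update m (g 14) (g 13)) ?_ ?_)
        (R'' := fun _ _ g m g' m' => g' = Function.update (Function.update g 14
            (min (min (g b) (g 2) + min (g 11) (g 2)) (g 2))) 11
              (min (min (g 11) (g 2) + 1) (g 2)) ∧
          m' = Function.update m (min (min (g b) (g 2) + min (g 11) (g 2)) (g 2)) (g 13)) ?_ ?_)
        ?_ ?_
    · rintro n Q g m g' m' - - ⟨rfl, rfl⟩
      exact ⟨rfl, trivial⟩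
    · rintro n Q g m g' m' g'' m'' - - ⟨rfl, rfl⟩ ⟨rfl, rfl⟩
      exact ⟨by simp [Expr.eval], rfl⟩
    · rintro n Q g m g' m' - - ⟨rfl, rfl⟩
      exact ⟨by simp, trivial⟩
    · rintro n Q g m g' m' g'' m'' - - ⟨rfl, rfl⟩ ⟨rfl, rfl⟩
      exact ⟨by simp [Expr.eval], by simp [Expr.eval]⟩
    · rintro n Q g m g' m' - hp ⟨rfl, rfl⟩
      exact ⟨by simp, trivial⟩
    · rintro n Q g m g' m' g'' m'' - hp ⟨rfl, rfl⟩ ⟨rfl, rfl⟩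
      have e1 : min (g b) (g 2) = g b := min_eq_left (by omega)
      have e2 : min (g 11) (g 2) = g 11 := min_eq_left (by omega)
      have e3 : min (g b + g 11) (g 2) = g b + g 11 := min_eq_left (by omega)
      have e4 : min (g 11 + 1) (g 2) = g 11 + 1 := min_eq_left (by omega)
      refine ⟨fun j hj => ?_, by simp, by simp [e2, e4], ?_⟩
      · have h1 : j ≠ 11 := by rintro rfl; simp at hj
        have h2 : j ≠ 13 := by rintro rfl; simp at hj
        have h3 : j ≠ 14 := by rintro rfl; simp at hj
        simp [h1, h2, h3]
      · simp [hb13, e1, e2, e3]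
  have hlen : ∀ g : Globals, ∀ m, 2 ≤ g 2 → el.eval g m [] ≤ g 2 :=
    fun g m hg => el.eval_le hg (by simp)
  refine (poly_assign 12 el).conseq (Pre' := fun _ _ g m => g b + el.eval g m [] ≤ g 2)
      (fun _ _ _ _ _ _ => trivial) (fun _ _ _ _ _ _ _ _ h => h) |>.seq
    (((poly_assign 11 (.lit 0)).conseq (Pre' := fun _ _ g _ => g b + g 12 ≤ g 2)
      (fun _ _ _ _ _ _ => trivial) (fun _ _ _ _ _ _ _ _ h => h)).seq
      (hbody.loop (Pre' := fun _ _ g _ => g b + g 12 ≤ g 2 ∧ g 11 = 0) (fun g _ => g 12)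
        (fun _ _ g m i g' m' => SameUpTo g g' ∧ g' 12 = g 12 ∧ g' 11 = i ∧
          (∀ a, a < g b ∨ g b + i ≤ a → m' a = m a) ∧
          ∀ j < i, ∃ g'', SameUpTo g g'' ∧ g'' 11 = j ∧
            m' (g b + j) = ev.eval g'' (fun a => if a < g b + j then m' a else m a) []) ?_ ?_ ?_)
      (R'' := fun _ _ g m g' m' => SameUpTo g g' ∧
          (∀ a, a < g b ∨ g b + g 12 ≤ a → m' a = m a) ∧
          ∀ j < g 12, ∃ g'', SameUpTo g g'' ∧ g'' 11 = j ∧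
            m' (g b + j) = ev.eval g'' (fun a => if a < g b + j then m' a else m a) []) ?_ ?_) ?_ ?_
  · rintro n Q g m - ⟨h, h'⟩
    exact ⟨by omega, fun j _ => rfl, rfl, h', fun _ _ => rfl, fun j hj => (Nat.not_lt_zero _ hj).elim⟩
  · rintro n Q g m - ⟨h, h'⟩ i hi g' m' ⟨hs, h12, h11, hm, hv⟩
    have h2 : g' 2 = g 2 := hs 2 (by simp)
    have hgb : g' b = g b := hs b hb
    refine ⟨by omega, h2, by omega, ?_⟩
    rintro g'' m'' ⟨hs', h12', h11', rfl⟩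
    rw [hgb, h11]
    refine ⟨fun j hj => (hs' j hj).trans (hs j hj), h12'.trans h12, by omega, fun a ha => ?_,
      fun j hj => ?_⟩
    · rw [Function.update_of_ne (by omega)]
      exact hm a (by omega)
    · rcases Nat.lt_succ_iff_lt_or_eq.1 hj with hj | rfl
      · obtain ⟨g₁, hs₁, h₁, e⟩ := hv j hj
        refine ⟨g₁, hs₁, h₁, ?_⟩
        rw [Function.update_of_ne (by omega), e]
        congr 1
        funext a
        split_ifs with ha
        · rw [Function.update_of_ne (by omega)]
        · rfl
      · refine ⟨g', hs, h11, ?_⟩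
        rw [Function.update_self]
        congr 1
        funext a
        split_ifs with ha
        · rw [Function.update_of_ne (by omega)]
        · exact hm a (by omega)
  · rintro n Q g m - ⟨h, h'⟩ g' m' ⟨hs, h12, h11, -⟩
    omega
  · rintro n Q g m g' m' hg hp ⟨rfl, rfl⟩
    have hb11 : b ≠ 11 := by rintro rfl; simp at hb
    exact ⟨by simp, by simpa [hb11] using hp, by simp [Expr.eval]⟩
  · rintro n Q g m g' m' g'' m'' hg hp ⟨rfl, rfl⟩ ⟨hs, -, -, hm, hv⟩
    have hb11 : b ≠ 11 := by rintro rfl; simp at hb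
    have tr : ∀ {g₁}, SameUpTo (Function.update g 11 (Expr.eval g m' (.lit 0) [])) g₁ →
        SameUpTo g g₁ := by
      intro g₁ h j hj
      have h1 : j ≠ 11 := by rintro rfl; simp at hj
      rw [h j hj, Function.update_of_ne h1]
    simp only [Function.update_of_ne hb11,
      Function.update_of_ne (show (12 : Fin 24) ≠ 11 by decide)] at hm hv
    exact ⟨tr hs, hm, fun j hj => let ⟨g₁, h₁, h⟩ := hv j hj; ⟨g₁, tr h₁, h⟩⟩
  · rintro n Q g m g' m' hg hp ⟨rfl, rfl⟩
    have hb12 : b ≠ 12 := by rintro rfl; simp at hb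
    exact ⟨by simp, by simpa [hb12] using hp⟩
  · rintro n Q g m g' m' g'' m'' hg hp ⟨rfl, rfl⟩ ⟨hs, hm, hv⟩
    have hb12 : b ≠ 12 := by rintro rfl; simp at hb
    have tr : ∀ {g₁}, SameUpTo (Function.update g 12 (el.eval g m' [])) g₁ →
        SameUpTo g g₁ := by
      intro g₁ h j hj
      have h1 : j ≠ 12 := by rintro rfl; simp at hj
      rw [h j hj, Function.update_of_ne h1]
    simp only [Function.update_of_ne hb12, Function.update_self] at hm hv
    exact ⟨tr hs, hm, fun j hj => let ⟨g₁, h₁, h⟩ := hv j hj; ⟨g₁, tr h₁, h⟩⟩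

end Poly

/-! ### Sets of vertices as numbers -/

/-- The number whose binary digits are the indicator of `S`. -/
def setCode {n : ℕ} (S : Finset (Fin n)) : ℕ := ∑ i ∈ S, 2 ^ (i : ℕ)

section SetCode

variable {n : ℕ} {S : Finset (Fin n)} {v : Fin n}

theorem setCode_eq_sum_map (S : Finset (Fin n)) :
    setCode S = ∑ i ∈ S.map Fin.valEmbedding, 2 ^ i := by
  simp [setCode]

theorem testBit_setCode {j : ℕ} : (setCode S).testBit j = true ↔ ∃ h : j < n, ⟨j, h⟩ ∈ S := by
  rw [← Nat.mem_bitIndices, ← List.mem_toFinset, setCode_eq_sum_map,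
    Finset.toFinset_bitIndices_sum_two_pow]
  simp only [Finset.mem_map, Fin.valEmbedding_apply]
  constructor
  · rintro ⟨i, hi, rfl⟩
    exact ⟨i.2, hi⟩
  · rintro ⟨h, hj⟩
    exact ⟨_, hj, rfl⟩

theorem testBit_setCode_val : (setCode S).testBit v = true ↔ v ∈ S := by
  simp [testBit_setCode]

theorem setCode_lt (S : Finset (Fin n)) : setCode S < 2 ^ n := by
  rw [setCode_eq_sum_map]
  exact Nat.geomSum_lt le_rfl (by simp)

theorem setCode_insert (h : v ∉ S) : setCode (insert v S) = setCode S + 2 ^ (v : ℕ) := by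
  rw [setCode, Finset.sum_insert h, add_comm, setCode]

theorem setCode_erase (h : v ∈ S) : setCode (S.erase v) = setCode S - 2 ^ (v : ℕ) := by
  conv_rhs => rw [← Finset.insert_erase h, setCode_insert (Finset.notMem_erase v S)]
  omega

theorem setCode_injective : Function.Injective (setCode (n := n)) := by
  intro S T h
  ext v
  rw [← testBit_setCode_val, h, testBit_setCode_val]

theorem exists_setCode_eq {a : ℕ} (ha : a < 2 ^ n) : ∃ S : Finset (Fin n), setCode S = a := by
  refine ⟨Finset.univ.filter fun i => a.testBit i = true, Nat.eq_of_testBit_eq fun j => ?_⟩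
  rw [Bool.eq_iff_iff, testBit_setCode]
  constructor
  · rintro ⟨h, hj⟩
    simpa using hj
  · intro h
    refine ⟨?_, by simpa using h⟩
    by_contra hj
    rw [Nat.testBit_lt_two_pow (ha.trans_le (Nat.pow_le_pow_right (by omega) (by omega)))] at h
    simp at h

theorem setCode_empty : setCode (∅ : Finset (Fin n)) = 0 := rfl

theorem setCode_univ : setCode (Finset.univ : Finset (Fin n)) = 2 ^ n - 1 := by
  obtain ⟨S, hS⟩ := exists_setCode_eq (n := n) (a := 2 ^ n - 1) (by have := Nat.two_pow_pos n; omega)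
  rw [← hS]
  congr 1
  ext v
  rw [← testBit_setCode_val (S := S), hS]
  simp

end SetCode

/-! ### Dynamic programming over the sets of vertices -/

open Classical in
/-- One more than the largest `v < n` satisfying `P`, and `0` if there is none. -/
noncomputable def lastSat (P : ℕ → Prop) (n : ℕ) : ℕ :=
  iterate (fun v acc => if P v then v + 1 else acc) 0 n

theorem lastSat_eq_zero {P : ℕ → Prop} {n : ℕ} : lastSat P n = 0 ↔ ∀ v < n, ¬ P v := by
  induction n with
  | zero => simp [lastSat, iterate]
  | succ n ih =>
    rw [lastSat, iterate, ← lastSat]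
    split_ifs with h
    · exact iff_of_false id fun h' => h' n (by omega) h
    · rw [ih]
      refine ⟨fun h' v hv => ?_, fun h' v hv => h' v (by omega)⟩
      rcases Nat.lt_succ_iff_lt_or_eq.1 hv with hv | rfl
      exacts [h' v hv, h]

theorem lastSat_spec {P : ℕ → Prop} {n v : ℕ} (h : lastSat P n = v + 1) : v < n ∧ P v := by
  induction n with
  | zero => simp [lastSat, iterate] at h
  | succ n ih =>
    rw [lastSat, iterate, ← lastSat] at h
    split_ifs at h with hn
    · obtain rfl : n = v := by omega
      exact ⟨by omega, hn⟩
    · exact ⟨(ih h).1.trans (by omega), (ih h).2⟩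

theorem lastSat_le (P : ℕ → Prop) (n : ℕ) : lastSat P n ≤ n := by
  rcases h : lastSat P n with _ | v
  exacts [Nat.zero_le _, (lastSat_spec h).1]

section Choice

variable {n : ℕ} {ρ : Fin n → Fin n → Finset (Fin n) → Prop} {c : ℕ → ℕ}

/-- `v` can be taken as a sink on `W`, the table `c` having a nonzero entry for the rest of `W`. -/
def Choosable (ρ : Fin n → Fin n → Finset (Fin n) → Prop) (c : ℕ → ℕ) (W : Finset (Fin n)) (v : ℕ) :
    Prop :=
  ∃ h : v < n, ⟨v, h⟩ ∈ W ∧ c (setCode (W.erase ⟨v, h⟩)) ≠ 0 ∧ SinkCond ρ ⟨v, h⟩ (W.erase ⟨v, h⟩)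

/-- The table `c` of possible sinks: the entry for a nonempty set `W` is `v + 1` if there is a
perfect map on `W` with the sink `v`, and `0` if there is no perfect map on `W`. -/
structure IsChoice (ρ : Fin n → Fin n → Finset (Fin n) → Prop) (c : ℕ → ℕ) : Prop where
  empty : c 0 = n + 1
  step : ∀ W : Finset (Fin n), W ≠ ∅ → c (setCode W) = lastSat (Choosable ρ c W) n

theorem IsChoice.unique {c' : ℕ → ℕ} (h : IsChoice ρ c) (h' : IsChoice ρ c') (W : Finset (Fin n)) :
    c (setCode W) = c' (setCode W) := by
  induction W using Finset.strongInduction with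
  | H W ih =>
    rcases eq_or_ne W ∅ with rfl | hW
    · rw [setCode_empty, h.empty, h'.empty]
    · rw [h.step W hW, h'.step W hW]
      congr 1
      funext v
      refine propext (exists_congr fun hv => and_congr_right fun hvW => ?_)
      rw [ih _ (Finset.erase_ssubset hvW)]

/-- One step down the chain of sets that leads from a set to the one at which `v` is chosen. -/
def chainStep (c : ℕ → ℕ) (v X : ℕ) : ℕ := if c X = v + 1 then X else X - 2 ^ (c X - 1)

/-- The arcs read off from the table: the parents of `v` are those at the set at which `v` is
chosen on the way down from the set of all vertices. -/
def ChosenAdj (ρ : Fin n → Fin n → Finset (Fin n) → Prop) (c : ℕ → ℕ) (u v : Fin n) : Prop :=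
  ∃ X : Finset (Fin n), (chainStep c v)^[n] (2 ^ n - 1) = setCode X ∧ v ∈ X ∧
    IsParent ρ v (X.erase v) u

theorem IsChoice.ne_zero (h : IsChoice ρ c) {D : DAG (Fin n)} {W : Finset (Fin n)}
    (hD : D.IsPerfect ρ W) : c (setCode W) ≠ 0 := by
  induction W using Finset.strongInduction generalizing D with
  | H W ih =>
    rcases eq_or_ne W ∅ with rfl | hW
    · rw [setCode_empty, h.empty]
      omega
    · obtain ⟨v, hvW, hv⟩ := D.exists_sink (Finset.nonempty_iff_ne_empty.2 hW) hD.1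
      have hD' : D.IsPerfect ρ (insert v (W.erase v)) := by rwa [Finset.insert_erase hvW]
      rw [h.step W hW]
      intro h0
      exact lastSat_eq_zero.1 h0 v v.2 ⟨v.2, hvW,
        ih _ (Finset.erase_ssubset hvW) (hD'.del hv (by simp)), hD'.sinkCond hv (by simp)⟩

theorem IsChoice.exists_perfect (h : IsChoice ρ c) (hsymm : ∀ u w S, ρ u w S ↔ ρ w u S)
    {W : Finset (Fin n)} (hW : c (setCode W) ≠ 0) :
    ∃ D : DAG (Fin n), D.IsPerfect ρ W ∧ ∀ v ∈ W, ∀ i, W.card ≤ i → ∃ X : Finset (Fin n),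
      (chainStep c v)^[i] (setCode W) = setCode X ∧ v ∈ X ∧
        ∀ u, D.Adj u v ↔ IsParent ρ v (X.erase v) u := by
  induction W using Finset.strongInduction with
  | H W ih =>
    rcases eq_or_ne W ∅ with rfl | hne
    · refine ⟨⟨⟨fun _ _ => False⟩, fun v hv => ?_⟩, ⟨fun _ _ h => h.elim, by simp⟩, by simp⟩
      obtain ⟨x, hx, -⟩ := Relation.TransGen.head'_iff.1 hv
      exact hx
    · obtain ⟨v₀, hv₀⟩ := Nat.exists_eq_add_one_of_ne_zero hW
      obtain ⟨-, hlt, hmem, hc, hsink⟩ := lastSat_spec ((h.step W hne).symm.trans hv₀)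
      lift v₀ to Fin n using hlt
      obtain ⟨D, hD, hchain⟩ := ih _ (Finset.erase_ssubset hmem) hc
      have hv : ∀ x, ¬ D.Adj v₀ x := fun x hx => Finset.notMem_erase _ _ (hD.1 _ _ hx).1
      have hW' : insert v₀ (W.erase v₀) = W := Finset.insert_erase hmem
      refine ⟨_, hW' ▸ hD.addSink hv (by simp) hsymm hsink, fun v hvW i hi => ?_⟩
      rcases eq_or_ne v v₀ with rfl | hne'
      · refine ⟨W, Function.iterate_fixed (by simp [chainStep, hv₀]) i, hvW, fun u => ?_⟩
        constructor
        · rintro (h' | h')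
          exacts [(Finset.notMem_erase _ _ (hD.1 _ _ h').2).elim, h'.1]
        · exact fun h' => .inr ⟨h', rfl⟩
      · have hcard := Finset.card_erase_add_one hmem
        obtain ⟨i, rfl⟩ : ∃ j, i = j + 1 := ⟨i - 1, by omega⟩
        obtain ⟨X, hX, hvX, hadj⟩ := hchain v (Finset.mem_erase.2 ⟨hne', hvW⟩) i (by omega)
        refine ⟨X, ?_, hvX, fun u => ?_⟩
        · have hval : (v₀ : ℕ) ≠ v := fun e => hne' (Fin.ext e.symm)
          rw [Function.iterate_succ_apply, ← hX, setCode_erase hmem, chainStep, hv₀]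
          simp [hval]
        · rw [← hadj]
          constructor
          · rintro (h' | h')
            exacts [h', (hne' h'.2).elim]
          · exact .inl

theorem IsChoice.exists_dag (h : IsChoice ρ c) (hsymm : ∀ u w S, ρ u w S ↔ ρ w u S)
    (hc : c (2 ^ n - 1) ≠ 0) :
    ∃ D : DAG (Fin n), D.IsPerfect ρ Finset.univ ∧ ∀ u v, D.Adj u v ↔ ChosenAdj ρ c u v := by
  rw [← setCode_univ] at hc
  obtain ⟨D, hD, hch⟩ := h.exists_perfect hsymm hc
  refine ⟨D, hD, fun u v => ?_⟩
  obtain ⟨X, hX, hvX, hadj⟩ := hch v (Finset.mem_univ v) n (by simp)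
  rw [setCode_univ] at hX
  rw [hadj]
  constructor
  · exact fun h' => ⟨X, hX, hvX, h'⟩
  · rintro ⟨Y, hY, -, h'⟩
    rwa [setCode_injective (hX.symm.trans hY)]

theorem ChosenAdj.congr {c' : ℕ → ℕ} (h : IsChoice ρ c) (h' : IsChoice ρ c') (u v : Fin n) :
    ChosenAdj ρ c u v ↔ ChosenAdj ρ c' u v := by
  have key : ∀ i, (chainStep c v)^[i] (2 ^ n - 1) = (chainStep c' v)^[i] (2 ^ n - 1) ∧
      (chainStep c v)^[i] (2 ^ n - 1) < 2 ^ n := by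
    intro i
    induction i with
    | zero => exact ⟨rfl, by have := Nat.two_pow_pos n; simp⟩
    | succ i ih =>
      rw [Function.iterate_succ_apply', Function.iterate_succ_apply', ← ih.1]
      obtain ⟨S, hS⟩ := exists_setCode_eq ih.2
      rw [chainStep, chainStep, ← hS, h.unique h' S]
      have := setCode_lt S
      exact ⟨rfl, by split_ifs; exacts [this, (Nat.sub_le _ _).trans_lt this]⟩
  simp only [ChosenAdj, (key n).1]

end Choice

/-! ### Logic and arithmetic as expressions -/

namespace Expr

/-- The expression, read as a truth value, holds. -/
def Holds (g : Globals) (m : ℕ → ℕ) (e : Expr) (l : List ℕ) : Prop := e.eval g m l ≠ 0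

/-- `if a then x else y` -/
def cond (a x y : Expr) : Expr := .ite (.lit 0) a x y

/-- negation -/
def neg (a : Expr) : Expr := cond a (.lit 0) (.lit 1)

/-- conjunction -/
def conj (a b : Expr) : Expr := cond a b (.lit 0)

/-- disjunction -/
def disj (a b : Expr) : Expr := cond a (.lit 1) b

/-- implication -/
def imp (a b : Expr) : Expr := cond a b (.lit 1)

/-- equivalence -/
def iff (a b : Expr) : Expr := cond a b (neg b)

/-- `a = b` -/
def eq (a b : Expr) : Expr := .ite a b (.lit 0) (.ite b a (.lit 0) (.lit 1))

/-- `∃ i < b, p`. In `p`, variable `0` is `i`, and variable `1` is not used. -/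
def ex (b p : Expr) : Expr := .iter b (.lit 0) (cond (.var 1) (.lit 1) p)

/-- `∀ i < b, p`. In `p`, variable `0` is `i`, and variable `1` is not used. -/
def all (b p : Expr) : Expr := neg (ex b (neg p))

/-- the product of variables `0` and `1` -/
def mulBody : Expr := .iter (.var 0) (.lit 0) (.add (.var 1) (.var 3))

/-- `a * b` -/
def mul (a b : Expr) : Expr := .call mulBody a b (.lit 0)

/-- `2` to the power variable `0` -/
def powBody : Expr := .iter (.var 0) (.lit 1) (.add (.var 1) (.var 1))

/-- `2 ^ a` -/
def pow (a : Expr) : Expr := .call powBody a (.lit 0) (.lit 0)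

/-- the remainder of variable `0` modulo variable `1`, by repeated subtraction -/
def modBody : Expr :=
  .iter (.var 0) (.var 0) (.ite (.var 1) (.var 3) (.var 1) (.sub (.var 1) (.var 3)))

/-- `a % b` -/
def mod (a b : Expr) : Expr := .call modBody a b (.lit 0)

/-- the quotient of variable `0` by variable `1`, counting the multiples that can be subtracted -/
def divBody : Expr :=
  .iter (.var 0) (.lit 0) (.ite (.sub (.var 2) (mul (.var 0) (.var 3))) (.var 3) (.var 1)
    (.add (.var 1) (.lit 1)))

/-- `a / b` -/
def div (a b : Expr) : Expr := .call divBody a b (.lit 0)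

/-- the binary digit of variable `0` at the place given by variable `1` -/
def bitBody : Expr := mod (div (.var 0) (pow (.var 1))) (.lit 2)

/-- the binary digit of `a` at place `b` -/
def bit (a b : Expr) : Expr := .call bitBody a b (.lit 0)

variable {g : Globals} {m : ℕ → ℕ} {l : List ℕ} {a b c x y p f : Expr}

theorem eval_cond [Decidable (a.Holds g m l)] :
    (cond a x y).eval g m l = if a.Holds g m l then x.eval g m l else y.eval g m l := by
  simp only [cond, eval, Holds, Nat.pos_iff_ne_zero, Fin.val_zero] at *
  congr

theorem holds_cond :
    (cond a x y).Holds g m l ↔ (a.Holds g m l ∧ x.Holds g m l ∨ ¬ a.Holds g m l ∧ y.Holds g m l) := by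
  classical
  rw [Holds, eval_cond]
  split_ifs with h
  · simp only [h, true_and, not_true_eq_false, false_and, or_false]
    rfl
  · simp only [h, false_and, not_false_eq_true, true_and, false_or]
    rfl

theorem not_holds_zero : ¬ (lit 0).Holds g m l := by simp [Holds, eval]

theorem holds_one : (lit 1).Holds g m l := by simp [Holds, eval]

theorem holds_neg : (neg a).Holds g m l ↔ ¬ a.Holds g m l := by
  simp [neg, holds_cond, not_holds_zero, holds_one]

theorem holds_conj : (conj a b).Holds g m l ↔ a.Holds g m l ∧ b.Holds g m l := by
  simp [conj, holds_cond, not_holds_zero]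

theorem holds_disj : (disj a b).Holds g m l ↔ a.Holds g m l ∨ b.Holds g m l := by
  simp only [disj, holds_cond, holds_one]
  tauto

theorem holds_imp : (imp a b).Holds g m l ↔ (a.Holds g m l → b.Holds g m l) := by
  simp only [imp, holds_cond, holds_one]
  tauto

theorem holds_iff : (iff a b).Holds g m l ↔ (a.Holds g m l ↔ b.Holds g m l) := by
  simp only [iff, holds_cond, holds_neg]
  tauto

theorem holds_eq : (eq a b).Holds g m l ↔ a.eval g m l = b.eval g m l := by
  simp only [eq, Holds, eval]
  split_ifs with h h' <;> simp <;> omega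

theorem holds_ite : (Expr.ite a b x y).Holds g m l ↔
    if a.eval g m l < b.eval g m l then x.Holds g m l else y.Holds g m l := by
  simp only [Holds, eval]
  split_ifs <;> rfl

theorem holds_call : (call f a b c).Holds g m l ↔
    f.Holds g m [a.eval g m l, b.eval g m l, c.eval g m l] := Iff.rfl

theorem holds_ex : (ex b p).Holds g m l ↔ ∃ i < b.eval g m l, p.Holds g m (i :: 0 :: l) := by
  have hbody : ∀ i acc, (cond (.var 1) (.lit 1) p).eval g m (i :: acc :: l) =
      if acc = 0 then p.eval g m (i :: acc :: l) else 1 := by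
    intro i acc
    by_cases h : acc = 0 <;> simp [cond, eval, h, Nat.pos_iff_ne_zero]
  simp only [Holds, ex, eval, hbody]
  generalize b.eval g m l = N
  induction N with
  | zero => simp [iterate]
  | succ N ih =>
    simp only [iterate, Nat.lt_succ_iff_lt_or_eq, or_and_right, exists_or, exists_eq_left]
    refine Iff.trans ?_ (or_congr_left ih)
    generalize iterate _ _ N = acc
    by_cases h : acc = 0 <;> simp [h]

theorem holds_all : (all b p).Holds g m l ↔ ∀ i < b.eval g m l, p.Holds g m (i :: 0 :: l) := by
  simp [all, holds_neg, holds_ex]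

theorem iterate_const_add (k N B : ℕ) : iterate (fun _ acc => min (acc + k) B) 0 N = min (N * k) B := by
  induction N with
  | zero => simp [iterate]
  | succ N ih =>
    rw [iterate, ih, Nat.add_mul]
    omega

theorem eval_mul : (mul a b).eval g m l = min (a.eval g m l * b.eval g m l) (g 2) := by
  simp [mul, mulBody, eval, iterate_const_add]

theorem eval_pow (hg : 2 ≤ g 2) : (pow a).eval g m l = min (2 ^ a.eval g m l) (g 2) := by
  simp only [pow, powBody, eval, List.getD_cons_succ, List.getD_cons_zero]
  generalize a.eval g m l = N
  induction N with
  | zero => simp [iterate]; omega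
  | succ N ih =>
    rw [iterate, ih, pow_succ]
    omega

theorem iterate_sub (k a N : ℕ) : ∃ q ≤ N, iterate (fun _ acc => if acc < k then acc else acc - k) a N
    + q * k = a ∧ (iterate (fun _ acc => if acc < k then acc else acc - k) a N < k ∨ q = N) := by
  induction N with
  | zero => exact ⟨0, le_rfl, by simp [iterate], .inr rfl⟩
  | succ N ih =>
    obtain ⟨q, hq, he, h⟩ := ih
    rw [iterate]
    split_ifs with hlt
    · exact ⟨q, by omega, he, .inl hlt⟩
    · exact ⟨q + 1, by omega, by rw [Nat.add_mul]; omega, .inr (by omega)⟩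

theorem eval_mod : (mod a b).eval g m l = a.eval g m l % b.eval g m l := by
  simp only [mod, modBody, eval, List.getD_cons_succ, List.getD_cons_zero]
  generalize a.eval g m l = a, b.eval g m l = b
  obtain ⟨q, hq, he, h⟩ := iterate_sub b a a
  generalize iterate (fun _ acc => if acc < b then acc else acc - b) a a = r at he h
  have hr : r % b = a % b := by
    rw [← he, Nat.add_mul_mod_self_right]
  rcases Nat.eq_zero_or_pos b with rfl | hb
  · simpa using hr
  · rw [← hr, Nat.mod_eq_of_lt]
    rcases h with h | rfl
    · exact h
    · have : q * 1 ≤ q * b := Nat.mul_le_mul_left _ hb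
      omega

theorem eval_div (hb : 0 < b.eval g m l) (ha : a.eval g m l ≤ g 2) :
    (div a b).eval g m l = a.eval g m l / b.eval g m l := by
  simp only [div, divBody, eval, eval_mul, List.getD_cons_succ, List.getD_cons_zero]
  generalize a.eval g m l = a at ha ⊢
  generalize b.eval g m l = b at hb ⊢
  have key : ∀ N, iterate (fun i acc => if a - min (i * b) (g 2) < b then acc
      else min (acc + (1 : Fin 3)) (g 2)) 0 N = min N (a / b) := by
    intro N
    have hdiv : a / b ≤ a := Nat.div_le_self _ _
    induction N with
    | zero => simp [iterate]
    | succ N ih =>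
      rw [iterate, ih]
      have hiff : N + 1 ≤ a / b ↔ (N + 1) * b ≤ a := Nat.le_div_iff_mul_le hb
      rw [Nat.add_mul] at hiff
      have h1 : ((1 : Fin 3) : ℕ) = 1 := rfl
      rw [h1]
      split_ifs with h <;> omega
  have := key a
  rw [min_eq_right (Nat.div_le_self _ _)] at this
  exact this

theorem holds_bitBody (hg : 2 ≤ g 2) {s w z : ℕ} (hs : s ≤ g 2) (hw : 2 ^ w ≤ g 2) :
    bitBody.Holds g m [s, w, z] ↔ s.testBit w = true := by
  have hp := Nat.two_pow_pos w
  have hpow : (pow (.var 1)).eval g m [s, w, z] = 2 ^ w := by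
    rw [eval_pow hg]
    simpa [eval] using hw
  rw [Holds, bitBody, eval_mod, eval_div (by omega) (by simpa [eval] using hs), hpow,
    Nat.testBit_eq_decide_div_mod_eq]
  have h2 : (lit 2).eval g m [s, w, z] = 2 := rfl
  rw [h2]
  simp only [eval, List.getD_cons_zero, decide_eq_true_eq]
  omega

end Expr

/-! ### The expressions of the algorithm -/

/-- The values of the global registers that hold parameters: the number `n` of vertices, the bound
for all numbers, `2 ^ n`, the number `n * n * 2 ^ n` of codes of queries, the number of digits, and
the addresses of the table of the oracle's answers (`g 4`), of the digits (`g 6`), of the table of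
possible sinks (`g 7`) and of the set to be queried (`g 8`). -/
structure Layout (n : ℕ) (g : Globals) : Prop where
  pos : 1 ≤ n
  g0 : g 0 = n
  g3 : g 3 = 2 ^ n
  g4 : g 4 = n * n * 2 ^ n
  g5 : g 5 ≤ g 4
  g6 : g 6 = g 4 + g 4
  g7 : g 7 = g 6 + g 4
  g8 : g 8 = g 7 + g 4
  cap : g 8 + g 4 + g 4 ≤ g 2

section Layout

variable {n : ℕ} {g : Globals} {m : ℕ → ℕ}

theorem Layout.le_g4 (h : Layout n g) : n * n ≤ g 4 ∧ n ≤ g 4 ∧ 2 ^ n ≤ g 4 := by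
  have h1 := Nat.two_pow_pos n
  have h2 := h.pos
  rw [h.g4]
  refine ⟨Nat.le_mul_of_pos_right _ h1, ?_, Nat.le_mul_of_pos_left _ (by positivity)⟩
  calc n = n * 1 * 1 := by simp
    _ ≤ n * n * 2 ^ n := by gcongr; omega

theorem Layout.two_le_g4 (h : Layout n g) : 2 ≤ g 4 := by
  have := h.le_g4.2.2
  have h2 : 2 ^ 1 ≤ 2 ^ n := Nat.pow_le_pow_right (by omega) h.pos
  omega

theorem Layout.two_le (h : Layout n g) : 2 ≤ g 2 := by
  have := h.two_le_g4
  have := h.cap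
  omega

theorem Layout.eval_glob (h : Layout n g) (i : Fin 24) (hi : i.val < 9 ∧ i.val ≠ 1) (l : List ℕ) :
    (Expr.glob i).eval g m l = g i := by
  have h1 := h.le_g4
  obtain ⟨hp, h0, h3, h4, h5, h6, h7, h8, hc⟩ := h
  rw [Expr.eval]
  apply min_eq_left
  obtain ⟨i, hi'⟩ := i
  simp only at hi
  have : i = 0 ∨ i = 2 ∨ i = 3 ∨ i = 4 ∨ i = 5 ∨ i = 6 ∨ i = 7 ∨ i = 8 := by omega
  rcases this with rfl | rfl | rfl | rfl | rfl | rfl | rfl | rfl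
  · change g 0 ≤ g 2; omega
  · change g 2 ≤ g 2; omega
  · change g 3 ≤ g 2; omega
  · change g 4 ≤ g 2; omega
  · change g 5 ≤ g 2; omega
  · change g 6 ≤ g 2; omega
  · change g 7 ≤ g 2; omega
  · change g 8 ≤ g 2; omega

theorem Layout.eval_n (h : Layout n g) (l : List ℕ) : (Expr.glob 0).eval g m l = n :=
  (h.eval_glob 0 (by simp) l).trans h.g0

theorem Layout.eval_sets (h : Layout n g) (l : List ℕ) : (Expr.glob 3).eval g m l = 2 ^ n :=
  (h.eval_glob 3 (by simp) l).trans h.g3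

theorem Layout.holds_bitBody (h : Layout n g) (S : Finset (Fin n)) (v : Fin n) (z : ℕ) :
    Expr.bitBody.Holds g m [setCode S, v, z] ↔ v ∈ S := by
  have h1 := h.le_g4
  have h2 := setCode_lt S
  have h3 : 2 ^ (v : ℕ) ≤ 2 ^ n := Nat.pow_le_pow_right (by omega) v.2.le
  have h4 := h.cap
  rw [Expr.holds_bitBody h.two_le (by omega) (by omega), testBit_setCode_val]

/-- Quantification over the vertices. -/
theorem Layout.holds_all_vertices (h : Layout n g) {p : Expr} {l : List ℕ} :
    (Expr.all (.glob 0) p).Holds g m l ↔ ∀ v : Fin n, p.Holds g m ((v : ℕ) :: 0 :: l) := by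
  rw [Expr.holds_all, h.eval_n]
  exact ⟨fun h v => h v v.2, fun h i hi => h ⟨i, hi⟩⟩

theorem Layout.holds_ex_vertices (h : Layout n g) {p : Expr} {l : List ℕ} :
    (Expr.ex (.glob 0) p).Holds g m l ↔ ∃ v : Fin n, p.Holds g m ((v : ℕ) :: 0 :: l) := by
  rw [Expr.holds_ex, h.eval_n]
  exact ⟨fun ⟨i, hi, h⟩ => ⟨⟨i, hi⟩, h⟩, fun ⟨v, h⟩ => ⟨v, v.2, h⟩⟩

/-- Quantification over the sets of vertices. -/
theorem Layout.holds_all_sets (h : Layout n g) {p : Expr} {l : List ℕ} :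
    (Expr.all (.glob 3) p).Holds g m l ↔
      ∀ S : Finset (Fin n), p.Holds g m (setCode S :: 0 :: l) := by
  rw [Expr.holds_all, h.eval_sets]
  refine ⟨fun h S => h _ (setCode_lt S), fun h i hi => ?_⟩
  obtain ⟨S, rfl⟩ := exists_setCode_eq hi
  exact h S

end Layout

/-- The code of a triple consisting of two vertices and a set. -/
def code {n : ℕ} (u v : Fin n) (S : Finset (Fin n)) : ℕ := (u * n + v) * 2 ^ n + setCode S

theorem code_lt {n : ℕ} (u v : Fin n) (S : Finset (Fin n)) : code u v S < n * n * 2 ^ n := by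
  have h1 : (u : ℕ) * n + v < n * n := by
    have : (u : ℕ) + 1 ≤ n := u.2
    have : ((u : ℕ) + 1) * n ≤ n * n := Nat.mul_le_mul_right _ this
    rw [Nat.add_mul] at this
    have := v.2
    omega
  have h2 : ((u : ℕ) * n + v + 1) * 2 ^ n ≤ n * n * 2 ^ n := Nat.mul_le_mul_right _ h1
  have h3 := setCode_lt S
  rw [Nat.add_mul] at h2
  rw [code]
  omega

theorem code_injective {n : ℕ} {u v u' v' : Fin n} {S S' : Finset (Fin n)}
    (h : code u v S = code u' v' S') : u = u' ∧ v = v' ∧ S = S' := by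
  have key : ∀ {a b c d k : ℕ}, b < k → d < k → a * k + b = c * k + d → a = c ∧ b = d := by
    intro a b c d k hb hd he
    have hk : 0 < k := by omega
    have h1 := congrArg (· / k) he
    have h2 := congrArg (· % k) he
    simp only [mul_comm _ k, Nat.mul_add_div hk, Nat.div_eq_of_lt hb, Nat.div_eq_of_lt hd,
      Nat.mul_add_mod, Nat.mod_eq_of_lt hb, Nat.mod_eq_of_lt hd] at h1 h2
    exact ⟨by simpa using h1, h2⟩
  obtain ⟨h1, h2⟩ := key (setCode_lt S) (setCode_lt S') h
  obtain ⟨h3, h4⟩ := key v.2 v'.2 h1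
  exact ⟨Fin.ext h3, Fin.ext h4, setCode_injective h2⟩

/-- The answer recorded for the code `a`, reversed if `a` is among the digits. -/
def EntryHolds (g : Globals) (m : ℕ → ℕ) (a : ℕ) : Prop :=
  ¬ (m (g 4 + a) ≠ 0 ↔ ∃ i < g 5, m (g 6 + i) = a)

/-- The independencies given by the recorded answers and the digits. -/
def MemIndep {n : ℕ} (g : Globals) (m : ℕ → ℕ) (u v : Fin n) (S : Finset (Fin n)) : Prop :=
  u ≠ v ∧ u ∉ S ∧ v ∉ S ∧ if u < v then EntryHolds g m (code u v S) else EntryHolds g m (code v u S)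

namespace Expr

/-- the code of the query with the variables `0` to `2` -/
def codeBody : Expr := .add (mul (.add (mul (.var 0) (.glob 0)) (.var 1)) (.glob 3)) (.var 2)

/-- whether the entry for the code in variable `0` holds -/
def entryBody : Expr :=
  neg (iff (.load (.add (.glob 4) (.var 0)))
    (ex (.glob 5) (eq (.load (.add (.glob 6) (.var 0))) (.var 2))))

/-- whether the vertices `0` and `1` are independent given the set `2` -/
def indepBody : Expr :=
  conj (neg (eq (.var 0) (.var 1))) (conj (neg (bit (.var 2) (.var 0)))
    (conj (neg (bit (.var 2) (.var 1)))
      (.ite (.var 0) (.var 1)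
        (.call entryBody (.call codeBody (.var 0) (.var 1) (.var 2)) (.lit 0) (.lit 0))
        (.call entryBody (.call codeBody (.var 1) (.var 0) (.var 2)) (.lit 0) (.lit 0)))))

/-- whether variable `2` is a parent of the vertex `0` that comes after the set `1` -/
def parentBody : Expr :=
  conj (bit (.var 1) (.var 2))
    (neg (.call indepBody (.var 2) (.var 0) (.sub (.var 1) (pow (.var 2)))))

/-- inclusion of the set `0` in the set `1` -/
def subsetBody : Expr := all (.glob 0) (imp (bit (.var 2) (.var 0)) (bit (.var 3) (.var 0)))

/-- whether the vertex `0` can be a sink after the set `1`. Each quantifier shifts the numbers of the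
variables by two. -/
def sinkBody : Expr :=
  all (.glob 0) (imp (bit (.var 3) (.var 0))
    (all (.glob 3) (imp (conj (.call subsetBody (.var 0) (.var 5) (.lit 0))
        (neg (bit (.var 0) (.var 2))))
      (conj
        (iff (.call indepBody (.var 2) (.var 4) (.var 0))
          (neg (ex (.glob 0) (conj (neg (bit (.var 2) (.var 0)))
            (conj (.call parentBody (.var 6) (.var 7) (.var 0))
              (disj (eq (.var 0) (.var 4))
                (neg (.call indepBody (.var 4) (.var 0) (.var 2)))))))))
        (all (.glob 0) (imp (conj (bit (.var 7) (.var 0))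
            (conj (neg (bit (.var 2) (.var 0))) (neg (eq (.var 0) (.var 4)))))
          (iff (.call indepBody (.var 4) (.var 0) (.add (.var 2) (pow (.var 6))))
            (conj (.call indepBody (.var 4) (.var 0) (.var 2))
              (disj (.call indepBody (.var 4) (.var 6) (.var 2))
                (.call indepBody (.var 0) (.var 6) (.var 2)))))))))))

/-- the entry of the table of possible sinks for the set in register `11` -/
def choice : Expr :=
  .ite (.lit 0) (.glob 11)
    (.iter (.glob 0) (.lit 0) (cond
      (conj (bit (.glob 11) (.var 0))
        (conj (.load (.add (.glob 7) (.sub (.glob 11) (pow (.var 0)))))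
          (.call sinkBody (.var 0) (.sub (.glob 11) (pow (.var 0))) (.lit 0))))
      (.add (.var 0) (.lit 1)) (.var 1)))
    (.add (.glob 0) (.lit 1))

/-- the end of the chain of sets for the vertex `0` -/
def chainBody : Expr :=
  .iter (.glob 0) (.sub (.glob 3) (.lit 1))
    (cond (eq (.load (.add (.glob 7) (.var 1))) (.add (.var 2) (.lit 1))) (.var 1)
      (.sub (.var 1) (pow (.sub (.load (.add (.glob 7) (.var 1))) (.lit 1)))))

/-- whether `2` is a parent of the vertex `1`, chosen at the set `0` -/
def chosenBody : Expr :=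
  conj (bit (.var 0) (.var 1))
    (.call parentBody (.var 1) (.sub (.var 0) (pow (.var 1))) (.var 2))

/-- whether there is an arc from the vertex `0` to the vertex `1` -/
def arcBody : Expr :=
  cond (.call chosenBody (.call chainBody (.var 1) (.lit 0) (.lit 0)) (.var 1) (.var 0)) (.lit 1)
    (.lit 0)

end Expr

open BNSL.Expr

section Semantics

variable {n : ℕ} {g : Globals} {m : ℕ → ℕ}

theorem Layout.eval_codeBody (h : Layout n g) (u v : Fin n) (S : Finset (Fin n)) :
    codeBody.eval g m [u, v, setCode S] = code u v S := by
  have h1 := code_lt u v S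
  have h2 := h.cap
  have h3 : (u : ℕ) * n + v ≤ ((u : ℕ) * n + v) * 2 ^ n := Nat.le_mul_of_pos_right _ (by positivity)
  rw [← h.g4] at h1
  simp only [codeBody, Expr.eval, eval_mul, List.getD_cons_zero, List.getD_cons_succ]
  have e0 := h.eval_n (m := m) []
  have e3 := h.eval_sets (m := m) []
  simp only [Expr.eval] at e0 e3
  rw [e0, e3]
  rw [code] at *
  rw [min_eq_left (a := (u : ℕ) * n) (by omega), min_eq_left (a := (u : ℕ) * n + v) (by omega),
    min_eq_left (a := ((u : ℕ) * n + v) * 2 ^ n) (by omega), min_eq_left (by omega)]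

theorem Layout.eval_load (h : Layout n g) {i : Fin 24} (hi : i = 4 ∨ i = 6 ∨ i = 7) {e : Expr}
    {l : List ℕ} (he : e.eval g m l < g 4) :
    (Expr.load (.add (.glob i) e)).eval g m l = min (m (g i + e.eval g m l)) (g 2) := by
  have h2 := h.cap
  have h6 := h.g6
  have h7 := h.g7
  have h8 := h.g8
  have : (Expr.add (.glob i) e).eval g m l = g i + e.eval g m l := by
    have hlt : g i + g 4 ≤ g 2 := by
      rcases hi with rfl | rfl | rfl <;> omega
    rw [Expr.eval, h.eval_glob i (by rcases hi with rfl | rfl | rfl <;> simp), min_eq_left (by omega)]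
  rw [Expr.eval, this]

theorem Layout.holds_load (h : Layout n g) {i : Fin 24} (hi : i = 4 ∨ i = 6 ∨ i = 7) {e : Expr}
    {l : List ℕ} (he : e.eval g m l < g 4) :
    (Expr.load (.add (.glob i) e)).Holds g m l ↔ min (m (g i + e.eval g m l)) (g 2) ≠ 0 := by
  rw [Holds, h.eval_load hi he]

theorem Layout.holds_entryBody (h : Layout n g) {a y z : ℕ} (ha : a < g 4) :
    entryBody.Holds g m [a, y, z] ↔ EntryHolds g m a := by
  have h2 := h.cap
  have h5 := h.g5
  have h2' := h.two_le
  rw [entryBody, holds_neg, holds_iff, holds_ex, EntryHolds, h.eval_glob 5 (by simp)]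
  simp only [holds_eq]
  rw [h.holds_load (by simp) (by simpa [Expr.eval] using ha)]
  refine not_congr (iff_congr ?_ (exists_congr fun i => and_congr_right fun hi => ?_))
  · simp only [Expr.eval, List.getD_cons_zero]
    omega
  · rw [h.eval_load (by simp) (by simp [Expr.eval]; omega)]
    simp only [Expr.eval, List.getD_cons_zero, List.getD_cons_succ]
    omega

theorem Layout.holds_indepBody (h : Layout n g) (u v : Fin n) (S : Finset (Fin n)) :
    indepBody.Holds g m [(u : ℕ), v, setCode S] ↔ MemIndep g m u v S := by
  have hc := fun u v => h.g4 ▸ code_lt u v S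
  simp only [indepBody, holds_conj, holds_neg, holds_eq, bit, holds_call, holds_ite, Expr.eval,
    List.getD_cons_zero, List.getD_cons_succ, h.holds_bitBody, h.eval_codeBody,
    h.holds_entryBody (hc _ _), MemIndep, Fin.val_inj, Fin.val_fin_lt, ne_eq]

theorem Layout.min_two_pow (h : Layout n g) (v : Fin n) : min (2 ^ (v : ℕ)) (g 2) = 2 ^ (v : ℕ) := by
  have h1 := h.le_g4
  have h3 : 2 ^ (v : ℕ) ≤ 2 ^ n := Nat.pow_le_pow_right (by omega) v.2.le
  have h4 := h.cap
  omega

theorem Layout.holds_parentBody (h : Layout n g) (v : Fin n) (W : Finset (Fin n)) (u : Fin n) :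
    parentBody.Holds g m [(v : ℕ), setCode W, u] ↔ IsParent (MemIndep g m) v W u := by
  simp only [parentBody, holds_conj, holds_neg, bit, holds_call, Expr.eval, eval_pow h.two_le,
    List.getD_cons_zero, List.getD_cons_succ, h.holds_bitBody, h.min_two_pow, IsParent]
  refine and_congr_right fun hu => ?_
  rw [← setCode_erase hu, h.holds_indepBody]

theorem Layout.holds_subsetBody (h : Layout n g) (S W : Finset (Fin n)) (z : ℕ) :
    subsetBody.Holds g m [setCode S, setCode W, z] ↔ S ⊆ W := by
  simp only [subsetBody, h.holds_all_vertices, holds_imp, bit, holds_call, Expr.eval,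
    List.getD_cons_zero, List.getD_cons_succ, h.holds_bitBody]
  rfl

theorem Layout.holds_sinkBody (h : Layout n g) {v : Fin n} {W : Finset (Fin n)} (hv : v ∉ W)
    (z : ℕ) :
    sinkBody.Holds g m [(v : ℕ), setCode W, z] ↔ SinkCond (MemIndep g m) v W := by
  simp only [sinkBody, h.holds_all_vertices, h.holds_all_sets, h.holds_ex_vertices, holds_imp,
    holds_iff, holds_conj, holds_disj, holds_neg, holds_eq, bit, holds_call, Expr.eval,
    eval_pow h.two_le, List.getD_cons_zero, List.getD_cons_succ, h.holds_bitBody, h.min_two_pow,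
    h.holds_parentBody, h.holds_subsetBody, h.holds_indepBody, Fin.val_inj, SinkCond, and_imp]
  refine forall_congr' fun u => imp_congr_right fun hu => forall_congr' fun S =>
    imp_congr_right fun hS => imp_congr_right fun huS => and_congr Iff.rfl ?_
  refine forall_congr' fun w => imp_congr_right fun hw => imp_congr_right fun hwS =>
    imp_congr_right fun hwu => ?_
  have hvS : v ∉ S := fun h' => hv (hS h')
  have hlt := setCode_lt (insert v S)
  have h1 := h.le_g4
  have h4 := h.cap
  rw [← setCode_insert hvS, min_eq_left (by omega), h.holds_indepBody]

/-- The table of possible sinks in the memory. -/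
def memChoice (g : Globals) (m : ℕ → ℕ) (X : ℕ) : ℕ := min (m (g 7 + X)) (g 2)

theorem Layout.n_add_one_le (h : Layout n g) : n + 1 ≤ g 2 := by
  have h1 := h.le_g4
  have h2 := h.two_le_g4
  have h4 := h.cap
  omega

theorem Layout.eval_choice (h : Layout n g) {W : Finset (Fin n)} (hW : g 11 = setCode W) :
    choice.eval g m [] = if W = ∅ then n + 1 else
      lastSat (Choosable (MemIndep g m) (memChoice g m) W) n := by
  classical
  have hlt := setCode_lt W
  have h1 := h.le_g4
  have h4 := h.cap
  have hn := h.n_add_one_le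
  have hmin : min (setCode W) (g 2) = setCode W := min_eq_left (by omega)
  have hglob : ∀ l, (Expr.glob 11).eval g m l = setCode W := fun l => by rw [Expr.eval, hW, hmin]
  rw [choice, Expr.eval, hglob]
  have h0 : (0 < setCode W) ↔ W ≠ ∅ := by
    rw [Nat.pos_iff_ne_zero, ← setCode_empty (n := n), ne_eq, setCode_injective.eq_iff]
  by_cases hne : W = ∅
  · rw [if_pos hne, if_neg (by simpa [Expr.eval] using fun h => h0.1 h hne)]
    rw [Expr.eval, h.eval_n]
    exact min_eq_left hn
  · rw [if_neg hne, if_pos (by simpa [Expr.eval] using h0.2 hne), Expr.eval, h.eval_n, lastSat]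
    -- the loop of the program agrees step by step with the search for the last possible sink
    suffices ∀ i ≤ n, iterate (fun i acc => (Expr.cond _ _ (Expr.var 1)).eval g m [i, acc]) 0 i =
        iterate (fun v acc => if Choosable (MemIndep g m) (memChoice g m) W v then v + 1 else acc)
          0 i from this n le_rfl
    intro i hi
    induction i with
    | zero => rfl
    | succ i ih =>
      rw [iterate, iterate, ih (by omega), eval_cond]
      generalize iterate _ 0 i = acc
      have hv : Holds g m (conj (bit (.glob 11) (.var 0))
          (conj (.load (.add (.glob 7) (.sub (.glob 11) (pow (.var 0)))))
            (.call sinkBody (.var 0) (.sub (.glob 11) (pow (.var 0))) (.lit 0)))) [i, acc] ↔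
          Choosable (MemIndep g m) (memChoice g m) W i := by
        obtain ⟨v, rfl⟩ : ∃ v : Fin n, (v : ℕ) = i := ⟨⟨i, by omega⟩, rfl⟩
        have hsub : (Expr.sub (.glob 11) (pow (.var 0))).eval g m [(v : ℕ), acc] =
            setCode W - 2 ^ (v : ℕ) := by
          rw [Expr.eval, hglob, eval_pow h.two_le]
          simp only [Expr.eval, List.getD_cons_zero, h.min_two_pow]
        simp only [holds_conj, bit, holds_call, hsub]
        rw [h.holds_load (by simp) (hsub ▸ (Nat.sub_le _ _).trans_lt (by omega)), hsub, hglob]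
        simp only [Expr.eval, List.getD_cons_zero]
        rw [h.holds_bitBody, Choosable]
        simp only [v.2, exists_true_left, Fin.eta]
        refine and_congr_right fun hvW => ?_
        rw [← setCode_erase hvW, h.holds_sinkBody (Finset.notMem_erase v W), memChoice]
      by_cases hC : Choosable (MemIndep g m) (memChoice g m) W i
      · rw [if_pos hC, if_pos (hv.2 hC)]
        simp only [Expr.eval, List.getD_cons_zero]
        exact min_eq_left (show i + 1 ≤ g 2 by omega)
      · rw [if_neg hC, if_neg (fun h => hC (hv.1 h))]
        simp [Expr.eval]

theorem Layout.eval_chainBody (h : Layout n g) (v : Fin n) (y z : ℕ) :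
    chainBody.eval g m [(v : ℕ), y, z] = (chainStep (memChoice g m) v)^[n] (2 ^ n - 1) ∧
      (chainStep (memChoice g m) v)^[n] (2 ^ n - 1) < 2 ^ n := by
  classical
  have h1 := h.le_g4
  have h4 := h.cap
  have hn := h.n_add_one_le
  have hpos := Nat.two_pow_pos n
  rw [chainBody, Expr.eval, h.eval_n, Expr.eval, h.eval_sets]
  suffices ∀ i, iterate (fun i acc => (Expr.cond _ _ _).eval g m (i :: acc :: [(v : ℕ), y, z]))
      (2 ^ n - 1) i = (chainStep (memChoice g m) v)^[i] (2 ^ n - 1) ∧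
      (chainStep (memChoice g m) v)^[i] (2 ^ n - 1) < 2 ^ n from this n
  intro i
  induction i with
  | zero => exact ⟨rfl, by simp⟩
  | succ i ih =>
    rw [iterate, Function.iterate_succ_apply', ih.1]
    generalize (chainStep (memChoice g m) v)^[i] (2 ^ n - 1) = X at ih
    have hX := ih.2
    have hload : (Expr.load (.add (.glob 7) (.var 1))).eval g m [i, X, (v : ℕ), y, z] =
        memChoice g m X := h.eval_load (by simp) (show X < g 4 by omega)
    have hadd : (Expr.add (.var 2) (.lit 1)).eval g m [i, X, (v : ℕ), y, z] = (v : ℕ) + 1 :=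
      min_eq_left (show (v : ℕ) + 1 ≤ g 2 by omega)
    rw [eval_cond, holds_eq, hload, hadd, chainStep]
    have hstep : (Expr.sub (.var 1) (pow (.sub (.load (.add (.glob 7) (.var 1))) (.lit 1)))).eval
        g m [i, X, (v : ℕ), y, z] = X - 2 ^ (memChoice g m X - 1) := by
      have hpred : (Expr.sub (.load (.add (.glob 7) (.var 1))) (.lit 1)).eval
          g m [i, X, (v : ℕ), y, z] = memChoice g m X - 1 := by
        rw [Expr.eval, hload]
        rfl
      rw [Expr.eval, eval_pow h.two_le, hpred]
      simp only [Expr.eval, List.getD_cons_zero, List.getD_cons_succ]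
      omega
    rw [hstep]
    refine ⟨by split_ifs <;> rfl, ?_⟩
    split_ifs
    exacts [hX, (Nat.sub_le _ _).trans_lt hX]

open Classical in
theorem Layout.eval_arcBody (h : Layout n g) (u v : Fin n) (z : ℕ) :
    arcBody.eval g m [(u : ℕ), v, z] =
      if ChosenAdj (MemIndep g m) (memChoice g m) u v then 1 else 0 := by
  obtain ⟨h1, h2⟩ := h.eval_chainBody (m := m) v 0 0
  obtain ⟨X, hX⟩ := exists_setCode_eq h2
  have hiff : (Expr.call chosenBody (.call chainBody (.var 1) (.lit 0) (.lit 0)) (.var 1)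
      (.var 0)).Holds g m [(u : ℕ), v, z] ↔ ChosenAdj (MemIndep g m) (memChoice g m) u v := by
    have e : (Expr.call chainBody (.var 1) (.lit 0) (.lit 0)).eval g m [(u : ℕ), v, z] = setCode X :=
      h1.trans hX.symm
    rw [holds_call, e, chosenBody, holds_conj]
    simp only [bit, holds_call, Expr.eval, eval_pow h.two_le,
      List.getD_cons_zero, List.getD_cons_succ, h.holds_bitBody, h.min_two_pow, ChosenAdj]
    constructor
    · rintro ⟨hv, hp⟩
      rw [← setCode_erase hv, h.holds_parentBody] at hp
      exact ⟨X, hX.symm, hv, hp⟩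
    · rintro ⟨Y, hY, hv, hp⟩
      obtain rfl := setCode_injective (hX.trans hY)
      rw [← setCode_erase hv, h.holds_parentBody]
      exact ⟨hv, hp⟩
  rw [arcBody, eval_cond]
  simp only [hiff]
  rfl

end Semantics

/-! ### Setting up the parameters -/

/-- A sequence of assignments. -/
def assigns : List (Fin 24 × Expr) → Prog
  | [] => .skip
  | p :: L => .seq (assign p.1 p.2) (assigns L)

/-- The effect of a sequence of assignments. -/
def afterAssigns (m : ℕ → ℕ) : List (Fin 24 × Expr) → Globals → Globals
  | [], g => g
  | p :: L, g => afterAssigns m L (Function.update g p.1 (p.2.eval g m []))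

theorem afterAssigns_of_ne {m : ℕ → ℕ} {r : Fin 24} {L : List (Fin 24 × Expr)} :
    ∀ {g : Globals}, (∀ p ∈ L, p.1 ≠ r) → afterAssigns m L g r = g r := by
  induction L with
  | nil => exact fun _ => rfl
  | cons p L ih =>
    intro g h
    rw [afterAssigns, ih fun q hq => h q (by simp [hq]),
      Function.update_of_ne (h p (by simp)).symm]

theorem poly_assigns (L : List (Fin 24 × Expr)) (hL : ∀ p ∈ L, p.1 ≠ 2) :
    Poly (assigns L) (fun _ _ _ _ => True)
      fun _ _ g m g' m' => g' = afterAssigns m L g ∧ m' = m := by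
  induction L with
  | nil =>
    refine ⟨0, fun n Q g m _ _ s hs hm => ⟨1, s, .skip s, by simp, ?_, hm⟩⟩
    exact funext hs
  | cons p L ih =>
    refine (poly_assign p.1 p.2).seq (ih fun q hq => hL q (by simp [hq])) ?_ ?_
    · rintro n Q g m g' m' - - ⟨rfl, rfl⟩
      exact ⟨Function.update_of_ne (hL p (by simp)).symm _ _, trivial⟩
    · rintro n Q g m g' m' g'' m'' - - ⟨rfl, rfl⟩ ⟨rfl, rfl⟩
      exact ⟨rfl, rfl⟩

theorem runs_const {n : ℕ} {Q : CIOracle n} {g : Globals} {m : ℕ → ℕ} (x : Fin 24) (c : ℕ) :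
    Runs Q (.instr (.const x c)) 1 g m fun g' m' => g' = Function.update g x c ∧ m' = m := by
  intro s hs hm
  refine ⟨_, _, .instr _ _, le_rfl, ?_, hm⟩
  funext i
  rcases eq_or_ne i x with rfl | hi
  · simp [Instr.run]
  · have : (i : ℕ) ≠ x := fun h => hi (Fin.ext h)
    simp [Instr.run, this, hi, hs i]

theorem runs_add {n : ℕ} {Q : CIOracle n} {g : Globals} {m : ℕ → ℕ} (x y z : Fin 24) :
    Runs Q (.instr (.add x y z)) (1 + g z) g m fun g' m' =>
      g' = Function.update g x (g y + g z) ∧ m' = m := by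
  intro s hs hm
  refine ⟨_, _, .instr _ _, by simp [Instr.cost, hs z], ?_, hm⟩
  funext i
  rcases eq_or_ne i x with rfl | hi
  · simp [Instr.run, hs y, hs z]
  · have : (i : ℕ) ≠ x := fun h => hi (Fin.ext h)
    simp [Instr.run, this, hi, hs i]

/-- The program that sets the bound for all numbers, in register `2`. -/
def capProg : Prog :=
  .seq (.instr (.const 2 16)) (.seq (.instr (.const 15 1)) (.loop 9 0
    (.seq (.instr (.add 2 2 2)) (.seq (.instr (.add 2 2 2)) (.seq (.instr (.add 2 2 2))
      (.seq (.instr (.add 2 2 2)) (.instr (.add 9 9 15))))))))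

theorem runs_capProg {n : ℕ} (Q : CIOracle n) {g : Globals} {m : ℕ → ℕ} (h0 : g 0 = n)
    (h9 : g 9 = 0) :
    Runs Q capProg ((16 ^ (n + 1) + 2) ^ 3) g m fun g' m' =>
      g' 0 = n ∧ g' 1 = g 1 ∧ g' 2 = 16 ^ (n + 1) ∧ g' 20 = g 20 ∧ g' 22 = g 22 ∧ m' = m := by
  have hbody : ∀ i < n, ∀ g' m', (g' 0 = n ∧ g' 1 = g 1 ∧ g' 2 = 16 ^ (i + 1) ∧ g' 20 = g 20 ∧
      g' 22 = g 22 ∧ m' = m ∧ g' 9 = i ∧ g' 15 = 1) →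
      Runs Q (.seq (.instr (.add 2 2 2)) (.seq (.instr (.add 2 2 2)) (.seq (.instr (.add 2 2 2))
        (.seq (.instr (.add 2 2 2)) (.instr (.add 9 9 15)))))) (6 + 16 ^ (n + 1)) g' m'
        fun g' m' => g' 0 = n ∧ g' 1 = g 1 ∧ g' 2 = 16 ^ (i + 1 + 1) ∧ g' 20 = g 20 ∧
          g' 22 = g 22 ∧ m' = m ∧ g' 9 = i + 1 ∧ g' 15 = 1 := by
    rintro i hi g' m' ⟨e0, e1, e2, e20, e22, rfl, e9, e15⟩
    have hle : 16 ^ (i + 1) * 16 ≤ 16 ^ (n + 1) := by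
      rw [← pow_succ]
      exact Nat.pow_le_pow_right (by omega) (by omega)
    refine Runs.mono (T := (1 + g' 2) + ((1 + 2 * g' 2) + ((1 + 4 * g' 2) + ((1 + 8 * g' 2) + 2))))
      (.seq (runs_add 2 2 2) ?_) (by omega) fun _ _ h => h
    rintro g₁ m₁ ⟨rfl, rfl⟩
    refine .seq ((runs_add 2 2 2).mono (by simp; omega) fun _ _ h => h) ?_
    rintro g₁ m₁ ⟨rfl, rfl⟩
    refine .seq ((runs_add 2 2 2).mono (by simp; omega) fun _ _ h => h) ?_
    rintro g₁ m₁ ⟨rfl, rfl⟩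
    refine .seq ((runs_add 2 2 2).mono (by simp; omega) fun _ _ h => h) ?_
    rintro g₁ m₁ ⟨rfl, rfl⟩
    refine (runs_add 9 9 15).mono (by simp [e15]) ?_
    rintro g₁ m₁ ⟨rfl, rfl⟩
    refine ⟨by simpa using e0, by simpa using e1, ?_, by simpa using e20, by simpa using e22, rfl,
      by simp [e9, e15], by simpa using e15⟩
    have := pow_succ 16 (i + 1)
    simp [e2]
    omega
  refine Runs.mono (.seq (runs_const 2 16) (T' := 1 + (n * (6 + 16 ^ (n + 1) + 1) + 1)) ?_) ?_
    fun _ _ h => h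
  · rintro g₁ m₁ ⟨rfl, rfl⟩
    refine .seq (runs_const 15 1) ?_
    rintro g₁ m₁ ⟨rfl, rfl⟩
    refine (Runs.loop (x := 9) (y := 0) (N := n) (fun i g' m' => g' 0 = n ∧ g' 1 = g 1 ∧
      g' 2 = 16 ^ (i + 1) ∧ g' 20 = g 20 ∧ g' 22 = g 22 ∧ m' = m₁ ∧ g' 9 = i ∧ g' 15 = 1)
      ?_ ?_ hbody ?_).mono le_rfl ?_
    · rintro i hi g' m' ⟨e0, -, -, -, -, -, e9, -⟩
      omega
    · rintro g' m' ⟨e0, -, -, -, -, -, e9, -⟩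
      omega
    · simp [h0, h9]
    · rintro g' m' ⟨e0, e1, e2, e20, e22, em, -, -⟩
      exact ⟨e0, e1, e2, e20, e22, em⟩
  · have hn' : n + 1 < 16 ^ (n + 1) := Nat.lt_pow_self (by omega)
    set B := 16 ^ (n + 1) with hB
    have h16 : 16 ≤ B := by
      rw [hB, pow_succ]
      exact Nat.le_mul_of_pos_left _ (by positivity)
    calc 1 + (1 + (n * (6 + B + 1) + 1)) ≤ B * (B + 7) + 3 := by
          have : n * (6 + B + 1) ≤ B * (6 + B + 1) := Nat.mul_le_mul_right _ (by omega)
          have : B * (B + 7) = B * (6 + B + 1) := by ring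
          omega
      _ ≤ (B + 2) ^ 3 := by
          have : (B + 2) ^ 3 = B * (B + 7) + 3 + (B ^ 3 + 5 * B ^ 2 + 5 * B + 5) := by ring
          omega

/-- The program that computes the parameters. -/
def layoutProg : Prog := assigns
  [(3, pow (.glob 0)), (4, mul (mul (.glob 0) (.glob 0)) (.glob 3)),
    (5, .ite (.glob 1) (.glob 4) (.glob 1) (.glob 4)), (6, .add (.glob 4) (.glob 4)),
    (7, .add (.glob 6) (.glob 4)), (8, .add (.glob 7) (.glob 4)), (21, .lit 1)]

theorem poly_layoutProg :
    Poly layoutProg (fun n _ g _ => 1 ≤ n ∧ g 0 = n ∧ g 2 = 16 ^ (n + 1))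
      fun n _ g m g' m' => g' 2 = g 2 ∧ Layout n g' ∧ g' 5 = min (g 1) (g' 4) ∧ g' 21 = 1 ∧
        g' 20 = g 20 ∧ g' 22 = g 22 ∧ m' = m := by
  refine (poly_assigns _ (by decide)).conseq (fun _ _ _ _ _ _ => trivial) ?_
  rintro n Q g m g' m' hg ⟨hn, h0, h2⟩ ⟨rfl, rfl⟩
  have hcap : 6 * (n * n * 2 ^ n) ≤ g 2 := by
    have h1 : n < 2 ^ n := Nat.lt_two_pow_self
    calc 6 * (n * n * 2 ^ n) ≤ 16 * (2 ^ n * 2 ^ n * 2 ^ n) := by gcongr; omega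
      _ = 16 * 8 ^ n := by rw [← mul_pow, ← mul_pow]; norm_num
      _ ≤ 16 * 16 ^ n := by gcongr; omega
      _ = g 2 := by rw [h2, pow_succ, mul_comm]
  have hpos := Nat.two_pow_pos n
  have hle1 : n * n ≤ n * n * 2 ^ n := Nat.le_mul_of_pos_right _ hpos
  have hle2 : n ≤ n * n := Nat.le_mul_of_pos_left _ hn
  have hle3 : 2 ^ n ≤ n * n * 2 ^ n := Nat.le_mul_of_pos_left _ (by positivity)
  have m0 : min n (g 2) = n := min_eq_left (by omega)
  have m1 : min (n * n) (g 2) = n * n := min_eq_left (by omega)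
  have m2 : min (2 ^ n) (g 2) = 2 ^ n := min_eq_left (by omega)
  have m3 : min (n * n * 2 ^ n) (g 2) = n * n * 2 ^ n := min_eq_left (by omega)
  generalize hM : n * n * 2 ^ n = M at *
  have m4 : min (M + M) (g 2) = M + M := min_eq_left (by omega)
  have m5 : min (M + M + M) (g 2) = M + M + M := min_eq_left (by omega)
  have m6 : min (M + M + M + M) (g 2) = M + M + M + M := min_eq_left (by omega)
  have e4 : afterAssigns m' [(3, pow (.glob 0)), (4, mul (mul (.glob 0) (.glob 0)) (.glob 3)),
    (5, .ite (.glob 1) (.glob 4) (.glob 1) (.glob 4)), (6, .add (.glob 4) (.glob 4)),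
    (7, .add (.glob 6) (.glob 4)), (8, .add (.glob 7) (.glob 4)), (21, .lit 1)] g =
    Function.update (Function.update (Function.update (Function.update (Function.update
      (Function.update (Function.update g 3 (2 ^ n)) 4 M) 5 (min (g 1) M)) 6 (M + M))
      7 (M + M + M)) 8 (M + M + M + M)) 21 1 := by
    have m7 : (if g 1 < M ∨ g 2 < M then min (g 1) (g 2) else M) = min (g 1) M := by
      split_ifs <;> omega
    simp [afterAssigns, eval_mul, eval_pow, hg, Expr.eval, h0, m0, m1, m2, hM, m3, m4, m5, m6, m7]
  rw [e4]
  refine ⟨by simp, ⟨hn, by simpa using h0, by simp, by simp [hM], by simp, by simp, by simp, by simp,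
    by simp; omega⟩, by simp, by simp, by simp, by simp, rfl⟩

/-! ### Recording the oracle's answers -/

/-- The oracle declares `u` and `v` to be independent given `S`. -/
def CIOracle.Indep {n : ℕ} (Q : CIOracle n) (u v : Fin n) (S : Finset (Fin n)) : Prop :=
  ∃ q, Q q = true ∧ (u = q.u ∧ v = q.v ∨ u = q.v ∧ v = q.u) ∧ q.S = S

theorem CIOracle.answer_ne_zero {n : ℕ} {Q : CIOracle n} {u v : Fin n} {S : Finset (Fin n)}
    {χ : ℕ → ℕ} (hχ : ∀ w : Fin n, χ w ≠ 0 ↔ w ∈ S) :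
    Q.answer u v χ ≠ 0 ↔ Q.Indep u v S := by
  classical
  rw [CIOracle.answer]
  have : (∃ q : CIQuery n, Q q = true ∧
      (((u : ℕ) = (q.u : ℕ) ∧ (v : ℕ) = (q.v : ℕ)) ∨ ((u : ℕ) = (q.v : ℕ) ∧ (v : ℕ) = (q.u : ℕ))) ∧
      (∀ w : Fin n, w ∈ q.S ↔ χ w ≠ 0)) ↔ Q.Indep u v S := by
    simp only [hχ, Fin.val_inj, CIOracle.Indep, Finset.ext_iff]
  rw [← this]
  split_ifs with h <;> simp [h]

theorem exists_code_eq {n a : ℕ} (ha : a < n * n * 2 ^ n) :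
    ∃ (u v : Fin n) (S : Finset (Fin n)), code u v S = a ∧ a % 2 ^ n = setCode S ∧
      a / 2 ^ n / n = u ∧ a / 2 ^ n % n = v := by
  have hp := Nat.two_pow_pos n
  have h1 : a / 2 ^ n < n * n := Nat.div_lt_of_lt_mul (by rwa [mul_comm])
  have h2 : a / 2 ^ n / n < n := Nat.div_lt_of_lt_mul h1
  obtain ⟨S, hS⟩ := exists_setCode_eq (n := n) (Nat.mod_lt a hp)
  refine ⟨⟨_, h2⟩, ⟨_, Nat.mod_lt (a / 2 ^ n) ((Nat.zero_le _).trans_lt h2)⟩, S, ?_, hS.symm, rfl, rfl⟩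
  rw [code, hS]
  simp only
  rw [Nat.div_add_mod', Nat.div_add_mod']

/-- Only the parameters of a layout matter. -/
theorem Layout.congr {n : ℕ} {g g' : Globals} (h : Layout n g)
    (hg : ∀ i : Fin 24, i.val < 9 → g' i = g i) : Layout n g' := by
  have e0 := hg 0 (by simp)
  have e2 := hg 2 (by simp)
  have e3 := hg 3 (by simp)
  have e4 := hg 4 (by simp)
  have e5 := hg 5 (by simp)
  have e6 := hg 6 (by simp)
  have e7 := hg 7 (by simp)
  have e8 := hg 8 (by simp)
  obtain ⟨hp, h0, h3, h4, h5, h6, h7, h8, hc⟩ := h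
  exact ⟨hp, by omega, by omega, by omega, by omega, by omega, by omega, by omega, by omega⟩

/-- The program that asks the query with the code in register `10` and records the answer. -/
def recordProg : Prog :=
  .seq (fill 8 (.glob 0) (bit (mod (.glob 10) (.glob 3)) (.glob 11)))
    (.seq (assigns [(16, div (div (.glob 10) (.glob 3)) (.glob 0)),
        (17, mod (div (.glob 10) (.glob 3)) (.glob 0)), (19, .add (.glob 4) (.glob 10))])
      (.seq (.instr (.query (18 : Fin 24) (16 : Fin 24) (17 : Fin 24) (8 : Fin 24)))
        (.seq (.instr (.store (19 : Fin 24) (18 : Fin 24)))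
          (assign 10 (.add (.glob 10) (.lit 1))))))

theorem poly_recordProg :
    Poly recordProg (fun n _ g _ => Layout n g ∧ g 10 < g 4)
      fun n Q g m g' m' => (∀ i : Fin 24, i.val < 9 ∨ 20 ≤ i.val → g' i = g i) ∧
        g' 10 = g 10 + 1 ∧ (∀ a < g 8, a ≠ g 4 + g 10 → m' a = m a) ∧
        ∀ (u v : Fin n) S, code u v S = g 10 → (m' (g 4 + g 10) ≠ 0 ↔ Q.Indep u v S) := by
  have htail : Poly (.seq (.instr (.query (18 : Fin 24) (16 : Fin 24) (17 : Fin 24) (8 : Fin 24)))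
      (.seq (.instr (.store (19 : Fin 24) (18 : Fin 24))) (assign 10 (.add (.glob 10) (.lit 1)))))
      (fun n _ g _ => n ≤ g 2) fun _ Q g m g' m' =>
        (∀ i : Fin 24, i.val < 9 ∨ 20 ≤ i.val → g' i = g i) ∧
        g' 10 = min (min (g 10) (g 2) + 1) (g 2) ∧
        m' = Function.update m (g 19) (Q.answer (g 16) (g 17) fun w => m (g 8 + w)) := by
    refine (poly_query 18 16 17 8).seq ((poly_store 19 18).seq
      (poly_assign 10 (.add (.glob 10) (.lit 1)))
      (R'' := fun _ _ g m g' m' => g' = Function.update g 10 (min (min (g 10) (g 2) + 1) (g 2)) ∧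
        m' = Function.update m (g 19) (g 18)) ?_ ?_) ?_ ?_
    · rintro n Q g m g' m' - - ⟨rfl, rfl⟩
      exact ⟨rfl, trivial⟩
    · rintro n Q g m g' m' g'' m'' - - ⟨rfl, rfl⟩ ⟨rfl, rfl⟩
      exact ⟨rfl, rfl⟩
    · rintro n Q g m g' m' - - ⟨rfl, rfl⟩
      exact ⟨by simp, trivial⟩
    · rintro n Q g m g' m' g'' m'' - - ⟨rfl, rfl⟩ ⟨rfl, rfl⟩
      refine ⟨fun i hi => ?_, by simp, by simp⟩
      have h1 : i ≠ 10 := by rintro rfl; simp at hi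
      have h2 : i ≠ 18 := by rintro rfl; simp at hi
      simp [h1, h2]
  refine ((poly_fill 8 (by simp) (.glob 0) (bit (mod (.glob 10) (.glob 3)) (.glob 11))).conseq
    (Pre' := fun n _ g _ => Layout n g ∧ g 10 < g 4) ?_ (fun _ _ _ _ _ _ _ _ h => h)).seq
    (((poly_assigns [(16, div (div (.glob 10) (.glob 3)) (.glob 0)),
        (17, mod (div (.glob 10) (.glob 3)) (.glob 0)), (19, .add (.glob 4) (.glob 10))]
        (by decide)).conseq (Pre' := fun n _ g _ => Layout n g ∧ g 10 < g 4)
        (fun _ _ _ _ _ _ => trivial) (fun _ _ _ _ _ _ _ _ h => h)).seq htail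
      (R'' := fun n Q g m g' m' => (∀ i : Fin 24, i.val < 9 ∨ 20 ≤ i.val → g' i = g i) ∧
        g' 10 = g 10 + 1 ∧
        m' = Function.update m (g 4 + g 10) (Q.answer (g 10 / 2 ^ n / n) (g 10 / 2 ^ n % n)
          fun w => m (g 8 + w))) ?_ ?_) ?_ ?_
  · rintro n Q g m - ⟨h, -⟩
    have := h.cap
    have := h.le_g4
    have := h.g0
    rw [h.eval_n]
    omega
  · rintro n Q g m g' m' - ⟨h, h10⟩ ⟨rfl, rfl⟩
    have := h.cap
    have := h.le_g4
    rw [afterAssigns_of_ne (by decide)]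
    exact ⟨rfl, by omega⟩
  · rintro n Q g m g' m' g'' m'' hg ⟨h, h10⟩ ⟨rfl, rfl⟩ ⟨hs, e10, rfl⟩
    have hcap := h.cap
    have hle := h.le_g4
    have hM := h.two_le_g4
    have h10' : ∀ g' : Globals, g' 10 = g 10 → g' 2 = g 2 → ∀ l,
        (Expr.glob 10).eval g' m' l = g 10 := by
      intro g' e e' l
      rw [Expr.eval, e, e', min_eq_left (by omega)]
    have hp := Nat.two_pow_pos n
    have hn := h.pos
    have hdl : g 10 / 2 ^ n ≤ g 10 := Nat.div_le_self _ _
    have hdiv : ∀ g' : Globals, Layout n g' → g' 10 = g 10 → g' 2 = g 2 → ∀ l,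
        (div (.glob 10) (.glob 3)).eval g' m' l = g 10 / 2 ^ n := by
      intro g' h' e e' l
      rw [eval_div (by rw [h'.eval_sets]; exact hp) (by rw [h10' g' e e']; omega), h10' g' e e',
        h'.eval_sets]
    have e16 : (div (div (.glob 10) (.glob 3)) (.glob 0)).eval g m' [] = g 10 / 2 ^ n / n := by
      rw [eval_div (by rw [h.eval_n]; exact hn) (by rw [hdiv g h rfl rfl]; omega),
        hdiv g h rfl rfl, h.eval_n]
    have hup : ∀ (r : Fin 24) (x : ℕ) (g' : Globals), Layout n g' → 15 < r.val →
        Layout n (Function.update g' r x) := by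
      intro r x g' h' hr
      refine h'.congr fun i hi => Function.update_of_ne ?_ _ _
      rintro rfl
      omega
    have h₁ := hup 16 (g 10 / 2 ^ n / n) g h (by simp)
    have h₂ := hup 17 (g 10 / 2 ^ n % n) _ h₁ (by simp)
    have e17 : (mod (div (.glob 10) (.glob 3)) (.glob 0)).eval
        (Function.update g 16 (g 10 / 2 ^ n / n)) m' [] = g 10 / 2 ^ n % n := by
      rw [eval_mod, hdiv _ h₁ (by simp) (by simp), h₁.eval_n]
    have e19 : (Expr.add (.glob 4) (.glob 10)).eval (Function.update
        (Function.update g 16 (g 10 / 2 ^ n / n)) 17 (g 10 / 2 ^ n % n)) m' [] = g 4 + g 10 := by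
      rw [Expr.eval, h₂.eval_glob 4 (by simp), h10' _ (by simp) (by simp)]
      simp
      omega
    simp only [afterAssigns, e16, e17, e19] at hs e10 ⊢
    refine ⟨fun i hi => ?_, ?_, by simp⟩
    · have h1 : i ≠ 16 := by rintro rfl; simp at hi
      have h2 : i ≠ 17 := by rintro rfl; simp at hi
      have h3 : i ≠ 19 := by rintro rfl; simp at hi
      rw [hs i hi]
      simp [h1, h2, h3]
    · rw [e10]
      simp
      omega
  · rintro n Q g m g' m' - ⟨h, h10⟩ ⟨hs, -, -⟩
    exact ⟨hs 2 (by simp), h.congr fun i hi => hs i (by omega),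
      by rw [hs 10 (by simp), hs 4 (by simp)]; exact h10⟩
  · rintro n Q g m g' m' g'' m'' hg ⟨h, h10⟩ ⟨hs, hm, hv⟩ ⟨hs', e10, rfl⟩
    have hcap := h.cap
    have hle := h.le_g4
    have h6 := h.g6
    have h7 := h.g7
    have h8 := h.g8
    have e8 := hs 8 (by simp)
    have e4 := hs 4 (by simp)
    have e10' := hs 10 (by simp)
    rw [e4, e10']
    refine ⟨fun i hi => ?_, by omega, fun a ha hne => ?_, fun u v S hc => ?_⟩
    · rw [hs' i hi, hs i (by omega)]
    · rw [Function.update_of_ne hne]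
      exact hm a (.inl ha)
    · rw [Function.update_self, e8]
      obtain ⟨u', v', S', hc', e1, e2, e3⟩ := exists_code_eq (h.g4 ▸ h10)
      obtain ⟨rfl, rfl, rfl⟩ := code_injective (hc'.trans hc.symm)
      rw [e2, e3]
      refine CIOracle.answer_ne_zero fun w => ?_
      have hw := w.2
      obtain ⟨g₁, hs₁, h₁, e⟩ := hv w (by rw [h.eval_n]; exact hw)
      have hL : Layout n g₁ := h.congr fun i hi => hs₁ i (by omega)
      have e2' := hs₁ 2 (by simp)
      have hmod : ∀ m l, (mod (.glob 10) (.glob 3)).eval g₁ m l = setCode S' := by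
        intro m l
        rw [eval_mod, hL.eval_sets, Expr.eval, hs₁ 10 (by simp), e2', min_eq_left (by omega), e1]
      have h11 : ∀ m l, (Expr.glob 11).eval g₁ m l = w := by
        intro m l
        rw [Expr.eval, h₁, e2', min_eq_left (by omega)]
      rw [e]
      change Holds _ _ _ _ ↔ _
      rw [bit, holds_call, hmod, h11, hL.holds_bitBody]

/-- The program that records all answers. -/
def tableProg : Prog :=
  .seq (assign 10 (.lit 0)) (.loop (10 : Fin 24) (4 : Fin 24) recordProg)

theorem poly_tableProg :
    Poly tableProg (fun n _ g _ => Layout n g)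
      fun n Q g m g' m' => (∀ i : Fin 24, i.val < 9 ∨ 20 ≤ i.val → g' i = g i) ∧
        (∀ a < g 8, a < g 4 ∨ g 6 ≤ a → m' a = m a) ∧
        ∀ (u v : Fin n) S, m' (g 4 + code u v S) ≠ 0 ↔ Q.Indep u v S := by
  refine (poly_assign 10 (.lit 0)).conseq (Pre' := fun n _ g _ => Layout n g)
      (fun _ _ _ _ _ _ => trivial) (fun _ _ _ _ _ _ _ _ h => h) |>.seq
    (poly_recordProg.loop (Pre' := fun n _ g m => Layout n g ∧ g 10 = 0) (fun g _ => g 4)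
      (fun n Q g m i g' m' => (∀ i : Fin 24, i.val < 9 ∨ 20 ≤ i.val → g' i = g i) ∧
        g' 10 = i ∧ (∀ a < g 8, a < g 4 ∨ g 6 ≤ a → m' a = m a) ∧
        ∀ (u v : Fin n) S, code u v S < i → (m' (g 4 + code u v S) ≠ 0 ↔ Q.Indep u v S)) ?_ ?_ ?_)
      ?_ ?_
  · rintro n Q g m - ⟨h, h10⟩
    have := h.cap
    exact ⟨by omega, fun _ _ => rfl, h10, fun _ _ _ => rfl, fun _ _ _ h => (Nat.not_lt_zero _ h).elim⟩
  · rintro n Q g m - ⟨h, h10⟩ i hi g' m' ⟨hs, e10, hm, ht⟩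
    have e4 := hs 4 (by simp)
    have e8 := hs 8 (by simp)
    refine ⟨by omega, hs 2 (by simp), ⟨h.congr fun j hj => hs j (.inl hj), by omega⟩, ?_⟩
    rintro g'' m'' ⟨hs', e10', hm', ht'⟩
    rw [e4, e10] at ht' hm'
    rw [e8] at hm'
    have h6 := h.g6
    have h7 := h.g7
    have h8 := h.g8
    refine ⟨fun j hj => (hs' j hj).trans (hs j hj), by omega, fun a ha ha' => ?_,
      fun u v S hc => ?_⟩
    · rw [hm' a ha (by omega), hm a ha ha']
    · have hcode := h.g4 ▸ code_lt u v S
      rcases Nat.lt_succ_iff_lt_or_eq.1 hc with hc | hc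
      · rw [hm' _ (by omega) (by omega)]
        exact ht u v S hc
      · rw [hc]
        exact ht' u v S hc
  · rintro n Q g m - ⟨h, h10⟩ g' m' ⟨hs, e10, hm, ht⟩
    have e4 := hs 4 (by simp)
    omega
  · rintro n Q g m g' m' - hp ⟨rfl, rfl⟩
    refine ⟨by simp, hp.congr fun j hj => Function.update_of_ne ?_ _ _, by simp [Expr.eval]⟩
    rintro rfl
    simp at hj
  · rintro n Q g m g' m' g'' m'' - hp ⟨rfl, rfl⟩ ⟨hs, -, hm, ht⟩
    refine ⟨fun j hj => (hs j hj).trans (Function.update_of_ne ?_ _ _), by simpa using hm,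
      fun u v S => ?_⟩
    · rintro rfl
      simp at hj
    · have hcode := hp.g4 ▸ code_lt u v S
      simpa using ht u v S (by simpa using hcode)

/-! ### Testing one vector of digits -/

section

variable {n : ℕ} {g g' : Globals} {m m' : ℕ → ℕ}

theorem Layout.memIndep_congr (h : Layout n g) (hg : ∀ i : Fin 24, i.val < 9 → g' i = g i)
    (hm : ∀ a, g 4 ≤ a → a < g 7 → m' a = m a) :
    (MemIndep g' m' : Fin n → Fin n → Finset (Fin n) → Prop) = MemIndep g m := by
  have h5 := h.g5
  have h6 := h.g6
  have h7 := h.g7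
  have key : ∀ a < g 4, EntryHolds g' m' a ↔ EntryHolds g m a := by
    intro a ha
    rw [EntryHolds, EntryHolds, hg 4 (by simp), hg 5 (by simp), hg 6 (by simp),
      hm _ (by omega) (by omega)]
    refine not_congr (iff_congr Iff.rfl (exists_congr fun i => and_congr_right fun hi => ?_))
    rw [hm _ (by omega) (by omega)]
  funext u v S
  rw [MemIndep, MemIndep, key _ (h.g4 ▸ code_lt u v S), key _ (h.g4 ▸ code_lt v u S)]

theorem Layout.two_pow_sub_one_lt (h : Layout n g) : 2 ^ n - 1 < g 4 := by
  have := h.le_g4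
  have := Nat.two_pow_pos n
  omega

theorem index_lt (u v : Fin n) : (u : ℕ) * n + v < n * n := by
  have : (u : ℕ) + 1 ≤ n := u.2
  have : ((u : ℕ) + 1) * n ≤ n * n := Nat.mul_le_mul_right _ this
  rw [Nat.add_mul] at this
  have := v.2
  omega

theorem poly_fill_choice :
    Poly (fill 7 (.glob 3) choice) (fun n _ g _ => Layout n g) fun n _ g m g' m' =>
      SameUpTo g g' ∧ (∀ a < g 7, m' a = m a) ∧
        IsChoice (n := n) (MemIndep g m) (memChoice g m') := by
  refine (poly_fill 7 (by simp) (.glob 3) choice).conseq ?_ ?_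
  · rintro n Q g m - h
    have := h.cap
    have := h.le_g4
    have := h.g8
    rw [h.eval_sets]
    omega
  · rintro n Q g m g' m' - h ⟨hs, hm, hv⟩
    have hn := h.n_add_one_le
    have key : ∀ W : Finset (Fin n), m' (g 7 + setCode W) = if W = ∅ then n + 1 else
        lastSat (Choosable (MemIndep g m) (memChoice g m') W) n := by
      intro W
      obtain ⟨g₁, hs₁, h₁, e⟩ := hv (setCode W) (by rw [h.eval_sets]; exact setCode_lt W)
      have hL : Layout n g₁ := h.congr fun i hi => hs₁ i (by omega)
      rw [e, hL.eval_choice h₁, h.memIndep_congr (fun i hi => hs₁ i (by omega)) (by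
        intro a ha ha'
        split_ifs
        exacts [hm a (.inl ha'), rfl])]
      congr 2
      funext v
      refine propext (exists_congr fun hvn => and_congr_right fun hvW => and_congr_left fun _ => ?_)
      have hlt : setCode (W.erase ⟨v, hvn⟩) < setCode W := by
        have h1 := setCode_insert (Finset.notMem_erase ⟨v, hvn⟩ W)
        rw [Finset.insert_erase hvW] at h1
        have := Nat.two_pow_pos v
        simp only at h1
        omega
      rw [memChoice, memChoice, hs₁ 7 (by simp), hs₁ 2 (by simp), if_pos (by omega)]
    refine ⟨hs, fun a ha => hm a (.inl ha), ⟨?_, fun W hW => ?_⟩⟩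
    · rw [memChoice, ← setCode_empty (n := n), key, if_pos rfl, min_eq_left hn]
    · rw [memChoice, key, if_neg hW, min_eq_left]
      exact (lastSat_le _ _).trans (by omega)

namespace Expr

/-- the entry of the table of possible sinks for the set of all vertices -/
def success : Expr := .load (.add (.glob 7) (.sub (.glob 3) (.lit 1)))

/-- whether the recorded graph differs from the one for the current digits -/
def differs : Expr :=
  ex (.glob 0) (ex (.glob 0) (neg (eq (.load (.add (mul (.var 2) (.glob 0)) (.var 0)))
    (.call arcBody (.var 2) (.var 0) (.lit 0)))))

/-- the new number of graphs found, where `2` stands for at least two -/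
def newCount : Expr :=
  cond success (cond (.glob 22) (cond differs (.lit 2) (.glob 22)) (.lit 1)) (.glob 22)

/-- the new entry of the recorded adjacency matrix at the position in register `11` -/
def newArc : Expr :=
  cond (conj success (neg (.glob 22)))
    (.call arcBody (div (.glob 11) (.glob 0)) (mod (.glob 11) (.glob 0)) (.lit 0))
    (.load (.glob 11))

/-- the digit at the position in register `11` after the vector of digits is incremented: it
changes if all lower digits have become zero -/
def newDigit : Expr :=
  cond (ex (.glob 11) (.load (.add (.glob 6) (.var 0)))) (.load (.add (.glob 6) (.glob 11)))
    (.ite (.add (.load (.add (.glob 6) (.glob 11))) (.lit 1)) (.glob 4)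
      (.add (.load (.add (.glob 6) (.glob 11))) (.lit 1)) (.lit 0))

/-- whether all digits are zero -/
def allZero : Expr := neg (ex (.glob 5) (.load (.add (.glob 6) (.var 0))))

end Expr

theorem Layout.eval_success (h : Layout n g) (l : List ℕ) :
    success.eval g m l = memChoice g m (2 ^ n - 1) := by
  have e : (Expr.sub (.glob 3) (.lit 1)).eval g m l = 2 ^ n - 1 := by
    rw [Expr.eval, h.eval_sets]
    rfl
  rw [success, h.eval_load (by simp) (by rw [e]; exact h.two_pow_sub_one_lt), e, memChoice]

open Classical in
/-- An entry of the adjacency matrix read off from the table in the memory. -/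
noncomputable def memArc {n : ℕ} (g : Globals) (m : ℕ → ℕ) (u v : Fin n) : ℕ :=
  if ChosenAdj (MemIndep g m) (memChoice g m) u v then 1 else 0

theorem Layout.holds_differs (h : Layout n g) :
    differs.Holds g m [] ↔ ∃ u v : Fin n, min (m (u * n + v)) (g 2) ≠ memArc g m u v := by
  have hcap := h.cap
  have hle := h.le_g4
  rw [differs, h.holds_ex_vertices]
  simp only [h.holds_ex_vertices, holds_neg, holds_eq]
  refine exists_congr fun u => exists_congr fun v => not_congr ?_
  have hi := index_lt u v
  have e1 : (Expr.add (mul (.var 2) (.glob 0)) (.var 0)).eval g m [(v : ℕ), 0, u, 0] =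
      u * n + v := by
    rw [Expr.eval, eval_mul, h.eval_n]
    simp only [Expr.eval, List.getD_cons_zero, List.getD_cons_succ]
    omega
  rw [Expr.eval, e1]
  exact iff_of_eq (congrArg _ (h.eval_arcBody u v 0))

theorem Layout.eval_newCount [Decidable (∃ u v : Fin n, min (m (u * n + v)) (g 2) ≠ memArc g m u v)]
    (h : Layout n g) (h22 : g 22 ≤ 2) : newCount.eval g m [] =
      if memChoice g m (2 ^ n - 1) = 0 then g 22 else if g 22 = 0 then 1 else
        if ∃ u v : Fin n, min (m (u * n + v)) (g 2) ≠ memArc g m u v then 2 else g 22 := by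
  classical
  have e22 : (Expr.glob 22).eval g m [] = g 22 := min_eq_left (h22.trans h.two_le)
  rw [newCount, eval_cond, eval_cond, eval_cond, e22]
  simp only [h.holds_differs]
  simp only [Holds, h.eval_success, e22, ite_not]
  rfl

theorem poly_fill_arcs :
    Poly (fill 10 (mul (.glob 0) (.glob 0)) newArc)
      (fun n _ g _ => Layout n g ∧ g 10 = 0 ∧ g 22 ≤ 2) fun n _ g m g' m' =>
      SameUpTo g g' ∧ (∀ a, n * n ≤ a → m' a = m a) ∧ ∀ u v : Fin n, m' (u * n + v) =
        if memChoice g m (2 ^ n - 1) ≠ 0 ∧ g 22 = 0 then memArc g m u v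
        else min (m (u * n + v)) (g 2) := by
  classical
  have hlen : ∀ {n : ℕ} {g : Globals} {m}, Layout n g →
      (mul (.glob 0) (.glob 0)).eval g m [] = n * n := by
    intro n g m h
    have := h.cap
    have := h.le_g4
    rw [eval_mul, h.eval_n]
    omega
  refine (poly_fill 10 (by simp) (mul (.glob 0) (.glob 0)) newArc).conseq ?_ ?_
  · rintro n Q g m - ⟨h, h10, h22⟩
    have := h.cap
    have := h.le_g4
    rw [hlen h]
    omega
  · rintro n Q g m g' m' - ⟨h, h10, h22⟩ ⟨hs, hm, hv⟩
    have hcap := h.cap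
    have hle := h.le_g4
    rw [hlen h] at hm hv
    rw [h10] at hm
    simp only [h10, zero_add] at hv hm
    refine ⟨hs, fun a ha => hm a (.inr ha), fun u v => ?_⟩
    have hi := index_lt u v
    obtain ⟨g₁, hs₁, h₁, e⟩ := hv _ hi
    have hL : Layout n g₁ := h.congr fun i hi => hs₁ i (by omega)
    rw [e]
    set m₁ : ℕ → ℕ := fun a => if a < (u : ℕ) * n + v then m' a else m a with hm₁
    have hm₁' : ∀ a, g 4 ≤ a → m₁ a = m a := fun a ha => if_neg (by omega)
    have e22 : ∀ l, (Expr.glob 22).eval g₁ m₁ l = g 22 := fun l => by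
      rw [Expr.eval, hs₁ 22 (by simp), hs₁ 2 (by simp), min_eq_left (h22.trans h.two_le)]
    have e11 : ∀ l, (Expr.glob 11).eval g₁ m₁ l = u * n + v := fun l => by
      rw [Expr.eval, h₁, hs₁ 2 (by simp), min_eq_left (by omega)]
    have hc : memChoice g₁ m₁ = memChoice g m := by
      funext X
      rw [memChoice, memChoice, hs₁ 7 (by simp), hs₁ 2 (by simp), hm₁' _ (by
        have := h.g7; have := h.g6; omega)]
    have hI : (MemIndep g₁ m₁ : Fin n → Fin n → Finset (Fin n) → Prop) = MemIndep g m :=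
      h.memIndep_congr (fun i hi => hs₁ i (by omega)) fun a ha _ => hm₁' a ha
    have hn := h.pos
    have ediv : (div (.glob 11) (.glob 0)).eval g₁ m₁ [] = u := by
      rw [eval_div (by rw [hL.eval_n]; exact hn) (by rw [e11, hs₁ 2 (by simp)]; omega), e11,
        hL.eval_n, mul_comm, Nat.mul_add_div hn, Nat.div_eq_of_lt v.2, add_zero]
    have emod : (mod (.glob 11) (.glob 0)).eval g₁ m₁ [] = v := by
      rw [eval_mod, e11, hL.eval_n, Nat.mul_add_mod', Nat.mod_eq_of_lt v.2]
    rw [newArc, eval_cond, holds_conj, holds_neg]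
    simp only [Holds, hL.eval_success, e22, hc, not_not]
    have e1 : (Expr.call arcBody (div (.glob 11) (.glob 0)) (mod (.glob 11) (.glob 0))
        (.lit 0)).eval g₁ m₁ [] = memArc g m u v := by
      rw [Expr.eval, ediv, emod]
      refine (hL.eval_arcBody u v _).trans ?_
      rw [hc, hI, memArc]
    have e2 : (Expr.load (.glob 11)).eval g₁ m₁ [] = min (m (u * n + v)) (g 2) := by
      rw [Expr.eval, e11, hs₁ 2 (by simp), hm₁]
      simp
    rw [e1, e2]

theorem poly_fill_digits :
    Poly (fill 6 (.glob 5) newDigit)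
      (fun n _ g m => Layout n g ∧ ∀ i < g 5, m (g 6 + i) < g 4) fun _ _ g m g' m' =>
      SameUpTo g g' ∧ (∀ a < g 6, m' a = m a) ∧ ∀ i < g 5, m' (g 6 + i) =
        if ∀ j < i, m' (g 6 + j) = 0 then
          if m (g 6 + i) + 1 < g 4 then m (g 6 + i) + 1 else 0
        else m (g 6 + i) := by
  classical
  refine (poly_fill 6 (by simp) (.glob 5) newDigit).conseq ?_ ?_
  · rintro n Q g m - ⟨h, hd⟩
    have := h.cap
    have := h.g5
    have := h.g7
    have := h.g8
    rw [h.eval_glob 5 (by simp)]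
    omega
  · rintro n Q g m g' m' - ⟨h, hd⟩ ⟨hs, hm, hv⟩
    have hcap := h.cap
    have h5 := h.g5
    have h2 := h.two_le
    rw [h.eval_glob 5 (by simp)] at hv hm
    refine ⟨hs, fun a ha => hm a (.inl ha), fun i hi => ?_⟩
    obtain ⟨g₁, hs₁, h₁, e⟩ := hv i hi
    have hL : Layout n g₁ := h.congr fun i hi => hs₁ i (by omega)
    have e2 := hs₁ 2 (by simp)
    have e4 := hs₁ 4 (by simp)
    have e6 := hs₁ 6 (by simp)
    rw [e]
    set m₁ : ℕ → ℕ := fun a => if a < g 6 + i then m' a else m a with hm₁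
    have e11 : ∀ l, (Expr.glob 11).eval g₁ m₁ l = i := fun l => by
      rw [Expr.eval, h₁, e2, min_eq_left (by omega)]
    have hdi := hd i hi
    have eload : ∀ l, (Expr.load (.add (.glob 6) (.glob 11))).eval g₁ m₁ l = m (g 6 + i) := by
      intro l
      rw [hL.eval_load (by simp) (by rw [e11]; omega), e11, e6, e2, hm₁]
      simp
      omega
    have eadd : ∀ l, (Expr.add (.load (.add (.glob 6) (.glob 11))) (.lit 1)).eval g₁ m₁ l =
        m (g 6 + i) + 1 := by
      intro l
      rw [Expr.eval, eload, e2]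
      exact min_eq_left (show m (g 6 + i) + 1 ≤ g 2 by omega)
    have hex : (ex (.glob 11) (.load (.add (.glob 6) (.var 0)))).Holds g₁ m₁ [] ↔
        ¬ ∀ j < i, m' (g 6 + j) = 0 := by
      rw [holds_ex, e11]
      push Not
      refine exists_congr fun j => and_congr_right fun hj => ?_
      rw [hL.holds_load (by simp) (by simp [Expr.eval]; omega), e6, e2]
      simp only [Expr.eval, List.getD_cons_zero, hm₁]
      rw [if_pos (by omega)]
      omega
    rw [newDigit, eval_cond]
    simp only [hex]
    have eite : (Expr.ite (.add (.load (.add (.glob 6) (.glob 11))) (.lit 1)) (.glob 4)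
        (.add (.load (.add (.glob 6) (.glob 11))) (.lit 1)) (.lit 0)).eval g₁ m₁ [] =
          if m (g 6 + i) + 1 < g 4 then m (g 6 + i) + 1 else 0 := by
      rw [Expr.eval, eadd, hL.eval_glob 4 (by simp), e4]
      rfl
    rw [eload, eite, ite_not]

theorem Layout.holds_allZero (h : Layout n g) :
    allZero.Holds g m [] ↔ ∀ i < g 5, m (g 6 + i) = 0 := by
  have h5 := h.g5
  have h2 := h.two_le
  rw [allZero, holds_neg, holds_ex, h.eval_glob 5 (by simp)]
  push Not
  refine forall_congr' fun i => imp_congr_right fun hi => ?_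
  rw [h.holds_load (by simp) (by simp [Expr.eval]; omega)]
  simp only [Expr.eval, List.getD_cons_zero]
  omega

/-- The program that tests the current vector of digits and passes to the next one. The number of
graphs found so far is in register `22`. Its new value waits in register `23` while the old one
decides whether the adjacency matrix is recorded. Register `20` becomes nonzero when the last vector
has been tested. -/
def testProg : Prog :=
  .seq (fill 7 (.glob 3) choice) (.seq (assigns [(23, newCount), (10, .lit 0)])
    (.seq (fill 10 (mul (.glob 0) (.glob 0)) newArc) (.seq (assign 22 (.glob 23))
      (.seq (fill 6 (.glob 5) newDigit) (assign 20 allZero)))))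

open Classical in
/-- The effect of `testProg`, `c` being the table of possible sinks. -/
structure TestRel (n : ℕ) (g : Globals) (m : ℕ → ℕ) (g' : Globals) (m' : ℕ → ℕ) (c : ℕ → ℕ) :
    Prop where
  isChoice : IsChoice (n := n) (MemIndep g m) c
  globals : ∀ i : Fin 24, i.val < 9 ∨ i = 21 → g' i = g i
  table : ∀ a, g 4 ≤ a → a < g 6 → m' a = m a
  count : g' 22 = if c (2 ^ n - 1) = 0 then g 22 else if g 22 = 0 then 1 else
    if ∃ u v : Fin n, m (u * n + v) ≠ if ChosenAdj (MemIndep g m) c u v then 1 else 0 then 2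
    else g 22
  arcs : ∀ u v : Fin n, m' (u * n + v) = if c (2 ^ n - 1) ≠ 0 ∧ g 22 = 0 then
    if ChosenAdj (MemIndep g m) c u v then 1 else 0 else m (u * n + v)
  digits : ∀ i < g 5, m' (g 6 + i) = if ∀ j < i, m' (g 6 + j) = 0 then
    if m (g 6 + i) + 1 < g 4 then m (g 6 + i) + 1 else 0 else m (g 6 + i)
  flag : g' 20 ≠ 0 ↔ ∀ i < g 5, m' (g 6 + i) = 0

/-- What `testProg` needs. -/
structure TestPre (n : ℕ) (g : Globals) (m : ℕ → ℕ) : Prop where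
  layout : Layout n g
  count : g 22 ≤ 2
  arcs : ∀ u v : Fin n, m (u * n + v) ≤ 1
  digits : ∀ i < g 5, m (g 6 + i) < g 4

theorem poly_testProg :
    Poly testProg (fun n _ g m => TestPre n g m)
      fun n _ g m g' m' => ∃ c, TestRel n g m g' m' c := by
  classical
  -- what follows the recording of the adjacency matrix
  have h1 : Poly (.seq (assign 22 (.glob 23)) (.seq (fill 6 (.glob 5) newDigit) (assign 20 allZero)))
      (fun n _ g m => Layout n g ∧ g 23 ≤ 2 ∧ ∀ i < g 5, m (g 6 + i) < g 4)
      (fun n Q g m g' m' => (∀ i : Fin 24, i.val < 9 ∨ i = 21 → g' i = g i) ∧ g' 22 = g 23 ∧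
        (∀ a < g 6, m' a = m a) ∧ (∀ i < g 5, m' (g 6 + i) = if ∀ j < i, m' (g 6 + j) = 0 then
          if m (g 6 + i) + 1 < g 4 then m (g 6 + i) + 1 else 0 else m (g 6 + i)) ∧
        (g' 20 ≠ 0 ↔ ∀ i < g 5, m' (g 6 + i) = 0)) := by
    refine ((poly_assign 22 (.glob 23)).conseq (fun _ _ _ _ _ _ => trivial)
      (fun _ _ _ _ _ _ _ _ h => h)).seq (poly_fill_digits.seq (poly_assign 20 allZero)
        (R'' := fun n Q g m g' m' => (∀ i : Fin 24, i.val < 9 ∨ i = 21 ∨ i = 22 → g' i = g i) ∧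
        (∀ a < g 6, m' a = m a) ∧ (∀ i < g 5, m' (g 6 + i) = if ∀ j < i, m' (g 6 + j) = 0 then
          if m (g 6 + i) + 1 < g 4 then m (g 6 + i) + 1 else 0 else m (g 6 + i)) ∧
        (g' 20 ≠ 0 ↔ ∀ i < g 5, m' (g 6 + i) = 0)) ?_ ?_) ?_ ?_
    · rintro n Q g m g' m' - - ⟨hs, -, -⟩
      exact ⟨hs 2 (by simp), trivial⟩
    · rintro n Q g m g' m' g'' m'' - ⟨h, hd⟩ ⟨hs, hm, hv⟩ ⟨rfl, rfl⟩
      refine ⟨fun i hi => ?_, hm, hv, ?_⟩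
      · have hi20 : i ≠ 20 := by rintro rfl; simp at hi
        rw [Function.update_of_ne hi20, hs]
        rcases hi with hi | rfl | rfl
        exacts [.inl (by omega), .inr (by simp), .inr (by simp)]
      · have hL : Layout n g' := h.congr fun i hi => hs i (by omega)
        have := hL.holds_allZero (m := m'')
        rw [hs 5 (by simp), hs 6 (by simp)] at this
        simpa [Holds] using this
    · rintro n Q g m g' m' - ⟨h, -, hd⟩ ⟨rfl, rfl⟩
      refine ⟨by simp, h.congr fun i hi => Function.update_of_ne ?_ _ _, by simpa using hd⟩
      rintro rfl
      simp at hi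
    · rintro n Q g m g' m' g'' m'' - ⟨h, h23, hd⟩ ⟨rfl, rfl⟩ ⟨hs, hm, hv, hf⟩
      have hup : ∀ i : Fin 24, i ≠ 22 →
          Function.update g 22 ((Expr.glob 23).eval g m' []) i = g i :=
        fun i hi => Function.update_of_ne hi _ _
      rw [hup 6 (by decide)] at hm hv hf
      rw [hup 5 (by decide)] at hv hf
      rw [hup 4 (by decide)] at hv
      refine ⟨fun i hi => ?_, ?_, hm, hv, hf⟩
      · rw [hs i (by tauto), hup]
        rintro rfl
        simp at hi
      · rw [hs 22 (by simp), Function.update_self, Expr.eval, min_eq_left (h23.trans h.two_le)]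
  -- what follows the filling of the table of possible sinks and the count of the graphs
  have h2 : Poly (.seq (fill 10 (mul (.glob 0) (.glob 0)) newArc)
      (.seq (assign 22 (.glob 23)) (.seq (fill 6 (.glob 5) newDigit) (assign 20 allZero))))
      (fun n _ g m => (Layout n g ∧ g 10 = 0 ∧ g 22 ≤ 2) ∧ g 23 ≤ 2 ∧
        ∀ i < g 5, m (g 6 + i) < g 4)
      (fun n Q g m g' m' => (∀ i : Fin 24, i.val < 9 ∨ i = 21 → g' i = g i) ∧ g' 22 = g 23 ∧
        (∀ a, g 4 ≤ a → a < g 6 → m' a = m a) ∧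
        (∀ u v : Fin n, m' (u * n + v) =
          if memChoice g m (2 ^ n - 1) ≠ 0 ∧ g 22 = 0 then memArc g m u v
          else min (m (u * n + v)) (g 2)) ∧
        (∀ i < g 5, m' (g 6 + i) = if ∀ j < i, m' (g 6 + j) = 0 then
          if m (g 6 + i) + 1 < g 4 then m (g 6 + i) + 1 else 0 else m (g 6 + i)) ∧
        (g' 20 ≠ 0 ↔ ∀ i < g 5, m' (g 6 + i) = 0)) := by
    refine (poly_fill_arcs.conseq (fun _ _ _ _ _ h => h.1) (fun _ _ _ _ _ _ _ _ h => h)).seq h1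
      ?_ ?_
    · rintro n Q g m g' m' - ⟨⟨h, h10, h22⟩, h23, hd⟩ ⟨hs, hm, ha⟩
      have hle := h.le_g4
      have h6 := h.g6
      refine ⟨hs 2 (by simp), h.congr fun i hi => hs i (by omega), ?_, ?_⟩
      · rw [hs 23 (by simp)]
        exact h23
      · rw [hs 5 (by simp), hs 4 (by simp), hs 6 (by simp)]
        intro i hi
        rw [hm _ (by omega)]
        exact hd i hi
    · rintro n Q g m g' m' g'' m'' - ⟨⟨h, h10, h22⟩, h23, hd⟩ ⟨hs, hm, ha⟩ ⟨hs', h22', hm', hv, hf⟩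
      have hle := h.le_g4
      have h6 := h.g6
      have h5 := h.g5
      rw [hs 6 (by simp)] at hm' hv hf
      rw [hs 5 (by simp)] at hv hf
      rw [hs 4 (by simp)] at hv
      refine ⟨fun i hi => ?_, ?_, fun a h1 h2 => ?_, fun u v => ?_, fun i hi => ?_, hf⟩
      · rw [hs' i hi, hs]
        rcases hi with hi | rfl
        exacts [.inl (by omega), .inr (by simp)]
      · rw [h22', hs 23 (by simp)]
      · rw [hm' a h2, hm a (by omega)]
      · have := index_lt u v
        rw [hm' _ (by omega), ha]
      · rw [hv i hi, hm _ (by omega)]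
  refine (poly_fill_choice.conseq (fun _ _ _ _ _ h => h.layout) (fun _ _ _ _ _ _ _ _ h => h)).seq
    (((poly_assigns [(23, newCount), (10, .lit 0)] (by decide)).conseq
      (Pre' := fun n _ g m => Layout n g ∧ g 22 ≤ 2 ∧ ∀ i < g 5, m (g 6 + i) < g 4)
      (fun _ _ _ _ _ _ => trivial) (R' := fun n _ g m g' m' =>
        (∀ i : Fin 24, i ≠ 23 → i ≠ 10 → g' i = g i) ∧ g' 10 = 0 ∧ g' 23 = newCount.eval g m [] ∧
          m' = m) ?_).seq h2
      (R'' := fun n Q g m g' m' => (∀ i : Fin 24, i.val < 9 ∨ i = 21 → g' i = g i) ∧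
        g' 22 = newCount.eval g m [] ∧
        (∀ a, g 4 ≤ a → a < g 6 → m' a = m a) ∧
        (∀ u v : Fin n, m' (u * n + v) =
          if memChoice g m (2 ^ n - 1) ≠ 0 ∧ g 22 = 0 then memArc g m u v
          else min (m (u * n + v)) (g 2)) ∧
        (∀ i < g 5, m' (g 6 + i) = if ∀ j < i, m' (g 6 + j) = 0 then
          if m (g 6 + i) + 1 < g 4 then m (g 6 + i) + 1 else 0 else m (g 6 + i)) ∧
        (g' 20 ≠ 0 ↔ ∀ i < g 5, m' (g 6 + i) = 0)) ?_ ?_) ?_ ?_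
  · rintro n Q g m g' m' - - ⟨rfl, rfl⟩
    refine ⟨fun i h1 h2 => ?_, ?_, ?_, rfl⟩
    · simp [afterAssigns, h1, h2]
    · simp [afterAssigns, Expr.eval]
    · simp [afterAssigns]
  · rintro n Q g m g' m' - ⟨h, h22, hd⟩ ⟨hs, h10, h23, rfl⟩
    refine ⟨hs 2 (by decide) (by decide), ⟨h.congr fun i hi => hs i ?_ ?_, h10, ?_⟩, ?_, ?_⟩
    · rintro rfl; simp at hi
    · rintro rfl; simp at hi
    · rw [hs 22 (by decide) (by decide)]
      exact h22
    · rw [h23, h.eval_newCount h22]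
      split_ifs <;> omega
    · rw [hs 5 (by decide) (by decide), hs 6 (by decide) (by decide), hs 4 (by decide) (by decide)]
      exact hd
  · rintro n Q g m g' m' g'' m'' - ⟨h, h22, hd⟩ ⟨hs, h10, h23, rfl⟩ ⟨hs', h22', hm, ha, hv, hf⟩
    have hs9 : ∀ i : Fin 24, i.val < 9 → g' i = g i := fun i hi => hs i
      (by rintro rfl; simp at hi) (by rintro rfl; simp at hi)
    have e1 : memChoice g' m' = memChoice g m' := by
      funext X
      rw [memChoice, memChoice, hs9 7 (by simp), hs9 2 (by simp)]
    have e2 : ∀ u v : Fin n, memArc g' m' u v = memArc g m' u v := by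
      intro u v
      rw [memArc, memArc, e1, h.memIndep_congr hs9 fun _ _ _ => rfl]
    simp only [e1, e2, hs9 4 (by simp), hs9 5 (by simp), hs9 6 (by simp), hs9 2 (by simp),
      hs 22 (by decide) (by decide)] at hm ha hv hf
    refine ⟨fun i hi => ?_, h22'.trans h23, hm, ha, hv, hf⟩
    rw [hs' i hi]
    rcases hi with hi | rfl
    exacts [hs9 i hi, hs 21 (by decide) (by decide)]
  · rintro n Q g m g' m' - hp ⟨hs, hm, -⟩
    have h := hp.layout
    have h5 := h.g5
    have h7 := h.g7
    refine ⟨hs 2 (by simp), h.congr fun i hi => hs i (by omega), ?_, ?_⟩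
    · rw [hs 22 (by simp)]
      exact hp.count
    · rw [hs 5 (by simp), hs 6 (by simp), hs 4 (by simp)]
      intro i hi
      rw [hm _ (by omega)]
      exact hp.digits i hi
  · rintro n Q g m g' m' g'' m'' hg hp ⟨hs, hm, hc⟩ ⟨hs', h22, hm', ha, hv, hf⟩
    have h := hp.layout
    have h5 := h.g5
    have h6 := h.g6
    have h7 := h.g7
    have hle := h.le_g4
    have hs9 : ∀ i : Fin 24, i.val < 9 → g' i = g i := fun i hi => hs i (by omega)
    have hL : Layout n g' := h.congr hs9
    have e1 : memChoice g' m' = memChoice g m' := by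
      funext X
      rw [memChoice, memChoice, hs9 7 (by simp), hs9 2 (by simp)]
    have eI : (MemIndep g' m' : Fin n → Fin n → Finset (Fin n) → Prop) = MemIndep g m :=
      h.memIndep_congr hs9 fun a _ ha => hm a ha
    have e22 := hs 22 (by simp)
    have hmin : ∀ u v : Fin n, min (m' (u * n + v)) (g 2) = m (u * n + v) := by
      intro u v
      have h1 := index_lt u v
      have h2 := hp.arcs u v
      rw [hm _ (by omega)]
      omega
    rw [hL.eval_newCount (by rw [e22]; exact hp.count), e1, e22, hs9 2 (by simp)] at h22
    simp only [memArc, hmin, e1, eI, hs9 4 (by simp), hs9 5 (by simp), hs9 6 (by simp),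
      hs9 2 (by simp), e22] at h22 hm' ha hv hf
    refine ⟨memChoice g m', hc, fun i hi => ?_, fun a h1 h2 => ?_, ?_, ?_, fun i hi => ?_, hf⟩
    · rw [hs' i hi, hs]
      rcases hi with hi | rfl
      exacts [.inl (by omega), .inr (by simp)]
    · rw [hm' a h1 h2, hm a (by omega)]
    · exact h22
    · exact ha
    · rw [hv i hi, hm _ (by omega)]

end

/-! ### Reversing the answers to a set of queries -/

section

variable {n : ℕ} {Q : CIOracle n} {D D' : DAG (Fin n)} {A : Set ℕ}

/-- The code of a query. -/
def CIQuery.code (q : CIQuery n) : ℕ := BNSL.code q.u q.v q.S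

theorem CIQuery.code_injective : Function.Injective (CIQuery.code (n := n)) := by
  rintro ⟨u, v, S, _, _, _⟩ ⟨u', v', S', _, _, _⟩ h
  obtain ⟨rfl, rfl, rfl⟩ := BNSL.code_injective h
  rfl

theorem CIQuery.code_lt (q : CIQuery n) : q.code < n * n * 2 ^ n := BNSL.code_lt _ _ _

/-- The number `0` is not the code of a query, so that it can be used for padding. -/
theorem CIQuery.code_ne_zero (q : CIQuery n) : q.code ≠ 0 := by
  have h : 0 < (q.v : ℕ) := (Nat.zero_le _).trans_lt q.lt
  have := Nat.two_pow_pos n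
  rw [CIQuery.code, BNSL.code]
  positivity

theorem CIOracle.indep_comm {u v : Fin n} {S : Finset (Fin n)} :
    Q.Indep u v S ↔ Q.Indep v u S := by
  refine exists_congr fun q => and_congr_right fun _ => and_congr_left fun _ => ?_
  rw [or_comm, and_comm, and_comm (a := u = _)]

theorem CIOracle.indep_iff (q : CIQuery n) : Q.Indep q.u q.v q.S ↔ Q q = true := by
  constructor
  · rintro ⟨⟨u, v, S, lt, hu, hv⟩, hq, ⟨h1, h2⟩ | ⟨h1, h2⟩, h3⟩
    · obtain ⟨u', v', S', lt', hu', hv'⟩ := q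
      obtain rfl : u' = u := h1
      obtain rfl : v' = v := h2
      obtain rfl : S = S' := h3
      exact hq
    · have := q.lt
      rw [h1, h2] at this
      exact (lt_asymm lt this).elim
  · exact fun h => ⟨q, h, .inl ⟨rfl, rfl⟩, rfl⟩

/-- The independencies according to `Q` after the answers to the queries with a code in `A` are
reversed. -/
def Reversed (Q : CIOracle n) (A : Set ℕ) (u v : Fin n) (S : Finset (Fin n)) : Prop :=
  u ≠ v ∧ u ∉ S ∧ v ∉ S ∧ ¬ (Q.Indep u v S ↔ (if u < v then code u v S else code v u S) ∈ A)

theorem Reversed.symm {u v : Fin n} {S : Finset (Fin n)} (h : Reversed Q A u v S) :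
    Reversed Q A v u S := by
  obtain ⟨h1, h2, h3, h4⟩ := h
  refine ⟨h1.symm, h3, h2, ?_⟩
  rw [CIOracle.indep_comm]
  rcases lt_or_gt_of_ne h1 with h | h
  · rwa [if_neg (lt_asymm h), ← if_pos (c := u < v) h (t := code u v S) (e := code v u S)]
  · rwa [if_pos h, ← if_neg (c := u < v) (lt_asymm h) (t := code u v S) (e := code v u S)]

theorem reversed_comm (u v : Fin n) (S : Finset (Fin n)) :
    Reversed Q A u v S ↔ Reversed Q A v u S := ⟨.symm, .symm⟩

theorem reversed_query (q : CIQuery n) :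
    Reversed Q A q.u q.v q.S ↔ ¬ (Q q = true ↔ q.code ∈ A) := by
  rw [Reversed, if_pos q.lt, CIOracle.indep_iff]
  exact ⟨fun h => h.2.2.2, fun h => ⟨q.lt.ne, q.u_notMem, q.v_notMem, h⟩⟩

/-- The perfect maps are the graphs whose errors are exactly the queries in `A`. -/
theorem isPerfect_reversed_iff : D.IsPerfect (Reversed Q A) Finset.univ ↔
    ∀ q : CIQuery n, ¬ (Q q = true ↔ D.Indep q) ↔ q.code ∈ A := by
  have key : ∀ q : CIQuery n, (D.DSep q.u q.v q.S ↔ Reversed Q A q.u q.v q.S) ↔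
      (¬ (Q q = true ↔ D.Indep q) ↔ q.code ∈ A) := by
    intro q
    rw [reversed_query, DAG.Indep]
    tauto
  constructor
  · exact fun h q => (key q).1 (h.2 _ (Finset.mem_univ _) _ (Finset.mem_univ _) q.lt.ne _
      (Finset.subset_univ _) q.u_notMem q.v_notMem)
  · refine fun h => ⟨fun _ _ _ => ⟨Finset.mem_univ _, Finset.mem_univ _⟩, fun u _ v _ huv S _ hu hv => ?_⟩
    rcases lt_or_gt_of_ne huv with hlt | hlt
    · exact (key ⟨u, v, S, hlt, hu, hv⟩).2 (h _)
    · rw [DAG.dSep_comm, reversed_comm]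
      exact (key ⟨v, u, S, hlt, hv, hu⟩).2 (h _)

theorem markovEquiv_of_isPerfect (h : D.IsPerfect (Reversed Q A) Finset.univ)
    (h' : D'.IsPerfect (Reversed Q A) Finset.univ) : MarkovEquiv D D' := by
  intro q
  have h1 := isPerfect_reversed_iff.1 h q
  have h2 := isPerfect_reversed_iff.1 h' q
  tauto

theorem reversed_eq_of_markovEquiv {A' : Set ℕ} (h : D.IsPerfect (Reversed Q A) Finset.univ)
    (h' : D'.IsPerfect (Reversed Q A') Finset.univ) (hD : MarkovEquiv D D') :
    Reversed Q A = Reversed Q A' := by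
  have key : ∀ q : CIQuery n, q.code ∈ A ↔ q.code ∈ A' := by
    intro q
    have h1 := isPerfect_reversed_iff.1 h q
    have h2 := isPerfect_reversed_iff.1 h' q
    have h3 := hD q
    tauto
  funext u v S
  refine propext (and_congr_right fun huv => and_congr_right fun hu => and_congr_right fun hv =>
    not_congr (iff_congr Iff.rfl ?_))
  split_ifs with hlt
  · exact key ⟨u, v, S, hlt, hu, hv⟩
  · exact key ⟨v, u, S, lt_of_le_of_ne (not_lt.1 hlt) huv.symm, hv, hu⟩

/-! ### Vectors of digits -/

/-- The lowest `K` digits of `x` in base `M`. -/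
def digitSet (M K x : ℕ) : Set ℕ := {a | ∃ i < K, x / M ^ i % M = a}

theorem forall_digit_eq_zero_iff {M : ℕ} (hM : 0 < M) (y i : ℕ) :
    (∀ j < i, y / M ^ j % M = 0) ↔ M ^ i ∣ y := by
  induction i with
  | zero => simp
  | succ i ih =>
    rw [Nat.forall_lt_succ_right, ih, ← Nat.dvd_iff_mod_eq_zero]
    constructor
    · rintro ⟨⟨z, rfl⟩, h⟩
      rw [Nat.mul_div_cancel_left _ (by positivity)] at h
      rw [pow_succ]
      exact Nat.mul_dvd_mul_left _ h
    · rintro ⟨z, rfl⟩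
      rw [pow_succ, mul_assoc, Nat.mul_div_cancel_left _ (by positivity)]
      exact ⟨⟨_, rfl⟩, ⟨_, rfl⟩⟩

/-- How adding `1` affects the digits: there is a carry as long as zeros are produced. -/
theorem digit_add_one {M : ℕ} (hM : 0 < M) (x i : ℕ) :
    (x + 1) / M ^ i % M = if ∀ j < i, (x + 1) / M ^ j % M = 0 then
      if x / M ^ i % M + 1 < M then x / M ^ i % M + 1 else 0 else x / M ^ i % M := by
  simp only [forall_digit_eq_zero_iff hM]
  rw [Nat.succ_div]
  split_ifs with h1 h2
  · rw [Nat.add_mod, Nat.mod_eq_of_lt (b := M) (a := _ + _)] <;>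
      rcases Nat.lt_or_ge 1 M with h | h
    · rw [Nat.mod_eq_of_lt h]
    · omega
    · rwa [Nat.mod_eq_of_lt h]
    · omega
  · have h3 := Nat.mod_lt (x / M ^ i) hM
    rw [← Nat.dvd_iff_mod_eq_zero, (Nat.modEq_zero_iff_dvd).symm]
    refine ((Nat.mod_modEq (x / M ^ i) M).symm.add_right 1).trans ?_
    rw [show x / M ^ i % M + 1 = M by omega]
    exact Nat.modEq_zero_iff_dvd.2 dvd_rfl
  · rfl

theorem dist_le_of_isPerfect {M K x : ℕ}
    (h : D.IsPerfect (Reversed Q (digitSet M K x)) Finset.univ) : D.dist Q ≤ K := by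
  rw [DAG.dist]
  calc _ = (CIQuery.code '' {q : CIQuery n | ¬ (Q q = true ↔ D.Indep q)}).ncard :=
        (Set.ncard_image_of_injective _ CIQuery.code_injective).symm
    _ ≤ (((Finset.range K).image fun i => x / M ^ i % M : Finset ℕ) : Set ℕ).ncard := by
        refine Set.ncard_le_ncard ?_ (Finset.finite_toSet _)
        rintro _ ⟨q, hq, rfl⟩
        obtain ⟨i, hi, h⟩ := (isPerfect_reversed_iff.1 h q).1 hq
        exact Finset.mem_coe.2 (Finset.mem_image.2 ⟨i, Finset.mem_range.2 hi, h⟩)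
    _ ≤ K := by
        rw [Set.ncard_coe_finset]
        exact Finset.card_image_le.trans (Finset.card_range K).le

/-- If `D` is within distance `k` to `Q`, then its errors are the digits of some number. -/
theorem exists_digitSet {k : ℕ} (hn : 1 ≤ n) (h : D.dist Q ≤ k) :
    ∃ x < (n * n * 2 ^ n) ^ min k (n * n * 2 ^ n),
      D.IsPerfect (Reversed Q (digitSet (n * n * 2 ^ n) (min k (n * n * 2 ^ n)) x)) Finset.univ := by
  classical
  set M := n * n * 2 ^ n with hM
  have hpos : 0 < M := by positivity
  set E : Set (CIQuery n) := {q | ¬ (Q q = true ↔ D.Indep q)} with hE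
  have hfin : (CIQuery.code '' E).Finite := Set.toFinite _
  set l := hfin.toFinset.toList with hl
  have hmem : ∀ a, a ∈ l ↔ ∃ q ∈ E, q.code = a := by simp [hl]
  have hlM : ∀ a ∈ l, a < M := by
    intro a ha
    obtain ⟨q, -, rfl⟩ := (hmem a).1 ha
    exact q.code_lt
  have hlen : l.length ≤ min k M := by
    rw [hl, Finset.length_toList]
    refine le_min ?_ ?_
    · rw [← Set.ncard_eq_toFinset_card _ hfin, Set.ncard_image_of_injective _ CIQuery.code_injective]
      exact h
    · refine (Finset.card_le_card (t := Finset.range M) fun a ha => ?_).trans (Finset.card_range M).le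
      exact Finset.mem_range.2 (hlM a (Finset.mem_toList.2 ha))
  have hd : ∀ i, l.getD i 0 < M := by
    intro i
    rcases lt_or_ge i l.length with hi | hi
    · rw [List.getD_eq_getElem _ _ hi]
      exact hlM _ (List.getElem_mem hi)
    · rwa [List.getD_eq_default _ _ hi]
  set x : Fin (M ^ min k M) := finFunctionFinEquiv fun i : Fin (min k M) => ⟨l.getD i 0, hd i⟩ with hx
  have hdig : ∀ i < min k M, (x : ℕ) / M ^ i % M = l.getD i 0 := by
    intro i hi
    have := finFunctionFinEquiv_symm_apply_val x ⟨i, hi⟩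
    rw [hx, Equiv.symm_apply_apply] at this
    exact this.symm
  refine ⟨x, x.2, isPerfect_reversed_iff.2 fun q => ?_⟩
  constructor
  · intro hq
    obtain ⟨i, hi, h⟩ := List.getElem_of_mem ((hmem q.code).2 ⟨q, hq, rfl⟩)
    refine ⟨i, hi.trans_le hlen, ?_⟩
    rw [hdig i (hi.trans_le hlen), List.getD_eq_getElem _ _ hi, h]
  · rintro ⟨i, hi, h⟩
    rw [hdig i hi] at h
    rcases lt_or_ge i l.length with hi' | hi'
    · rw [List.getD_eq_getElem _ _ hi'] at h
      obtain ⟨q', hq', h'⟩ := (hmem _).1 (h ▸ List.getElem_mem hi')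
      rwa [← CIQuery.code_injective h']
    · rw [List.getD_eq_default _ _ hi'] at h
      exact (q.code_ne_zero h.symm).elim

/-! ### The graphs found -/

/-- `D` is the perfect map for `ρ` that the algorithm finds. -/
def ReadOff (ρ : Fin n → Fin n → Finset (Fin n) → Prop) (D : DAG (Fin n)) : Prop :=
  D.IsPerfect ρ Finset.univ ∧ ∃ c, IsChoice ρ c ∧ ∀ u v, D.Adj u v ↔ ChosenAdj ρ c u v

theorem DAG.eq_of_adj (h : ∀ u v, D.Adj u v ↔ D'.Adj u v) : D = D' := by
  obtain ⟨⟨a⟩, _⟩ := D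
  obtain ⟨⟨b⟩, _⟩ := D'
  obtain rfl : a = b := funext fun u => funext fun v => propext (h u v)
  rfl

theorem ReadOff.unique {ρ : Fin n → Fin n → Finset (Fin n) → Prop} (h : ReadOff ρ D)
    (h' : ReadOff ρ D') : D = D' := by
  obtain ⟨-, c, hc, e⟩ := h
  obtain ⟨-, c', hc', e'⟩ := h'
  exact DAG.eq_of_adj fun u v => (e u v).trans ((ChosenAdj.congr hc hc' u v).trans (e' u v).symm)

/-- What is known after the sets `B y` with `y < x` are tried as sets of errors: `N` is the number
of graphs found, with `2` standing for at least two, and `a` is the adjacency matrix of the first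
one. -/
inductive Record (Q : CIOracle n) (B : ℕ → Set ℕ) (x : ℕ) : ℕ → (Fin n → Fin n → ℕ) → Prop
  | zero (a) : (∀ y < x, ∀ D : DAG (Fin n), ¬ D.IsPerfect (Reversed Q (B y)) Finset.univ) →
      Record Q B x 0 a
  | one (a) (y : ℕ) (D : DAG (Fin n)) : y < x → ReadOff (Reversed Q (B y)) D →
      (∀ u v, (D.Adj u v → a u v = 1) ∧ (¬ D.Adj u v → a u v = 0)) →
      (∀ z < x, ∀ D' : DAG (Fin n), D'.IsPerfect (Reversed Q (B z)) Finset.univ →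
        D.IsPerfect (Reversed Q (B z)) Finset.univ) → Record Q B x 1 a
  | two (a) (y z : ℕ) (D D' : DAG (Fin n)) : y < x → z < x →
      D.IsPerfect (Reversed Q (B y)) Finset.univ → D'.IsPerfect (Reversed Q (B z)) Finset.univ →
      ¬ MarkovEquiv D D' → Record Q B x 2 a

variable {B : ℕ → Set ℕ} {x N : ℕ} {a : Fin n → Fin n → ℕ} {c : ℕ → ℕ}

theorem Record.le_two (h : Record Q B x N a) : N ≤ 2 := by
  cases h <;> omega

theorem Record.step_of_eq_zero (h : Record Q B x N a) (hc : IsChoice (Reversed Q (B x)) c)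
    (h0 : c (2 ^ n - 1) = 0) : Record Q B (x + 1) N a := by
  have hx : ∀ D : DAG (Fin n), ¬ D.IsPerfect (Reversed Q (B x)) Finset.univ :=
    fun D hD => hc.ne_zero hD (by rwa [setCode_univ])
  cases h with
  | zero _ h => exact .zero _ (Nat.forall_lt_succ_right.2 ⟨h, hx⟩)
  | one _ y D hy hD ha h =>
    exact .one _ y D (by omega) hD ha
      (Nat.forall_lt_succ_right.2 ⟨h, fun D' hD' => (hx D' hD').elim⟩)
  | two _ y z D D' hy hz hD hD' h => exact .two _ y z D D' (by omega) (by omega) hD hD' h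

open Classical in
theorem Record.step (h : Record Q B x N a) (hc : IsChoice (Reversed Q (B x)) c) :
    Record Q B (x + 1) (if c (2 ^ n - 1) = 0 then N else if N = 0 then 1 else
        if ∃ u v : Fin n, a u v ≠ if ChosenAdj (Reversed Q (B x)) c u v then 1 else 0 then 2 else N)
      fun u v => if c (2 ^ n - 1) ≠ 0 ∧ N = 0 then
        if ChosenAdj (Reversed Q (B x)) c u v then 1 else 0 else a u v := by
  by_cases h0 : c (2 ^ n - 1) = 0
  · simp only [h0, if_true, ne_eq, not_true_eq_false, false_and, if_false]
    exact h.step_of_eq_zero hc h0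
  obtain ⟨E, hE, hadj⟩ := hc.exists_dag reversed_comm h0
  have hread : ReadOff (Reversed Q (B x)) E := ⟨hE, c, hc, hadj⟩
  simp only [h0, if_false, ne_eq, not_false_eq_true, true_and, ← hadj]
  cases h with
  | zero _ h =>
    simp only [if_true]
    exact .one _ x E (by omega) hread (fun u v => ⟨fun h => if_pos h, fun h => if_neg h⟩)
      (Nat.forall_lt_succ_right.2 ⟨fun y hy D hD => (h y hy D hD).elim, fun _ _ => hE⟩)
  | one _ y D hy hD ha h =>
    simp only [one_ne_zero, if_false]
    have hval : ∀ u v, a u v = if D.Adj u v then 1 else 0 := by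
      intro u v
      split_ifs with huv
      exacts [(ha u v).1 huv, (ha u v).2 huv]
    split_ifs with hne
    · refine .two _ y x D E (by omega) (by omega) hD.1 hE fun hDE => ?_
      -- equivalent graphs have the same table of possible sinks and hence the same arcs
      rw [← reversed_eq_of_markovEquiv hD.1 hE hDE] at hread
      obtain ⟨u, v, huv⟩ := hne
      rw [hval, hD.unique hread] at huv
      exact huv rfl
    · push Not at hne
      obtain rfl : D = E := by
        refine DAG.eq_of_adj fun u v => ?_
        have := hne u v
        rw [hval] at this
        split_ifs at this <;> tauto
      exact .one _ y D (by omega) hD ha (Nat.forall_lt_succ_right.2 ⟨h, fun _ _ => hE⟩)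
  | two _ y z D D' hy hz hD hD' h =>
    simp only [OfNat.ofNat_ne_zero, if_false, ite_self]
    exact .two _ y z D D' (by omega) (by omega) hD hD' h

end

/-! ### The search -/

/-- The program that tests all vectors of digits. -/
def searchProg : Prog := .loop (20 : Fin 24) (21 : Fin 24) testProg

section

variable {n : ℕ} {Q : CIOracle n} {g g' : Globals} {m m' : ℕ → ℕ}

/-- The situation before the digits of `x` are tested. -/
structure SearchInv (Q : CIOracle n) (g : Globals) (x : ℕ) (g' : Globals) (m' : ℕ → ℕ) : Prop where
  globals : ∀ i : Fin 24, i.val < 9 ∨ i = 21 → g' i = g i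
  flag : g' 20 = 0 ↔ x < g 4 ^ g 5
  table : ∀ (u v : Fin n) S, m' (g 4 + code u v S) ≠ 0 ↔ Q.Indep u v S
  digits : ∀ i < g 5, m' (g 6 + i) = x / g 4 ^ i % g 4
  arcs : ∀ u v : Fin n, m' (u * n + v) ≤ 1
  record : Record Q (digitSet (g 4) (g 5)) x (g' 22) fun u v => m' (u * n + v)

theorem SearchInv.memIndep_eq {x : ℕ} (h : SearchInv Q g x g' m') :
    (MemIndep g' m' : Fin n → Fin n → Finset (Fin n) → Prop) =
      Reversed Q (digitSet (g 4) (g 5) x) := by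
  have key : ∀ u v S, EntryHolds g' m' (code u v S) ↔
      ¬ (Q.Indep u v S ↔ code u v S ∈ digitSet (g 4) (g 5) x) := by
    intro u v S
    rw [EntryHolds, h.globals 4 (by simp), h.globals 5 (by simp), h.globals 6 (by simp), h.table]
    refine not_congr (iff_congr Iff.rfl (exists_congr fun i => and_congr_right fun hi => ?_))
    rw [h.digits i hi]
  funext u v S
  rw [MemIndep, Reversed, key, key, CIOracle.indep_comm (u := v)]
  split_ifs <;> rfl

theorem SearchInv.step {x : ℕ} (hL : Layout n g) (h : SearchInv Q g x g' m') (hx : x < g 4 ^ g 5)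
    {g'' : Globals} {m'' c : ℕ → ℕ} (ht : TestRel n g' m' g'' m'' c) :
    SearchInv Q g (x + 1) g'' m'' := by
  obtain ⟨hc, hg, hm, hcount, harcs, hdig, hflag⟩ := ht
  have hpos : 0 < g 4 := by have := hL.two_le_g4; omega
  have h6 := hL.g6
  rw [h.memIndep_eq] at hc hcount harcs
  rw [h.globals 4 (by simp), h.globals 6 (by simp)] at hm
  rw [h.globals 5 (by simp), h.globals 4 (by simp), h.globals 6 (by simp)] at hdig
  rw [h.globals 5 (by simp), h.globals 6 (by simp)] at hflag
  have hdig' : ∀ i < g 5, m'' (g 6 + i) = (x + 1) / g 4 ^ i % g 4 := by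
    intro i
    induction i using Nat.strong_induction_on with
    | _ i ih =>
      intro hi
      rw [hdig i hi, digit_add_one hpos, h.digits i hi]
      refine if_congr (forall_congr' fun j => imp_congr_right fun hj => ?_) rfl rfl
      rw [ih j hj (by omega)]
  refine ⟨fun i hi => (hg i hi).trans (h.globals i hi), ?_, fun u v S => ?_, hdig', fun u v => ?_, ?_⟩
  · rw [← not_iff_not, ← ne_eq, hflag, not_lt]
    have : (∀ i < g 5, m'' (g 6 + i) = 0) ↔ g 4 ^ g 5 ∣ x + 1 := by
      rw [← forall_digit_eq_zero_iff hpos]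
      exact forall_congr' fun i => imp_congr_right fun hi => by rw [hdig' i hi]
    rw [this]
    exact ⟨Nat.le_of_dvd (by omega), fun h => (le_antisymm h hx) ▸ dvd_rfl⟩
  · have := hL.g4 ▸ code_lt u v S
    rw [hm _ (by omega) (by omega), h.table]
  · have := h.arcs u v
    rw [harcs]
    split_ifs <;> omega
  · have := h.record.step hc
    rw [hcount]
    simp only [harcs]
    convert this using 1

theorem exists_runs_searchProg : ∃ c, ∀ (n : ℕ) (Q : CIOracle n) (g : Globals) (m : ℕ → ℕ),
    Layout n g → g 21 = 1 → SearchInv Q g 0 g m →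
      Runs Q searchProg (g 4 ^ g 5 * ((g 2 + 2) ^ c + 1) + 1) g m (SearchInv Q g (g 4 ^ g 5)) := by
  obtain ⟨c, hc⟩ := poly_testProg
  refine ⟨c, fun n Q g m hL h21 h0 => Runs.loop _ ?_ ?_ ?_ h0⟩
  · intro x hx g' m' h
    have := h.flag.2 hx
    have := h.globals 21 (by simp)
    omega
  · intro g' m' h
    have := mt h.flag.1 (lt_irrefl _)
    have := h.globals 21 (by simp)
    omega
  · intro x hx g' m' h
    have e2 := h.globals 2 (by simp)
    have hpos : 0 < g 4 := by have := hL.two_le_g4; omega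
    have hpre : TestPre n g' m' := by
      refine ⟨hL.congr fun i hi => h.globals i (.inl hi), h.record.le_two, h.arcs, ?_⟩
      rw [h.globals 4 (by simp), h.globals 5 (by simp), h.globals 6 (by simp)]
      intro i hi
      rw [h.digits i hi]
      exact Nat.mod_lt _ hpos
    refine (hc n Q g' m' hpre.layout.two_le hpre).mono (by rw [e2]) ?_
    rintro g'' m'' ⟨c, ht⟩
    exact h.step hL hx ht

end

/-! ### The whole program -/

/-- The program that solves the problem. -/
def mainProg : Prog :=
  .seq capProg (.seq layoutProg (.seq tableProg (.seq searchProg (assign 0 (.glob 22)))))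

/-- There is a correct output that is presented if `N` is in register `0` and `m` in the memory. -/
def Correct {n : ℕ} (Q : CIOracle n) (k : ℕ) (N : ℕ) (m : ℕ → ℕ) : Prop :=
  ∃ a : Answer n, (∀ s : State, s.reg 0 = N → s.mem = m → Presents s a) ∧ IsCorrect Q k a

/-- After the search, what has been recorded is correct: every graph within distance `k` has been
tested. -/
theorem SearchInv.correct {n k : ℕ} {Q : CIOracle n} {g g' : Globals} {m' : ℕ → ℕ}
    (hL : Layout n g) (h5 : g 5 = min k (g 4)) (h : SearchInv Q g (g 4 ^ g 5) g' m') :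
    Correct Q k (g' 22) m' := by
  have hle : g 5 ≤ k := by omega
  have hex : ∀ D : DAG (Fin n), D.dist Q ≤ k → ∃ x < g 4 ^ g 5,
      D.IsPerfect (Reversed Q (digitSet (g 4) (g 5) x)) Finset.univ := by
    rw [h5, hL.g4]
    exact fun D hD => exists_digitSet hL.pos hD
  have hr := h.record
  generalize g' 22 = N at hr
  cases hr with
  | zero _ h =>
    refine ⟨.nonexistent, fun s hs _ => hs, fun D hD => ?_⟩
    obtain ⟨x, hx, hDx⟩ := hex D hD
    exact h x hx D hDx
  | one _ y D hy hD ha h =>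
    refine ⟨.dag D, fun s hs hm => ⟨hs, by rwa [hm]⟩, (dist_le_of_isPerfect hD.1).trans hle, ?_⟩
    intro D' hD'
    obtain ⟨x, hx, hDx⟩ := hex D' hD'
    exact markovEquiv_of_isPerfect (h x hx D' hDx) hDx
  | two _ y z D D' hy hz hD hD' h =>
    exact ⟨.notUnique, fun s hs _ => hs, D, D', (dist_le_of_isPerfect hD).trans hle,
      (dist_le_of_isPerfect hD').trans hle, h⟩

theorem time_bound {n k C t N : ℕ} (hn : 1 ≤ n)
    (hN : N = (n * n * 2 ^ n) ^ min k (n * n * 2 ^ n)) (ht : t ≤ N * (16 ^ (n + 1) + 2) ^ C) :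
    t ≤ n ^ (2 * k + 12 * C) * 2 ^ (n * (k + 12 * C)) := by
  have h1 : N ≤ n ^ (2 * k) * 2 ^ (n * k) := by
    rw [hN]
    calc _ ≤ (n * n * 2 ^ n) ^ k :=
          Nat.pow_le_pow_right (by positivity) (min_le_left _ _)
      _ = _ := by rw [mul_pow, ← sq, ← pow_mul, ← pow_mul]
  have h2 : 16 ^ (n + 1) + 2 ≤ 2 ^ (12 * n) := by
    have hp : 1 ≤ 16 ^ (n + 1) := Nat.one_le_pow _ _ (by omega)
    calc 16 ^ (n + 1) + 2 ≤ 16 ^ (n + 1) * 16 := by omega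
      _ = 16 ^ (n + 2) := by rw [← pow_succ]
      _ ≤ 16 ^ (3 * n) := Nat.pow_le_pow_right (by omega) (by omega)
      _ = 2 ^ (12 * n) := by
        rw [show 12 * n = 4 * (3 * n) by ring, pow_mul 2 4]
        norm_num
  calc t ≤ N * (16 ^ (n + 1) + 2) ^ C := ht
    _ ≤ n ^ (2 * k) * 2 ^ (n * k) * (2 ^ (12 * n)) ^ C := by gcongr
    _ = n ^ (2 * k) * 2 ^ (n * (k + 12 * C)) := by
      rw [← pow_mul, mul_assoc, ← pow_add]
      congr 2
      ring
    _ ≤ n ^ (2 * k + 12 * C) * 2 ^ (n * (k + 12 * C)) := by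
      gcongr; omega

theorem exists_runs_mainProg : ∃ C, ∀ (n k : ℕ), 1 ≤ n → ∀ Q : CIOracle n,
    Runs Q mainProg ((n * n * 2 ^ n) ^ min k (n * n * 2 ^ n) * (16 ^ (n + 1) + 2) ^ C)
      (fun i => (initState n k).reg i) (fun _ => 0) fun g m => Correct Q k (g 0) m := by
  obtain ⟨c₁, h₁⟩ := poly_layoutProg
  obtain ⟨c₂, h₂⟩ := poly_tableProg
  obtain ⟨c₃, h₃⟩ := exists_runs_searchProg
  obtain ⟨c₄, h₄⟩ := poly_assign 0 (.glob 22)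
  refine ⟨3 + c₁ + c₂ + c₃ + c₄ + 1, fun n k hn Q => ?_⟩
  set B := 16 ^ (n + 1) + 2 with hB
  set M := n * n * 2 ^ n with hM
  have hB2 : 18 ≤ B := by
    have : 16 ^ 1 ≤ 16 ^ (n + 1) := Nat.pow_le_pow_right (by omega) (by omega)
    omega
  refine Runs.mono (T := B ^ 3 + (B ^ c₁ + (B ^ c₂ + ((M ^ min k M * (B ^ c₃ + 1) + 1) + B ^ c₄))))
    (R := fun g m => Correct Q k (g 0) m) ?_ ?_ fun _ _ h => h
  · refine (runs_capProg Q (by simp [initState]) (by simp [initState])).seq ?_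
    rintro g m ⟨e0, e1, e2, e20, e22, rfl⟩
    have eB : g 2 + 2 = B := by rw [e2]
    have hcap : 2 ≤ g 2 := by omega
    refine ((h₁ n Q g _ hcap ⟨hn, e0, e2⟩).mono (by rw [eB]) fun _ _ h => h).seq ?_
    rintro g₁ m₁ ⟨e2', hL, h5, h21, e20', e22', rfl⟩
    have eB' : g₁ 2 + 2 = B := by rw [e2', eB]
    refine ((h₂ n Q g₁ _ hL.two_le hL).mono (by rw [eB']) fun _ _ h => h).seq ?_
    rintro g₂ m₂ ⟨hs, hm, ht⟩
    have hs9 : ∀ i : Fin 24, i.val < 9 → g₂ i = g₁ i := fun i hi => hs i (.inl hi)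
    have hL₂ : Layout n g₂ := hL.congr hs9
    have eB₂ : g₂ 2 + 2 = B := by rw [hs9 2 (by simp), eB']
    have h5' : g₂ 5 = min k (g₂ 4) := by
      rw [hs9 5 (by simp), hs9 4 (by simp), h5, e1]
      simp [initState]
    have e4 : g₂ 4 = M := hL₂.g4
    have hinit : SearchInv Q g₂ 0 g₂ m₂ := by
      have h4 := hL.le_g4
      have h5 := hL.g5
      have h6 := hL.g6
      have h7 := hL.g7
      have h8 := hL.g8
      have e20₂ : g₂ 20 = 0 := by
        rw [hs 20 (by simp), e20', e20]
        simp [initState]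
      have e22₂ : g₂ 22 = 0 := by
        rw [hs 22 (by simp), e22', e22]
        simp [initState]
      refine ⟨fun _ _ => rfl, ?_, fun u v S => ?_, fun i hi => ?_, fun u v => ?_, ?_⟩
      · simp only [e20₂, true_iff]
        have := hL₂.two_le_g4
        positivity
      · rw [hs9 4 (by simp), ht]
      · rw [hs9 5 (by simp)] at hi
        rw [hs9 6 (by simp), hm _ (by omega) (by omega)]
        simp
      · have := index_lt u v
        rw [hm _ (by omega) (by omega)]
        exact Nat.zero_le 1
      · rw [e22₂]
        exact .zero _ fun y hy => (Nat.not_lt_zero _ hy).elim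
    refine ((h₃ n Q g₂ m₂ hL₂ (by rw [hs 21 (by simp), h21]) hinit).mono
      (by rw [eB₂, h5', e4]) fun _ _ h => h).seq ?_
    intro g₃ m₃ h
    have eg₃ : g₃ 2 = g₂ 2 := h.globals 2 (by simp)
    refine (h₄ n Q g₃ m₃ (by omega) trivial).mono (by rw [eg₃, eB₂]) ?_
    rintro g₄ m₄ ⟨rfl, rfl⟩
    have := h.record.le_two
    rw [Function.update_self, Expr.eval, min_eq_left (by omega)]
    exact h.correct hL₂ h5'
  · have hN : 1 ≤ M ^ min k M := Nat.one_le_pow _ _ (by positivity)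
    set N := M ^ min k M with hN'
    set s := 3 + c₁ + c₂ + c₃ + c₄ with hs
    have hle : ∀ i ≤ s, B ^ i ≤ N * B ^ s := fun i hi =>
      (Nat.pow_le_pow_right (by omega) hi).trans (Nat.le_mul_of_pos_left _ hN)
    have h0 : 1 ≤ N * B ^ s := by simpa using hle 0 (by omega)
    have h1 := hle 3 (by omega)
    have h2 := hle c₁ (by omega)
    have h3 := hle c₂ (by omega)
    have h4 := hle c₄ (by omega)
    have h5 : N * (B ^ c₃ + 1) ≤ 2 * (N * B ^ s) := by
      have h6 : B ^ c₃ ≤ B ^ s := Nat.pow_le_pow_right (by omega) (by omega)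
      have h7 : 1 ≤ B ^ s := Nat.one_le_pow _ _ (by omega)
      calc N * (B ^ c₃ + 1) ≤ N * (B ^ s + B ^ s) := Nat.mul_le_mul_left _ (by omega)
        _ = 2 * (N * B ^ s) := by ring
    calc _ ≤ N * B ^ s * 18 := by omega
      _ ≤ N * B ^ s * B := Nat.mul_le_mul_left _ hB2
      _ = N * B ^ (s + 1) := by rw [pow_succ, mul_assoc]

end BNSL

theorem mainTheorem5 :
    ∃ (P : BNSL.Prog) (c : ℕ), ∀ (n k : ℕ), 1 ≤ n → ∀ Q : BNSL.CIOracle n,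
      ∃ (t : ℕ) (s : BNSL.State) (a : BNSL.Answer n),
        BNSL.Exec Q P (BNSL.initState n k) t s ∧
        BNSL.Presents s a ∧ BNSL.IsCorrect Q k a ∧
        t ≤ n ^ (2 * k + c) * 2 ^ (n * (k + c)) := by
  obtain ⟨C, hC⟩ := BNSL.exists_runs_mainProg
  refine ⟨BNSL.mainProg, 12 * C, fun n k hn Q => ?_⟩
  obtain ⟨t, s, he, ht, a, hp, ha⟩ := hC n k hn Q (BNSL.initState n k) (fun _ => rfl) rfl
  exact ⟨t, s, a, he, hp s rfl rfl, ha, BNSL.time_bound hn rfl ht⟩
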